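/- Let $n\ge 1$, $2\le p<\infty$, $T>0$, and let $\Omega\subset\mathbb{R}^n$ be a bounded domain satisfying the exterior sphere condition: for every $y\in\partial\Omega$ there is an open ball $B_\delta(z)\subset\mathbb{R}^n\setminus\Omega$, $\delta>0$, with $y\in\partial B_\delta(z)$. Put $\Omega_T=\Omega\times(0,T)$, $\Gamma_p=(\partial\Omega\times[0,T])\cup(\Omega\times\{0\})$ and, for $\varepsilon>0$, $S_\varepsilon=\{x\in\mathbb{R}^n\setminus\Omega:\operatorname{dist}(x,\partial\Omega)\le\varepsilon\}$ and $$\Gamma_p^\varepsilon=\Big(S_\varepsilon\times(-\tfrac{\varepsilon^2}{2},T]\Big)\cup\Big(\Omega\times(-\tfrac{\varepsilon^2}{2},0]\Big).$$ Let $\varepsilon_0>0$, and let $F:\Gamma_p^{\varepsilon_0}\to\mathbb{R}$ and $\psi:\mathbb{R}^{n+1}\to\mathbb{R}$ satisfy, for some constants $C_1,C_2$ and all points of their domains, $$|F(x,t)-F(y,s)|\le C_1\big(|x-y|+|t-s|^{1/2}\big),\qquad |\psi(x,t)-\psi(y,s)|\le C_2\big(|x-y|+|t-s|^{1/2}\big),$$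 and $\psi\le F$ on $\Gamma_p^{\varepsilon_0}$. Let $\alpha=\frac{p-2}{p+n}$ and $\beta=\frac{n+2}{p+n}$ and, for $0<\varepsilon\le\varepsilon_0$, let $u^\varepsilon:\Omega_T\cup\Gamma_p^\varepsilon\to\mathbb{R}$ be the bounded Borel function with $u^\varepsilon=F$ on $\Gamma_p^\varepsilon$ and, for $(x,t)\in\Omega_T$, $$u^\varepsilon(x,t)=\max\Big\{\psi(x,t),\ \tfrac{\alpha}{2}\Big(\sup_{y\in B_\varepsilon(x)}u^\varepsilon(y,t-\tfrac{\varepsilon^2}{2})+\inf_{y\in B_\varepsilon(x)}u^\varepsilon(y,t-\tfrac{\varepsilon^2}{2})\Big)+\frac{\beta}{|B_\varepsilon(x)|}\int_{B_\varepsilon(x)}u^\varepsilon(y,t-\tfrac{\varepsilon^2}{2})\,dy\Big\}.$$ Then, as $\varepsilon\to0^+$, $u^\varepsilon$ converges uniformly on $\Omega_T\cup\Gamma_p$, and its limit extends to a continuous function $u:\overline{\Omega_T}\to\mathbb{R}$ which is a viscosity solution of $$\min\big\{(n+p)u_t-[(p-2)\Delta_\infty u+\Delta u],\ u-\psi\big\}=0\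 \text{ in }\Omega_T,\qquad u=F\ \text{ on }\Gamma_p,\qquad u\ge\psi\ \text{ in }\Omega_T,$$ in the following sense: $u$ is continuous on $\overline{\Omega_T}$, $u=F$ on $\Gamma_p$, $u\ge\psi$ in $\Omega_T$, and for every $(x_0,t_0)\in\Omega_T$ and every $\varphi$ of class $C^{2,1}$ (twice continuously differentiable in $x$, once in $t$) near $(x_0,t_0)$, with all derivatives evaluated at $(x_0,t_0)$: (i) if $u-\varphi$ has a local minimum at $(x_0,t_0)$, then $(n+p)\varphi_t\ge(p-2)\Delta_\infty\varphi+\Delta\varphi$ if $\nabla\varphi\ne0$, and $(n+p)\varphi_t\ge(p-2)\lambda_{\min}(D^2\varphi)+\Delta\varphi$ if $\nabla\varphi=0$; (ii) if $u-\varphi$ has a local maximum at $(x_0,t_0)$, then either $u(x_0,t_0)=\psi(x_0,t_0)$, or $(n+p)\varphi_t\le(p-2)\Delta_\infty\varphi+\Delta\varphi$ if $\nabla\varphi\ne0$, and $(n+p)\varphi_t\le(p-2)\lambda_{\max}(D^2\varphi)+\Delta\varphi$ if $\nabla\varphi=0$. Here $\nabla$, $D^2$ and $\Delta$ act in the space variable,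 $\Delta_\infty\varphi=\langle D^2\varphi\,\nabla\varphi,\nabla\varphi\rangle/|\nabla\varphi|^2$, and $\lambda_{\min}$, $\lambda_{\max}$ are the smallest and largest eigenvalues. -/

import Mathlib

open Set Filter Topology MeasureTheory

noncomputable section

namespace TugOfWar

/-- Points `(x, t)` of space-time, with `x` in Euclidean `n`-space. -/
abbrev SpaceTime (n : ℕ) : Type := EuclideanSpace ℝ (Fin n) × ℝ

variable {n : ℕ}

/-! ### Domains -/

/-- The parabolic cylinder `Ω × (0, T)`. -/
def cylinder (Ω : Set (EuclideanSpace ℝ (Fin n))) (T : ℝ) : Set (SpaceTime n) :=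
  Ω ×ˢ Ioo 0 T

/-- The parabolic boundary `(∂Ω × [0, T]) ∪ (Ω × {0})`. -/
def parabolicBoundary (Ω : Set (EuclideanSpace ℝ (Fin n))) (T : ℝ) : Set (SpaceTime n) :=
  frontier Ω ×ˢ Icc 0 T ∪ Ω ×ˢ {0}

/-- The outer strip of width `ε` around the boundary of `Ω`. -/
def outerStrip (Ω : Set (EuclideanSpace ℝ (Fin n))) (ε : ℝ) : Set (EuclideanSpace ℝ (Fin n)) :=
  {x | x ∉ Ω ∧ Metric.infDist x (frontier Ω) ≤ ε}

/-- The parabolic boundary strip of width `ε`. -/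
def parabolicStrip (Ω : Set (EuclideanSpace ℝ (Fin n))) (T ε : ℝ) : Set (SpaceTime n) :=
  outerStrip Ω ε ×ˢ Ioc (-(ε ^ 2 / 2)) T ∪ Ω ×ˢ Ioc (-(ε ^ 2 / 2)) 0

/-- Every boundary point of `Ω` lies on the boundary of an open ball of positive radius that does
not meet `Ω`. -/
def ExteriorSphereCondition (Ω : Set (EuclideanSpace ℝ (Fin n))) : Prop :=
  ∀ y ∈ frontier Ω, ∃ z : EuclideanSpace ℝ (Fin n), ∃ δ : ℝ,
    0 < δ ∧ Metric.ball z δ ⊆ Ωᶜ ∧ y ∈ Metric.sphere z δ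

/-- Lipschitz continuity on `S` for the parabolic distance `|x - y| + |t - s| ^ (1 / 2)`. -/
def ParabolicLipschitzOn (C : ℝ) (f : SpaceTime n → ℝ) (S : Set (SpaceTime n)) : Prop :=
  ∀ z ∈ S, ∀ w ∈ S, |f z - f w| ≤ C * (‖z.1 - w.1‖ + √|z.2 - w.2|)

/-! ### The dynamic programming principle -/

/-- `u` is a bounded Borel function on `Ω_T ∪ Γ_p^ε` which satisfies the dynamic programming
principle of the game with step `ε`, obstacle `ψ` and boundary payoff `F`, for the weights
`α = (p - 2) / (p + n)` and `β = (n + 2) / (p + n)`. Values of `u` elsewhere play no role. -/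
structure IsDPPSolution (Ω : Set (EuclideanSpace ℝ (Fin n))) (T p : ℝ) (F ψ : SpaceTime n → ℝ)
    (ε : ℝ) (u : SpaceTime n → ℝ) : Prop where
  borel : Measurable fun z : ↥(cylinder Ω T ∪ parabolicStrip Ω T ε) => u z
  bounded : ∃ M : ℝ, ∀ z ∈ cylinder Ω T ∪ parabolicStrip Ω T ε, |u z| ≤ M
  interior : ∀ z ∈ cylinder Ω T,
    u z = max (ψ z)
      ((p - 2) / (p + n) / 2 *
          ((⨆ y : Metric.ball z.1 ε, u (y, z.2 - ε ^ 2 / 2)) +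
            ⨅ y : Metric.ball z.1 ε, u (y, z.2 - ε ^ 2 / 2)) +
        (n + 2) / (p + n) * ⨍ y in Metric.ball z.1 ε, u (y, z.2 - ε ^ 2 / 2))
  boundary : ∀ z ∈ parabolicStrip Ω T ε, u z = F z

/-! ### Derivatives of test functions -/

/-- The time derivative. -/
def timeDeriv (φ : SpaceTime n → ℝ) (z : SpaceTime n) : ℝ :=
  deriv (fun s => φ (z.1, s)) z.2

/-- The gradient in the space variable. -/
def spaceGradient (φ : SpaceTime n → ℝ) (z : SpaceTime n) : EuclideanSpace ℝ (Fin n) :=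
  gradient (fun y => φ (y, z.2)) z.1

/-- The Hessian in the space variable, as a bilinear form. -/
def spaceHessian (φ : SpaceTime n → ℝ) (z : SpaceTime n) :
    EuclideanSpace ℝ (Fin n) →L[ℝ] EuclideanSpace ℝ (Fin n) →L[ℝ] ℝ :=
  fderiv ℝ (fderiv ℝ fun y => φ (y, z.2)) z.1

/-- The Hessian matrix in the space variable, in the standard basis. -/
def hessianMatrix (φ : SpaceTime n → ℝ) (z : SpaceTime n) : Matrix (Fin n) (Fin n) ℝ :=
  Matrix.of fun i j =>
    spaceHessian φ z (EuclideanSpace.single i 1) (EuclideanSpace.single j 1)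

/-- The Laplacian in the space variable. -/
def spaceLaplacian (φ : SpaceTime n → ℝ) (z : SpaceTime n) : ℝ :=
  (hessianMatrix φ z).trace

/-- The normalized infinity Laplacian `⟨D²φ ∇φ, ∇φ⟩ / |∇φ|²` (used only where `∇φ ≠ 0`). -/
def infinityLaplacian (φ : SpaceTime n → ℝ) (z : SpaceTime n) : ℝ :=
  spaceHessian φ z (spaceGradient φ z) (spaceGradient φ z) / ‖spaceGradient φ z‖ ^ 2

/-- The smallest eigenvalue (used only for symmetric matrices of positive size). -/
def lambdaMin (A : Matrix (Fin n) (Fin n) ℝ) : ℝ :=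
  sInf {μ : ℝ | Module.End.HasEigenvalue (Matrix.toLin' A) μ}

/-- The largest eigenvalue (used only for symmetric matrices of positive size). -/
def lambdaMax (A : Matrix (Fin n) (Fin n) ℝ) : ℝ :=
  sSup {μ : ℝ | Module.End.HasEigenvalue (Matrix.toLin' A) μ}

/-- `φ` is of class `C^{2,1}` on the open set `U`: it has continuous derivatives up to order two
in the space variable and of order one in time. -/
structure IsC21On (φ : SpaceTime n → ℝ) (U : Set (SpaceTime n)) : Prop where
  contDiffAt_space : ∀ z ∈ U, ContDiffAt ℝ 2 (fun y => φ (y, z.2)) z.1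
  differentiableAt_time : ∀ z ∈ U, DifferentiableAt ℝ (fun s => φ (z.1, s)) z.2
  continuousOn : ContinuousOn φ U
  continuousOn_gradient : ContinuousOn (spaceGradient φ) U
  continuousOn_hessian : ContinuousOn (spaceHessian φ) U
  continuousOn_timeDeriv : ContinuousOn (timeDeriv φ) U

/-! ### Viscosity solutions -/

/-- The inequality for test functions that touch from below. -/
def SupersolutionIneq (p : ℝ) (φ : SpaceTime n → ℝ) (z : SpaceTime n) : Prop :=
  (spaceGradient φ z ≠ 0 →
    (p - 2) * infinityLaplacian φ z + spaceLaplacian φ z ≤ (n + p) * timeDeriv φ z) ∧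
  (spaceGradient φ z = 0 →
    (p - 2) * lambdaMin (hessianMatrix φ z) + spaceLaplacian φ z ≤ (n + p) * timeDeriv φ z)

/-- The inequality for test functions that touch from above. -/
def SubsolutionIneq (p : ℝ) (φ : SpaceTime n → ℝ) (z : SpaceTime n) : Prop :=
  (spaceGradient φ z ≠ 0 →
    (n + p) * timeDeriv φ z ≤ (p - 2) * infinityLaplacian φ z + spaceLaplacian φ z) ∧
  (spaceGradient φ z = 0 →
    (n + p) * timeDeriv φ z ≤ (p - 2) * lambdaMax (hessianMatrix φ z) + spaceLaplacian φ z)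

/-- `u` is a viscosity solution of
`min {(n + p) u_t - [(p - 2) Δ_∞ u + Δ u], u - ψ} = 0` in `Ω × (0, T)` with `u = F` on the
parabolic boundary and `u ≥ ψ`. Only the values of `u` on the closed cylinder matter. -/
structure IsViscositySolution (Ω : Set (EuclideanSpace ℝ (Fin n))) (T p : ℝ)
    (F ψ : SpaceTime n → ℝ) (u : SpaceTime n → ℝ) : Prop where
  continuousOn : ContinuousOn u (closure (cylinder Ω T))
  boundary : ∀ z ∈ parabolicBoundary Ω T, u z = F z
  obstacle : ∀ z ∈ cylinder Ω T, ψ z ≤ u z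
  super : ∀ z ∈ cylinder Ω T, ∀ (φ : SpaceTime n → ℝ) (U : Set (SpaceTime n)),
    IsOpen U → z ∈ U → IsC21On φ U → IsLocalMin (fun w => u w - φ w) z →
      SupersolutionIneq p φ z
  sub : ∀ z ∈ cylinder Ω T, ∀ (φ : SpaceTime n → ℝ) (U : Set (SpaceTime n)),
    IsOpen U → z ∈ U → IsC21On φ U → IsLocalMax (fun w => u w - φ w) z →
      u z = ψ z ∨ SubsolutionIneq p φ z

end TugOfWar

end

/-! The game is a monotone, stable and consistent approximation of the obstacle problem, so the
method of half-relaxed limits applies. Let `v` and `w` be the upper relaxed limits of `u ε` and of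
`-u ε`. Always `0 ≤ v + w`. Once `v + w ≤ 0` is known on the closed cylinder, `v = -w` is continuous
and the convergence is uniform. Since the game step commutes with negation, `-u ε` is again a game
subsolution, with an irrelevant obstacle, so every estimate is proved only for subsolutions.

Consistency (`IsGameSubsolution.upperLimit_jet`). A quadratic test function is inserted at an
almost-contact point. Evaluating the infimum opposite to the maximizer `h₁` cancels the linear
terms, so the tug-of-war part yields `X h₁ h₁`, while the average yields the trace of `X`. If the
gradient is nonzero, `h₁` is nearly parallel to it, which gives the normalized infinity Laplacian.
If it vanishes, one only gets a bound by some `l ≥ 0` that dominates `X`. The sharp statement with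
extreme eigenvalues, needed when `X` is negative definite, is recovered in
`IsGameSubsolution.jet_gradient_zero` by a small linear tilt that makes the gradient nonzero.

Boundary values (`IsGameSubsolution.upperLimit_le_boundary`). Explicit strict supersolutions vanish
at the given boundary point and are large away from it: a paraboloid at the initial time and a
Gaussian profile centred in the exterior ball on the lateral boundary.

Comparison (`add_nonpos_of_jet_subsolutions`). Both limits are regularized by sup-convolution. At a
maximum of the sum, tilted by a small linear `q`, `exists_second_order_separation` produces opposite
Hessians and gradients that are opposite up to `q`. Its proof uses concave envelopes: they are of
class `C^{1,1}`, so their gradients are differentiable almost everywhere, and a Lipschitz map sends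
the bad null set to a null set of slopes, which a generic `q` avoids. The operator is discontinuous
at zero gradient. The kernel is therefore quartic in space near the origin, so that a small gradient
forces a small Hessian bound; its quadratic growth at infinity keeps the sup-convolutions
semiconvex. -/

noncomputable section

namespace TugOfWar

/-! ### Semiconvex functions and their concave envelopes -/

section Semiconvex

variable {V : Type*} [NormedAddCommGroup V] [NormedSpace ℝ V]

/-- A function with an affine support from below at every point is convex. -/
theorem convexOn_of_support {f : V → ℝ}
    (hf : ∀ z, ∃ l : V →L[ℝ] ℝ, ∀ h, f z + l h ≤ f (z + h)) : ConvexOn ℝ univ f := by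
  refine ⟨convex_univ, fun x _ y _ a b ha hb hab => ?_⟩
  obtain ⟨l, hl⟩ := hf (a • x + b • y)
  have hx := hl (x - (a • x + b • y))
  have hy := hl (y - (a • x + b • y))
  simp only [add_sub_cancel, map_sub, map_add, map_smul, smul_eq_mul] at hx hy ⊢
  have h1 := mul_le_mul_of_nonneg_left hx ha
  have h2 := mul_le_mul_of_nonneg_left hy hb
  obtain rfl : b = 1 - a := by linarith
  nlinarith

/-- A concave function on a finite-dimensional space has a supergradient at every point. -/
theorem exists_supergradient [FiniteDimensional ℝ V] {f : V → ℝ} (hf : ConcaveOn ℝ univ f)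
    (z : V) : ∃ l : V →L[ℝ] ℝ, ∀ h, f (z + h) ≤ f z + l h := by
  have hcont : Continuous f := hf.locallyLipschitz.continuous
  have hconv : Convex ℝ {p : V × ℝ | p.2 < f p.1} := by
    have := hf.convex_strict_hypograph
    simpa using this
  have hopen : IsOpen {p : V × ℝ | p.2 < f p.1} :=
    isOpen_lt continuous_snd (hcont.comp continuous_fst)
  -- Separate the graph point from the open strict hypograph. The separating functional is not
  -- vertical because points directly below the graph lie in the hypograph, so it can be normalized
  -- to a supergradient.
  obtain ⟨L, hL⟩ := geometric_hahn_banach_open_point (x := (z, f z)) hconv hopen (by simp)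
  have hsplit : ∀ (x : V) (r : ℝ), L (x, r) = L (x, 0) + r * L (0, 1) := by
    intro x r
    have : ((x, r) : V × ℝ) = (x, 0) + r • (0, 1) := by simp
    rw [this, map_add, map_smul, smul_eq_mul]
  have hpos : 0 < L (0, 1) := by
    have := hL (z, f z - 1) (by simp)
    rw [hsplit z, hsplit z (f z)] at this
    linarith
  have key : ∀ w, L (w, 0) + f w * L (0, 1) ≤ L (z, 0) + f z * L (0, 1) := by
    intro w
    refine le_of_forall_pos_lt_add fun e he => ?_
    have := hL (w, f w - e / L (0, 1)) (by simpa using div_pos he hpos)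
    rw [hsplit w, hsplit z (f z), sub_mul, div_mul_cancel₀ _ hpos.ne'] at this
    linarith
  refine ⟨-(L (0, 1))⁻¹ • L.comp (ContinuousLinearMap.inl ℝ V ℝ), fun h => ?_⟩
  have hk := key (z + h)
  have hz : L (z + h, 0) = L (z, 0) + L (h, 0) := by
    rw [← map_add]; simp
  rw [hz] at hk
  simp only [_root_.smul_apply, ContinuousLinearMap.comp_apply,
    ContinuousLinearMap.inl_apply, smul_eq_mul]
  have : (f (z + h) - f z + (L (0, 1))⁻¹ * L (h, 0)) * L (0, 1) ≤ 0 := by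
    have : (f (z + h) - f z + (L (0, 1))⁻¹ * L (h, 0)) * L (0, 1)
        = (f (z + h) - f z) * L (0, 1) + L (h, 0) := by field_simp
    rw [this]; linarith
  have := nonpos_of_mul_nonpos_left this hpos
  linarith

/-- The least concave majorant. -/
def concaveEnvelope (f : V → ℝ) (z : V) : ℝ :=
  sInf {r | ∃ φ : V → ℝ, ConcaveOn ℝ univ φ ∧ (∀ w, f w ≤ φ w) ∧ φ z = r}

theorem concaveEnvelope_le {f φ : V → ℝ} (hφ : ConcaveOn ℝ univ φ) (h : ∀ w, f w ≤ φ w) (z : V) :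
    concaveEnvelope f z ≤ φ z := by
  refine csInf_le ⟨f z, ?_⟩ ⟨φ, hφ, h, rfl⟩
  rintro r ⟨φ', -, h', rfl⟩
  exact h' z

theorem le_concaveEnvelope {f φ : V → ℝ} (hφ : ConcaveOn ℝ univ φ) (h : ∀ w, f w ≤ φ w) (z : V) :
    f z ≤ concaveEnvelope f z := by
  refine le_csInf ⟨φ z, φ, hφ, h, rfl⟩ ?_
  rintro r ⟨φ', -, h', rfl⟩
  exact h' z

theorem concaveOn_concaveEnvelope {f φ : V → ℝ} (hφ : ConcaveOn ℝ univ φ) (h : ∀ w, f w ≤ φ w) :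
    ConcaveOn ℝ univ (concaveEnvelope f) := by
  refine ⟨convex_univ, fun x _ y _ a b ha hb hab => ?_⟩
  refine le_csInf ⟨φ _, φ, hφ, h, rfl⟩ ?_
  rintro r ⟨φ', hc, h', rfl⟩
  refine le_trans ?_ (hc.2 (mem_univ x) (mem_univ y) ha hb hab)
  have hx := concaveEnvelope_le hc h' x
  have hy := concaveEnvelope_le hc h' y
  simp only [smul_eq_mul]
  gcongr

/-- The average of the two translates of the envelope by `k` and `-k`, raised by `C / 2 * ‖k‖ ^ 2`,
is itself a concave majorant of `f`, and the envelope is the least one. -/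
theorem concaveEnvelope_second_difference {f φ : V → ℝ} {C : ℝ} (hφ : ConcaveOn ℝ univ φ)
    (h : ∀ w, f w ≤ φ w) (hf : ∀ z k, 2 * f z - C * ‖k‖ ^ 2 ≤ f (z + k) + f (z - k)) (z k : V) :
    2 * concaveEnvelope f z - C * ‖k‖ ^ 2
      ≤ concaveEnvelope f (z + k) + concaveEnvelope f (z - k) := by
  have hc := concaveOn_concaveEnvelope hφ h
  have hshift : ∀ k : V, ConcaveOn ℝ univ fun w => concaveEnvelope f (w + k) := by
    intro k
    simpa [Function.comp_def] using hc.translate_left k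
  have hm : ConcaveOn ℝ univ fun w =>
      (2 : ℝ)⁻¹ • (concaveEnvelope f (w + k) + concaveEnvelope f (w + -k)) + C / 2 * ‖k‖ ^ 2 :=
    (((hshift k).add (hshift (-k))).smul (by norm_num)).add_const _
  have hmf : ∀ w, f w ≤ (2 : ℝ)⁻¹ • (concaveEnvelope f (w + k) + concaveEnvelope f (w + -k)) +
      C / 2 * ‖k‖ ^ 2 := by
    intro w
    have h1 := le_concaveEnvelope hφ h (w + k)
    have h2 := le_concaveEnvelope hφ h (w + -k)
    have h3 := hf w k
    simp only [smul_eq_mul]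
    rw [sub_eq_add_neg w k] at h3
    linarith
  have := concaveEnvelope_le hm hmf z
  simp only [smul_eq_mul, ← sub_eq_add_neg] at this
  linarith

/-- A concave function with second differences bounded from below is of class `C^{1,1}`. -/
theorem exists_lipschitz_gradient [FiniteDimensional ℝ V] {f : V → ℝ} {C : ℝ} (hC : 0 ≤ C)
    (hf : ConcaveOn ℝ univ f) (h2 : ∀ z k, 2 * f z - C * ‖k‖ ^ 2 ≤ f (z + k) + f (z - k)) :
    ∃ g : V → V →L[ℝ] ℝ, (∀ z h, f (z + h) ≤ f z + g z h) ∧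
      (∀ z h, f z + g z h - C * ‖h‖ ^ 2 ≤ f (z + h)) ∧
      LipschitzWith (Real.toNNReal (2 * C)) g := by
  choose g hg using fun z => exists_supergradient hf z
  have hlow : ∀ z h, f z + g z h - C * ‖h‖ ^ 2 ≤ f (z + h) := by
    intro z h
    have h1 := h2 z h
    have h3 := hg z (-h)
    rw [map_neg, ← sub_eq_add_neg] at h3
    linarith
  refine ⟨g, hg, hlow, LipschitzWith.of_dist_le_mul fun x y => ?_⟩
  rw [dist_eq_norm, dist_eq_norm, Real.coe_toNNReal _ (by positivity)]
  -- Bound the value at `x + h` from below by the expansion at `x` and from above by the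
  -- supergradient at `y`, and compare `f x` with `f y` through the lower expansion at `y`.
  have key : ∀ h, (g x - g y) h ≤ C * (‖h‖ ^ 2 + ‖x - y‖ ^ 2) := by
    intro h
    have h1 := hlow x h
    have h3 := hg y (x - y + h)
    have h4 := hlow y (x - y)
    rw [show y + (x - y + h) = x + h by abel, map_add] at h3
    rw [add_sub_cancel] at h4
    simp only [_root_.sub_apply]
    linarith
  rcases eq_or_ne x y with rfl | hxy
  · simp
  have hd : 0 < ‖x - y‖ := norm_pos_iff.2 (sub_ne_zero.2 hxy)
  refine ContinuousLinearMap.opNorm_le_bound _ (by positivity) fun h => ?_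
  rcases eq_or_ne h 0 with rfl | hh
  · simp
  have hh' : 0 < ‖h‖ := norm_pos_iff.2 hh
  -- Choosing `h` of length `‖x - y‖` balances the two quadratic terms.
  have key2 : ∀ h : V, ‖h‖ = ‖x - y‖ → (g x - g y) h ≤ 2 * C * ‖x - y‖ ^ 2 := by
    intro h e
    have := key h
    rw [e] at this
    linarith
  have hs : ‖(‖x - y‖ / ‖h‖) • h‖ = ‖x - y‖ := by
    rw [norm_smul, Real.norm_of_nonneg (by positivity)]; field_simp
  have k1 := key2 _ hs
  have k2 := key2 (-((‖x - y‖ / ‖h‖) • h)) (by rw [norm_neg, hs])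
  rw [map_neg, map_smul, smul_eq_mul] at k2
  rw [map_smul, smul_eq_mul] at k1
  have k3 : ‖x - y‖ / ‖h‖ * |(g x - g y) h| ≤ 2 * C * ‖x - y‖ ^ 2 := by
    rcases abs_cases ((g x - g y) h) with ⟨e, -⟩ | ⟨e, -⟩ <;> rw [e] <;> linarith
  rw [Real.norm_eq_abs]
  rw [div_mul_eq_mul_div, div_le_iff₀ hh'] at k3
  have : ‖x - y‖ * |(g x - g y) h| ≤ ‖x - y‖ * (2 * C * ‖x - y‖ * ‖h‖) := by
    calc _ ≤ _ := k3
      _ = _ := by ring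
  exact le_of_mul_le_mul_left this hd

/-- A first-order expansion with quadratic error is a derivative. -/
theorem hasFDerivAt_of_quadratic_bounds {f : V → ℝ} {C : ℝ} {g : V →L[ℝ] ℝ} {z : V}
    (h1 : ∀ h, f (z + h) ≤ f z + g h) (h2 : ∀ h, f z + g h - C * ‖h‖ ^ 2 ≤ f (z + h)) :
    HasFDerivAt f g z := by
  rw [hasFDerivAt_iff_isLittleO_nhds_zero]
  have : (fun h => f (z + h) - f z - g h) =O[𝓝 0] fun h : V => ‖h‖ ^ 2 := by
    refine Asymptotics.IsBigO.of_bound |C| (Eventually.of_forall fun h => ?_)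
    have e1 := h1 h
    have e2 := h2 h
    rw [Real.norm_eq_abs, norm_pow, norm_norm, abs_le]
    have := mul_le_mul_of_nonneg_right (le_abs_self C) (sq_nonneg ‖h‖)
    have := mul_nonneg (abs_nonneg C) (sq_nonneg ‖h‖)
    constructor <;> linarith
  refine this.trans_isLittleO ?_
  refine Asymptotics.IsLittleO.of_norm_right ?_
  exact Asymptotics.isLittleO_pow_id one_lt_two |>.comp_tendsto
    (by simpa using (continuous_norm (E := V)).tendsto 0)

/-- Second-order Taylor expansion at a point where the gradient is differentiable. -/
theorem taylor_two_of_hasFDerivAt {f : V → ℝ} {g : V → V →L[ℝ] ℝ} {B : V →L[ℝ] V →L[ℝ] ℝ} {z : V}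
    (hf : ∀ᶠ w in 𝓝 z, HasFDerivAt f (g w) w) (hg : HasFDerivAt g B z) {η : ℝ} (hη : 0 < η) :
    ∀ᶠ h in 𝓝 (0 : V), |f (z + h) - f z - g z h - 1 / 2 * B h h| ≤ η * ‖h‖ ^ 2 := by
  rw [hasFDerivAt_iff_isLittleO_nhds_zero] at hg
  have hb := hg.bound hη
  have hf0 : ∀ᶠ h in 𝓝 (0 : V), HasFDerivAt f (g (z + h)) (z + h) := by
    have : Tendsto (fun h : V => z + h) (𝓝 0) (𝓝 z) := by
      simpa using (continuous_const_add z).tendsto (0 : V)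
    exact this.eventually hf
  obtain ⟨r, hr, hball⟩ := Metric.eventually_nhds_iff_ball.1 (hb.and hf0)
  filter_upwards [Metric.ball_mem_nhds (0 : V) hr] with h hh
  have hmem : ∀ s ∈ Icc (0 : ℝ) 1, s • h ∈ Metric.ball (0 : V) r := by
    intro s hs
    rw [mem_ball_zero_iff] at hh ⊢
    refine lt_of_le_of_lt ?_ hh
    rw [norm_smul, Real.norm_of_nonneg hs.1]
    exact mul_le_of_le_one_left (norm_nonneg _) hs.2
  -- Along the ray the Taylor polynomial is subtracted; differentiability of `g` makes the
  -- derivative of the rest at most `η * ‖h‖ ^ 2`, and the mean value inequality integrates it.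
  let ρ : ℝ → ℝ := fun s => f (z + s • h) - s * g z h - s ^ 2 / 2 * B h h
  have hρ : ∀ s ∈ Icc (0 : ℝ) 1, HasDerivAt ρ ((g (z + s • h) - g z - B (s • h)) h) s := by
    intro s hs
    have hl : HasDerivAt (fun s : ℝ => z + s • h) h s := by
      simpa using ((hasDerivAt_id s).smul_const h).const_add z
    have e1 := (hball _ (hmem s hs)).2.comp_hasDerivAt s hl
    have e2 : HasDerivAt (fun s : ℝ => s * g z h) (g z h) s := by
      simpa using (hasDerivAt_id s).mul_const (g z h)
    have e3 : HasDerivAt (fun s : ℝ => s ^ 2 / 2 * B h h) (s * B h h) s := by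
      have := ((hasDerivAt_pow 2 s).div_const 2).mul_const (B h h)
      exact this.congr_deriv (by push_cast; ring)
    refine ((e1.sub e2).sub e3).congr_deriv ?_
    simp
  have hbound : ∀ s ∈ Icc (0 : ℝ) 1, ‖(g (z + s • h) - g z - B (s • h)) h‖ ≤ η * ‖h‖ ^ 2 := by
    intro s hs
    have hn : ‖s • h‖ ≤ ‖h‖ := by
      rw [norm_smul, Real.norm_of_nonneg hs.1]
      exact mul_le_of_le_one_left (norm_nonneg _) hs.2
    have := (hball (s • h) (hmem s hs)).1
    calc _ ≤ ‖g (z + s • h) - g z - B (s • h)‖ * ‖h‖ := ContinuousLinearMap.le_opNorm _ _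
      _ ≤ (η * ‖h‖) * ‖h‖ := by gcongr; exact this.trans (by gcongr)
      _ = _ := by ring
  have := (convex_Icc (0 : ℝ) 1).norm_image_sub_le_of_norm_hasDerivWithin_le
    (fun s hs => (hρ s hs).hasDerivWithinAt) hbound (left_mem_Icc.2 zero_le_one)
    (right_mem_Icc.2 zero_le_one)
  simp only [ρ, one_smul, zero_smul, add_zero, sub_zero, norm_one, mul_one] at this
  rw [Real.norm_eq_abs] at this
  convert this using 2
  ring

/-- Values of a Lipschitz map between spaces of equal dimension avoid, arbitrarily close to the
origin, the image of a null set. -/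
theorem exists_small_notMem_image [FiniteDimensional ℝ V] [MeasurableSpace V] [BorelSpace V]
    {g : V → V →L[ℝ] ℝ} {L : NNReal} (hg : LipschitzWith L g) {N : Set V}
    {μ : Measure V} [μ.IsAddHaarMeasure] (hN : μ N = 0) {r : ℝ} (hr : 0 < r) :
    ∃ q : V →L[ℝ] ℝ, ‖q‖ < r ∧ q ∉ g '' N := by
  let _ : MeasurableSpace (V →L[ℝ] ℝ) := borel _
  have : BorelSpace (V →L[ℝ] ℝ) := ⟨rfl⟩
  have hdim : Module.finrank ℝ (V →L[ℝ] ℝ) = Module.finrank ℝ V := by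
    rw [← (LinearMap.toContinuousLinearMap (𝕜 := ℝ) (E := V) (F' := ℝ)).finrank_eq,
      Module.finrank_linearMap, Module.finrank_self, mul_one]
  -- The space and its dual have the same dimension, so null sets can be compared through Hausdorff
  -- measure, for which Lipschitz images of null sets are null while balls have positive measure.
  have h0 : Measure.hausdorffMeasure (Module.finrank ℝ V : ℝ) N = 0 :=
    (Measure.absolutelyContinuous_isAddHaarMeasure _ μ) hN
  have h1 : Measure.hausdorffMeasure (Module.finrank ℝ (V →L[ℝ] ℝ) : ℝ) (g '' N) = 0 := by
    rw [hdim]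
    refine le_antisymm ?_ (zero_le)
    refine (hg.hausdorffMeasure_image_le (by positivity) N).trans ?_
    rw [h0, mul_zero]
  by_contra hcon
  push Not at hcon
  have hsub : Metric.ball (0 : V →L[ℝ] ℝ) r ⊆ g '' N := fun q hq => hcon q (by simpa using hq)
  have hp : 0 < Measure.hausdorffMeasure (Module.finrank ℝ (V →L[ℝ] ℝ) : ℝ)
      (Metric.ball (0 : V →L[ℝ] ℝ) r) :=
    Metric.measure_ball_pos _ _ hr
  exact absurd (measure_mono_null hsub h1) hp.ne'

/-- The theorem on sums for a pair of semiconvex functions: after a small linear perturbation the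
sum has a maximum point at which one function with a second-order expansion separates the two. -/
theorem exists_second_order_separation [FiniteDimensional ℝ V] {U W : V → ℝ}
    (b : V →L[ℝ] V →L[ℝ] ℝ)
    (hU : ∀ z, ∃ l : V →L[ℝ] ℝ, ∀ h, U z + l h - b h h ≤ U (z + h))
    (hW : ∀ z, ∃ l : V →L[ℝ] ℝ, ∀ h, W z + l h - b h h ≤ W (z + h))
    (hmax : ∀ q : V →L[ℝ] ℝ, ‖q‖ < 1 → ∃ z, ∀ w, U w + W w - q w ≤ U z + W z - q z) :
    ∃ Λ : ℝ, ∀ r > 0, ∃ (q g : V →L[ℝ] ℝ) (B : V →L[ℝ] V →L[ℝ] ℝ) (z : V),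
      ‖q‖ < r ∧ ‖B‖ ≤ Λ ∧ (∀ w, U w + W w - q w ≤ U z + W z - q z) ∧
      (∀ η > 0, ∀ᶠ h in 𝓝 (0 : V), U (z + h) ≤ U z + g h + 1 / 2 * B h h + η * ‖h‖ ^ 2) ∧
      (∀ η > 0, ∀ᶠ h in 𝓝 (0 : V),
        W (z + h) ≤ W z + (q - g) h - 1 / 2 * B h h + η * ‖h‖ ^ 2) := by
  have hb : ∀ h, |b h h| ≤ ‖b‖ * ‖h‖ ^ 2 := fun h => by
    have := b.le_opNorm₂ h h
    rw [Real.norm_eq_abs] at this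
    linarith [sq ‖h‖, mul_assoc ‖b‖ ‖h‖ ‖h‖]
  have hsd : ∀ (f : V → ℝ), (∀ z, ∃ l : V →L[ℝ] ℝ, ∀ h, f z + l h - b h h ≤ f (z + h)) →
      ∀ z k, 2 * f z - 2 * b k k ≤ f (z + k) + f (z - k) := by
    intro f hf z k
    obtain ⟨l, hl⟩ := hf z
    have h1 := hl k
    have h2 := hl (-k)
    simp only [map_neg, _root_.neg_apply, neg_neg, ← sub_eq_add_neg] at h1 h2
    linarith
  obtain ⟨z₀, hz₀⟩ := hmax 0 (by simp)
  simp only [_root_.zero_apply, sub_zero] at hz₀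
  have hconst : ConcaveOn ℝ univ fun _ : V => U z₀ + W z₀ := concaveOn_const _ convex_univ
  have hs1 : ∀ z k, 2 * (U z + W z) - 4 * ‖b‖ * ‖k‖ ^ 2 ≤ U (z + k) + W (z + k) +
      (U (z - k) + W (z - k)) := by
    intro z k
    have := hsd U hU z k
    have := hsd W hW z k
    have := (abs_le.1 (hb k)).2
    linarith
  -- The envelope of the sum identifies tilts with slopes: at a maximum of `U + W - q` it touches
  -- the sum with gradient `q`.
  set Γ := concaveEnvelope fun z => U z + W z with hΓ
  have hΓc : ConcaveOn ℝ univ Γ := concaveOn_concaveEnvelope hconst hz₀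
  have hΓle : ∀ z, U z + W z ≤ Γ z := le_concaveEnvelope hconst hz₀
  obtain ⟨G, hG1, hG2, hGL⟩ := exists_lipschitz_gradient (by positivity) hΓc
    (concaveEnvelope_second_difference hconst hz₀ hs1)
  have hWc : ConvexOn ℝ univ fun z => W z + b z z := by
    refine convexOn_of_support fun z => ?_
    obtain ⟨l, hl⟩ := hW z
    refine ⟨l + b z + b.flip z, fun h => ?_⟩
    have := hl h
    simp only [map_add, _root_.add_apply, ContinuousLinearMap.flip_apply]
    linarith
  have hmaj : ConcaveOn ℝ univ fun z => Γ z - (W z + b z z) := hΓc.sub hWc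
  have hle : ∀ z, U z - b z z ≤ Γ z - (W z + b z z) := fun z => by linarith [hΓle z]
  have hs2 : ∀ z k, 2 * (U z - b z z) - 4 * ‖b‖ * ‖k‖ ^ 2 ≤ U (z + k) - b (z + k) (z + k) +
      (U (z - k) - b (z - k) (z - k)) := by
    intro z k
    have := hsd U hU z k
    have := (abs_le.1 (hb k)).2
    simp only [map_add, map_sub, _root_.add_apply, _root_.sub_apply]
    linarith
  -- This function separates the pair: it lies above `U - b` and below the concave function `Γ - (W
  -- + b)`. It is of class `C^{1,1}`, because the second differences of `U - b` are bounded below.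
  set E := concaveEnvelope fun z => U z - b z z with hE
  have hEc : ConcaveOn ℝ univ E := concaveOn_concaveEnvelope hmaj hle
  have hEU : ∀ z, U z - b z z ≤ E z := le_concaveEnvelope hmaj hle
  have hEW : ∀ z, E z ≤ Γ z - (W z + b z z) := concaveEnvelope_le hmaj hle
  obtain ⟨e, he1, he2, heL⟩ := exists_lipschitz_gradient (by positivity) hEc
    (concaveEnvelope_second_difference hmaj hle hs2)
  have hder : ∀ z, HasFDerivAt E (e z) z :=
    fun z => hasFDerivAt_of_quadratic_bounds (he1 z) (he2 z)
  let _ : MeasurableSpace V := borel V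
  have : BorelSpace V := ⟨rfl⟩
  have hN : (Measure.addHaar (G := V)) {z | ¬ DifferentiableAt ℝ e z} = 0 :=
    heL.ae_differentiableAt
  refine ⟨2 * (4 * ‖b‖) + ‖b + b.flip‖, fun r hr => ?_⟩
  -- The slope `q` is not attained by `G` at any point where `e` fails to be differentiable.
  obtain ⟨q, hq, hqN⟩ := exists_small_notMem_image hGL hN (lt_min hr one_pos)
  obtain ⟨z, hz⟩ := hmax q (hq.trans_le (min_le_right _ _))
  have haff : ConcaveOn ℝ univ fun w => (U z + W z - q z) + q w :=
    (concaveOn_const _ convex_univ).add (q.toLinearMap.concaveOn convex_univ)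
  have hΓaff : ∀ w, Γ w ≤ (U z + W z - q z) + q w :=
    concaveEnvelope_le haff fun w => by linarith [hz w]
  have hcontact : Γ z = U z + W z := le_antisymm (by linarith [hΓaff z]) (hΓle z)
  have hGq : G z = q := by
    have d1 : HasFDerivAt Γ (G z) z := hasFDerivAt_of_quadratic_bounds (hG1 z) (hG2 z)
    have d2 : HasFDerivAt (fun w => Γ w - q w) (G z - q) z := d1.sub q.hasFDerivAt
    have : IsLocalMax (fun w => Γ w - q w) z :=
      Eventually.of_forall fun w => by
        have := hΓaff w
        simp only
        linarith
    exact sub_eq_zero.1 (this.hasFDerivAt_eq_zero d2)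
  have hdiff : DifferentiableAt ℝ e z := by
    by_contra hcon
    exact hqN ⟨z, hcon, hGq⟩
  -- At `z` the chain `U - b ≤ E ≤ Γ - (W + b)` consists of equalities, so the expansion of `E`
  -- bounds `U` from above and, with the opposite sign, bounds `W`.
  have hEz : E z = U z - b z z :=
    le_antisymm (by linarith [hEW z]) (hEU z)
  refine ⟨q, e z + b z + b.flip z, fderiv ℝ e z + (b + b.flip), z, hq.trans_le (min_le_left _ _),
    ?_, hz, fun η hη => ?_, fun η hη => ?_⟩
  · refine (norm_add_le (fderiv ℝ e z) (b + b.flip)).trans (add_le_add ?_ le_rfl)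
    have := norm_fderiv_le_of_lipschitz (x₀ := z) ℝ heL
    rwa [Real.coe_toNNReal _ (by positivity)] at this
  · filter_upwards [taylor_two_of_hasFDerivAt (.of_forall hder) hdiff.hasFDerivAt hη] with h hh
    have h1 := (abs_le.1 hh).2
    have h2 := hEU (z + h)
    simp only [map_add, _root_.add_apply, ContinuousLinearMap.flip_apply] at h2 ⊢
    linarith
  · filter_upwards [taylor_two_of_hasFDerivAt (.of_forall hder) hdiff.hasFDerivAt hη] with h hh
    have h1 := (abs_le.1 hh).1
    have h2 := hEW (z + h)
    have h3 := hΓaff (z + h)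
    simp only [map_add, _root_.add_apply, _root_.sub_apply,
      ContinuousLinearMap.flip_apply] at h2 h3 ⊢
    linarith

end Semiconvex

end TugOfWar

end

set_option linter.unusedSectionVars false

noncomputable section

namespace TugOfWar

/-! ### Sup-convolution with a kernel that is quartic in space and quadratic in time -/

section SupConvolution

variable {E : Type*} [NormedAddCommGroup E] [InnerProductSpace ℝ E]

local notation "⟪" x ", " y "⟫" => inner ℝ x y

/-- The penalization kernel, quartic at the origin in space and quadratic in time. -/
def kernel (ζ : E × ℝ) : ℝ := ‖ζ.1‖ ^ 4 / (1 + ‖ζ.1‖ ^ 2) + ζ.2 ^ 2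

/-- Half of the radial slope of the space part of `kernel`, as a function of `‖x‖ ^ 2`. -/
def kernelSlope (s : ℝ) : ℝ := 1 - 1 / (1 + s) ^ 2

/-- The inner product as a bounded bilinear map. -/
def innerBilin : E →L[ℝ] E →L[ℝ] ℝ := innerSL ℝ

@[simp] theorem innerBilin_apply (x y : E) : innerBilin x y = ⟪x, y⟫ := rfl

/-- The inner product of space-time. -/
def spaceTimeInner : E × ℝ →L[ℝ] E × ℝ →L[ℝ] ℝ :=
  innerBilin.bilinearComp (ContinuousLinearMap.fst ℝ E ℝ) (ContinuousLinearMap.fst ℝ E ℝ) +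
    (ContinuousLinearMap.mul ℝ ℝ).bilinearComp (ContinuousLinearMap.snd ℝ E ℝ)
      (ContinuousLinearMap.snd ℝ E ℝ)

theorem spaceTimeInner_apply (h k : E × ℝ) : spaceTimeInner h k = ⟪h.1, k.1⟫ + h.2 * k.2 := by
  simp [spaceTimeInner]

/-- The derivative of `kernel`. -/
def kernelDeriv (ζ : E × ℝ) : E × ℝ →L[ℝ] ℝ :=
  (2 * kernelSlope (‖ζ.1‖ ^ 2)) • (innerSL ℝ ζ.1).comp (ContinuousLinearMap.fst ℝ E ℝ) +
    (2 * ζ.2) • ContinuousLinearMap.snd ℝ E ℝ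

theorem kernelDeriv_apply (ζ h : E × ℝ) :
    kernelDeriv ζ h = 2 * kernelSlope (‖ζ.1‖ ^ 2) * ⟪ζ.1, h.1⟫ + 2 * ζ.2 * h.2 := by
  simp [kernelDeriv]

@[simp] theorem kernel_zero : kernel (0 : E × ℝ) = 0 := by simp [kernel]

theorem kernel_nonneg (ζ : E × ℝ) : 0 ≤ kernel ζ := by unfold kernel; positivity

/-- Quadratic growth beats linear tilts, which confines the maximum points in the comparison
argument. -/
theorem norm_sq_le_kernel (ζ : E × ℝ) : ‖ζ‖ ^ 2 ≤ kernel ζ + 1 := by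
  have h1 : ‖ζ.1‖ ^ 2 - 1 ≤ ‖ζ.1‖ ^ 4 / (1 + ‖ζ.1‖ ^ 2) := by
    rw [le_div_iff₀ (by positivity)]
    nlinarith
  have h2 : 0 ≤ ‖ζ.1‖ ^ 4 / (1 + ‖ζ.1‖ ^ 2) := by positivity
  unfold kernel
  rw [Prod.norm_def]
  rcases max_cases ‖ζ.1‖ ‖ζ.2‖ with ⟨e, -⟩ | ⟨e, -⟩ <;> rw [e]
  · nlinarith [sq_nonneg ζ.2]
  · rw [Real.norm_eq_abs, sq_abs]; linarith

/-- A bounded penalty divided by a small `δ` forces the penalized points together. -/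
theorem exists_kernel_lt_imp {ρ : ℝ} (hρ : 0 < ρ) :
    ∃ c > 0, ∀ ζ : E × ℝ, kernel ζ < c → ‖ζ‖ < ρ := by
  refine ⟨min (ρ ^ 4 / (1 + ρ ^ 2)) (ρ ^ 2), by positivity, fun ζ hζ => ?_⟩
  by_contra! hcon
  have h2 : 0 ≤ ‖ζ.1‖ ^ 4 / (1 + ‖ζ.1‖ ^ 2) := by positivity
  unfold kernel at hζ
  rw [Prod.norm_def] at hcon
  rcases le_max_iff.1 hcon with h | h
  · have : ρ ^ 4 / (1 + ρ ^ 2) ≤ ‖ζ.1‖ ^ 4 / (1 + ‖ζ.1‖ ^ 2) := by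
      have hs : ρ ^ 2 ≤ ‖ζ.1‖ ^ 2 := by gcongr
      rw [div_le_div_iff₀ (by positivity) (by positivity)]
      have : ρ ^ 2 * ρ ^ 2 * (1 + ‖ζ.1‖ ^ 2) ≤ ‖ζ.1‖ ^ 2 * ‖ζ.1‖ ^ 2 * (1 + ρ ^ 2) := by
        have hm := mul_le_mul hs hs (by positivity) (by positivity)
        have hp : 0 ≤ ρ ^ 2 * ‖ζ.1‖ ^ 2 * (‖ζ.1‖ ^ 2 - ρ ^ 2) :=
          mul_nonneg (by positivity) (by linarith)
        nlinarith
      nlinarith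
    have := lt_of_lt_of_le hζ (min_le_left _ _)
    nlinarith [sq_nonneg ζ.2]
  · have h3 : ρ ^ 2 ≤ ζ.2 ^ 2 := by
      rw [← sq_abs ζ.2, ← Real.norm_eq_abs]; gcongr
    have := lt_of_lt_of_le hζ (min_le_right _ _)
    linarith

theorem kernelSlope_nonneg {s : ℝ} (hs : 0 ≤ s) : 0 ≤ kernelSlope s := by
  unfold kernelSlope
  rw [sub_nonneg, div_le_one (by positivity)]
  nlinarith

theorem kernelSlope_le_one (s : ℝ) : kernelSlope s ≤ 1 := by
  unfold kernelSlope
  have : 0 ≤ 1 / (1 + s) ^ 2 := by positivity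
  linarith

theorem kernelSlope_le {s : ℝ} (hs : 0 ≤ s) : kernelSlope s ≤ 2 * s := by
  unfold kernelSlope
  have : 1 - 2 * s ≤ 1 / (1 + s) ^ 2 := by
    rw [le_div_iff₀ (by positivity)]
    nlinarith [mul_nonneg hs hs, mul_nonneg hs (mul_nonneg hs hs)]
  linarith

theorem kernelSlope_mono {s t : ℝ} (hs : 0 ≤ s) (hst : s ≤ t) :
    kernelSlope s ≤ kernelSlope t := by
  unfold kernelSlope
  gcongr

theorem kernelSlope_pos {s : ℝ} (hs : 0 < s) : 0 < kernelSlope s := by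
  unfold kernelSlope
  rw [sub_pos, div_lt_one (by positivity)]
  nlinarith

/-- Exact second-order expansion of `kernel`. -/
theorem kernel_add (ζ h : E × ℝ) :
    kernel (ζ + h) = kernel ζ + kernelDeriv ζ h + kernelSlope (‖ζ.1‖ ^ 2) * ‖h.1‖ ^ 2 +
      (2 * ⟪ζ.1, h.1⟫ + ‖h.1‖ ^ 2) ^ 2 / ((1 + ‖ζ.1‖ ^ 2) ^ 2 * (1 + ‖ζ.1 + h.1‖ ^ 2)) +
      h.2 ^ 2 := by
  have hs : ‖ζ.1 + h.1‖ ^ 2 = ‖ζ.1‖ ^ 2 + 2 * ⟪ζ.1, h.1⟫ + ‖h.1‖ ^ 2 := norm_add_sq_real _ _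
  -- As a function of `s = ‖x‖ ^ 2` the space part is `s ^ 2 / (1 + s)`, whose derivative is
  -- `kernelSlope`; the remainder of its first-order expansion is explicit.
  have key : ∀ s t r : ℝ, 0 ≤ s → 0 ≤ t → t - s = r →
      t ^ 2 / (1 + t) = s ^ 2 / (1 + s) + kernelSlope s * r +
        r ^ 2 / ((1 + s) ^ 2 * (1 + t)) := by
    intro s t r h1 h2 h3
    subst h3
    unfold kernelSlope
    field_simp
    ring
  have h4 : ∀ x : E, ‖x‖ ^ 4 = (‖x‖ ^ 2) ^ 2 := fun x => by ring
  rw [kernelDeriv_apply]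
  simp only [kernel, Prod.fst_add, Prod.snd_add, h4]
  rw [key (‖ζ.1‖ ^ 2) (‖ζ.1 + h.1‖ ^ 2) (2 * ⟪ζ.1, h.1⟫ + ‖h.1‖ ^ 2) (by positivity)
    (by positivity) (by rw [hs]; ring)]
  ring

/-- The slope is at most one and the quotient remainder at most `2 * ‖h.1‖ ^ 2`, uniformly in `ζ`.
This global bound makes sup-convolutions semiconvex on the whole space. -/
theorem kernel_add_le (ζ h : E × ℝ) :
    kernel (ζ + h) ≤ kernel ζ + kernelDeriv ζ h + 3 * spaceTimeInner h h := by
  rw [kernel_add, spaceTimeInner_apply, real_inner_self_eq_norm_sq]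
  have hs : ‖ζ.1 + h.1‖ ^ 2 = ‖ζ.1‖ ^ 2 + 2 * ⟪ζ.1, h.1⟫ + ‖h.1‖ ^ 2 := norm_add_sq_real _ _
  have hr : (2 * ⟪ζ.1, h.1⟫ + ‖h.1‖ ^ 2) ^ 2 ≤
      (2 * (‖ζ.1‖ ^ 2 + ‖ζ.1 + h.1‖ ^ 2)) * ‖h.1‖ ^ 2 := by
    have e : 2 * ⟪ζ.1, h.1⟫ + ‖h.1‖ ^ 2 = (‖ζ.1 + h.1‖ - ‖ζ.1‖) * (‖ζ.1 + h.1‖ + ‖ζ.1‖) := by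
      linarith
    have e1 : (‖ζ.1 + h.1‖ - ‖ζ.1‖) ^ 2 ≤ ‖h.1‖ ^ 2 := by
      rw [← sq_abs]
      have := abs_norm_sub_norm_le (ζ.1 + h.1) ζ.1
      rw [add_sub_cancel_left] at this
      gcongr
    have e2 : (‖ζ.1 + h.1‖ + ‖ζ.1‖) ^ 2 ≤ 2 * (‖ζ.1‖ ^ 2 + ‖ζ.1 + h.1‖ ^ 2) := by
      nlinarith [sq_nonneg (‖ζ.1 + h.1‖ - ‖ζ.1‖)]
    rw [e, mul_pow, mul_comm]
    gcongr
  have hq : (2 * ⟪ζ.1, h.1⟫ + ‖h.1‖ ^ 2) ^ 2 /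
      ((1 + ‖ζ.1‖ ^ 2) ^ 2 * (1 + ‖ζ.1 + h.1‖ ^ 2)) ≤ 2 * ‖h.1‖ ^ 2 := by
    rw [div_le_iff₀ (by positivity)]
    refine hr.trans ?_
    have : ‖ζ.1‖ ^ 2 + ‖ζ.1 + h.1‖ ^ 2 ≤ (1 + ‖ζ.1‖ ^ 2) ^ 2 * (1 + ‖ζ.1 + h.1‖ ^ 2) := by
      have ha : 0 ≤ ‖ζ.1‖ ^ 2 := by positivity
      have hb : 0 ≤ ‖ζ.1 + h.1‖ ^ 2 := by positivity
      nlinarith [mul_nonneg ha hb, mul_nonneg (mul_nonneg ha ha) hb, mul_nonneg ha ha]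
    nlinarith [mul_le_mul_of_nonneg_right this (sq_nonneg ‖h.1‖)]
  have h1 := mul_le_mul_of_nonneg_right (kernelSlope_le_one (‖ζ.1‖ ^ 2)) (sq_nonneg ‖h.1‖)
  nlinarith [sq_nonneg h.2]

/-- The quadratic coefficient vanishes with `ζ.1`, because `kernelSlope s ≤ 2 * s`. This is the
effect of the quartic behaviour at the origin. -/
theorem kernel_add_space_le (ζ : E × ℝ) (h : E) :
    kernel (ζ + (h, 0)) ≤ kernel ζ + kernelDeriv ζ (h, 0) + 6 * ‖ζ.1‖ ^ 2 * ‖h‖ ^ 2 +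
      (4 * ‖ζ.1‖ * ‖h‖ + ‖h‖ ^ 2) * ‖h‖ ^ 2 := by
  rw [kernel_add]
  have h1 : (2 * ⟪ζ.1, h⟫ + ‖h‖ ^ 2) ^ 2 / ((1 + ‖ζ.1‖ ^ 2) ^ 2 * (1 + ‖ζ.1 + h‖ ^ 2)) ≤
      (2 * ⟪ζ.1, h⟫ + ‖h‖ ^ 2) ^ 2 := by
    refine div_le_self (by positivity) ?_
    exact one_le_mul_of_one_le_of_one_le (one_le_pow₀ (by nlinarith [sq_nonneg ‖ζ.1‖]))
      (by nlinarith [sq_nonneg ‖ζ.1 + h‖])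
  have h2 := abs_real_inner_le_norm ζ.1 h
  have h3 : (2 * ⟪ζ.1, h⟫ + ‖h‖ ^ 2) ^ 2 ≤ (2 * (‖ζ.1‖ * ‖h‖) + ‖h‖ ^ 2) ^ 2 := by
    apply sq_le_sq'
    · have := (abs_le.1 h2).1; nlinarith [sq_nonneg ‖h‖]
    · have := (abs_le.1 h2).2; linarith
  have h4 := mul_le_mul_of_nonneg_right (kernelSlope_le (sq_nonneg ‖ζ.1‖)) (sq_nonneg ‖h‖)
  simp only at h1 ⊢
  nlinarith

/-- `U` is the sup-convolution of `f` over `K`, with all suprema attained. -/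
def IsSupConvolution (f : E × ℝ → ℝ) (K : Set (E × ℝ)) (δ : ℝ) (U : E × ℝ → ℝ) : Prop :=
  ∀ z, (∃ w ∈ K, U z = f w - kernel (z - w) / δ) ∧ ∀ w ∈ K, f w - kernel (z - w) / δ ≤ U z

theorem continuous_kernel : Continuous (kernel : E × ℝ → ℝ) := by
  unfold kernel
  refine Continuous.add (Continuous.div (by fun_prop) (by fun_prop) fun x => ?_) (by fun_prop)
  positivity

theorem exists_isSupConvolution {f : E × ℝ → ℝ} {K : Set (E × ℝ)} (hK : IsCompact K)
    (hne : K.Nonempty) (hf : UpperSemicontinuousOn f K) (δ : ℝ) :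
    ∃ U, IsSupConvolution f K δ U := by
  have : ∀ z, ∃ w ∈ K, IsMaxOn (fun w => f w - kernel (z - w) / δ) K w := by
    intro z
    refine UpperSemicontinuousOn.exists_isMaxOn hne hK ?_
    have hc : Continuous fun w => -(kernel (z - w) / δ) := by
      have := continuous_kernel (E := E)
      fun_prop
    have := hf.add (hc.upperSemicontinuous.upperSemicontinuousOn K)
    simpa only [sub_eq_add_neg] using this
  choose w hw hmax using this
  exact ⟨fun z => f (w z) - kernel (z - w z) / δ, fun z => ⟨⟨w z, hw z, rfl⟩, fun v hv => hmax z hv⟩⟩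

/-- Keep the maximizing `w` fixed while `z` moves; the kernel expansion then supports `U` from
below. -/
theorem IsSupConvolution.support {f : E × ℝ → ℝ} {K : Set (E × ℝ)} {δ : ℝ} (hδ : 0 < δ)
    {U : E × ℝ → ℝ} (hU : IsSupConvolution f K δ U) (z : E × ℝ) :
    ∃ l : E × ℝ →L[ℝ] ℝ, ∀ h, U z + l h - ((3 / δ) • spaceTimeInner) h h ≤ U (z + h) := by
  obtain ⟨⟨w, hw, hz⟩, -⟩ := hU z
  refine ⟨-(1 / δ) • kernelDeriv (z - w), fun h => ?_⟩
  have h1 := (hU (z + h)).2 w hw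
  have h2 := kernel_add_le (z - w) h
  rw [show z + h - w = z - w + h by abel] at h1
  have h3 := div_le_div_of_nonneg_right h2 hδ.le
  rw [hz]
  simp only [_root_.smul_apply, smul_eq_mul]
  have : (kernel (z - w) + kernelDeriv (z - w) h + 3 * spaceTimeInner h h) / δ =
    kernel (z - w) / δ + 1 / δ * kernelDeriv (z - w) h + 3 / δ * spaceTimeInner h h := by ring
  linarith

theorem IsSupConvolution.continuous [FiniteDimensional ℝ E] {f : E × ℝ → ℝ} {K : Set (E × ℝ)}
    {δ : ℝ} (hδ : 0 < δ) {U : E × ℝ → ℝ} (hU : IsSupConvolution f K δ U) : Continuous U := by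
  have hc : ConvexOn ℝ univ fun z => U z + ((3 / δ) • spaceTimeInner) z z := by
    refine convexOn_of_support fun z => ?_
    obtain ⟨l, hl⟩ := hU.support hδ z
    refine ⟨l + ((3 / δ) • spaceTimeInner) z + ((3 / δ) • spaceTimeInner).flip z, fun h => ?_⟩
    have := hl h
    simp only [map_add, _root_.add_apply, ContinuousLinearMap.flip_apply] at this ⊢
    linarith
  have h1 := hc.locallyLipschitz.continuous
  have h2 : Continuous fun z : E × ℝ => ((3 / δ) • spaceTimeInner) z z := by fun_prop
  simpa [Pi.sub_def] using h1.sub h2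

/-- First- and second-order conditions for a function that is nonnegative up to `o(‖h‖ ^ 2)`. -/
theorem linear_eq_zero_and_quadratic_nonneg {L : E →L[ℝ] ℝ} {A : E →L[ℝ] E →L[ℝ] ℝ}
    (h : ∀ η > 0, ∀ᶠ k in 𝓝 (0 : E), -(η * ‖k‖ ^ 2) ≤ L k + A k k) :
    (∀ k, L k = 0) ∧ ∀ k, 0 ≤ A k k := by
  have hray : ∀ η > 0, ∀ k : E, ∀ᶠ t in 𝓝 (0 : ℝ),
      -(η * (t ^ 2 * ‖k‖ ^ 2)) ≤ t * L k + t ^ 2 * A k k := by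
    intro η hη k
    have : Tendsto (fun t : ℝ => t • k) (𝓝 0) (𝓝 0) := by
      have : Continuous fun t : ℝ => t • k := by fun_prop
      simpa using this.tendsto 0
    filter_upwards [this.eventually (h η hη)] with t ht
    simp only [norm_smul, mul_pow, Real.norm_eq_abs, sq_abs, map_smul, smul_eq_mul,
      _root_.smul_apply] at ht
    linarith [ht, sq t, mul_assoc t t (A k k)]
  have hL0 : ∀ k, 0 ≤ L k := by
    intro k
    have h1 := (hray 1 one_pos k).filter_mono (nhdsWithin_le_nhds (s := Ioi 0))
    have h2 : Tendsto (fun t : ℝ => L k + t * (A k k + ‖k‖ ^ 2)) (𝓝[>] 0)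
        (𝓝 (L k + 0 * (A k k + ‖k‖ ^ 2))) :=
      (Continuous.tendsto (by fun_prop) 0).mono_left nhdsWithin_le_nhds
    rw [zero_mul, add_zero] at h2
    refine ge_of_tendsto h2 ?_
    filter_upwards [h1, self_mem_nhdsWithin] with t ht (htpos : 0 < t)
    refine le_of_mul_le_mul_left ?_ htpos
    nlinarith
  have hL : ∀ k, L k = 0 := fun k => by
    have := hL0 (-k)
    rw [map_neg] at this
    exact le_antisymm (by linarith) (hL0 k)
  refine ⟨hL, fun k => ?_⟩
  refine le_of_forall_pos_le_add fun e he => ?_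
  have h1 := (hray (e / (‖k‖ ^ 2 + 1)) (by positivity) k).filter_mono
    (nhdsWithin_le_nhds (s := Ioi 0))
  obtain ⟨t, ht, htpos : 0 < t⟩ := (h1.and self_mem_nhdsWithin).exists
  rw [hL k, mul_zero, zero_add] at ht
  have h2 : -(e / (‖k‖ ^ 2 + 1) * ‖k‖ ^ 2) ≤ A k k := by
    refine le_of_mul_le_mul_left ?_ (pow_pos htpos 2)
    linarith
  have h3 : e / (‖k‖ ^ 2 + 1) * ‖k‖ ^ 2 ≤ e := by
    rw [div_mul_eq_mul_div, div_le_iff₀ (by positivity)]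
    nlinarith [sq_nonneg ‖k‖]
  linarith

/-- A second-order expansion from above of a sup-convolution passes to the original function at
the point where the supremum is attained. -/
theorem IsSupConvolution.expansion {f : E × ℝ → ℝ} {K : Set (E × ℝ)} {δ : ℝ}
    {U : E × ℝ → ℝ} (hU : IsSupConvolution f K δ U) {z w : E × ℝ}
    (hz : U z = f w - kernel (z - w) / δ) {g : E × ℝ →L[ℝ] ℝ}
    {B : E × ℝ →L[ℝ] E × ℝ →L[ℝ] ℝ}
    (hexp : ∀ η > 0, ∀ᶠ h in 𝓝 (0 : E × ℝ), U (z + h) ≤ U z + g h + 1 / 2 * B h h + η * ‖h‖ ^ 2)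
    {η : ℝ} (hη : 0 < η) :
    ∀ᶠ h in 𝓝 (0 : E × ℝ), w + h ∈ K →
      f (w + h) ≤ f w + g h + 1 / 2 * B h h + η * ‖h‖ ^ 2 := by
  filter_upwards [hexp η hη] with h hh hK
  have h1 := (hU (z + h)).2 _ hK
  -- Moving both points by `h` leaves the penalty unchanged, so the expansion of `U` at `z` becomes
  -- one of `f` at `w`.
  rw [add_sub_add_right_eq_sub] at h1
  linarith

/-- The first and second derivatives of a sup-convolution are controlled by the kernel. -/
theorem IsSupConvolution.gradient_hessian {f : E × ℝ → ℝ} {K : Set (E × ℝ)} {δ : ℝ} (hδ : 0 < δ)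
    {U : E × ℝ → ℝ} (hU : IsSupConvolution f K δ U) {z w : E × ℝ} (hw : w ∈ K)
    (hz : U z = f w - kernel (z - w) / δ) {g : E × ℝ →L[ℝ] ℝ}
    {B : E × ℝ →L[ℝ] E × ℝ →L[ℝ] ℝ}
    (hexp : ∀ η > 0, ∀ᶠ h in 𝓝 (0 : E × ℝ),
      U (z + h) ≤ U z + g h + 1 / 2 * B h h + η * ‖h‖ ^ 2) :
    (∀ h, g (h, 0) = -(2 / δ * kernelSlope (‖(z - w).1‖ ^ 2) * ⟪(z - w).1, h⟫)) ∧
      ∀ h, -(12 / δ * ‖(z - w).1‖ ^ 2 * ‖h‖ ^ 2) ≤ B (h, 0) (h, 0) := by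
  set ζ := z - w with hζ
  let i := ContinuousLinearMap.inl ℝ E ℝ
  -- With `w` fixed, the kernel gives a lower expansion of `U`, while `hexp` gives an upper one;
  -- their difference is nonnegative up to `o(‖k‖ ^ 2)`.
  have key := linear_eq_zero_and_quadratic_nonneg
    (L := g.comp i + (1 / δ) • (kernelDeriv ζ).comp i)
    (A := (1 / 2 : ℝ) • B.bilinearComp i i + (6 / δ * ‖ζ.1‖ ^ 2) • innerBilin) ?_
  · refine ⟨fun h => ?_, fun h => ?_⟩
    · have := key.1 h
      simp only [i, _root_.add_apply, ContinuousLinearMap.comp_apply, _root_.smul_apply,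
        ContinuousLinearMap.inl_apply, kernelDeriv_apply, smul_eq_mul, mul_zero, add_zero] at this
      have e : 2 / δ * kernelSlope (‖ζ.1‖ ^ 2) * ⟪ζ.1, h⟫ =
        1 / δ * (2 * kernelSlope (‖ζ.1‖ ^ 2) * ⟪ζ.1, h⟫) := by ring
      linarith
    · have := key.2 h
      simp only [i, _root_.add_apply, ContinuousLinearMap.bilinearComp_apply, _root_.smul_apply,
        ContinuousLinearMap.inl_apply, smul_eq_mul, innerBilin_apply,
        real_inner_self_eq_norm_sq] at this
      have e : 12 / δ * ‖ζ.1‖ ^ 2 * ‖h‖ ^ 2 = 2 * (6 / δ * ‖ζ.1‖ ^ 2 * ‖h‖ ^ 2) := by ring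
      linarith
  · intro η hη
    have hi : Tendsto (fun k : E => ((k, 0) : E × ℝ)) (𝓝 0) (𝓝 0) := by
      have : Continuous fun k : E => ((k, 0) : E × ℝ) := by fun_prop
      exact this.tendsto 0
    have hsmall : ∀ᶠ k in 𝓝 (0 : E), 1 / δ * (4 * ‖ζ.1‖ * ‖k‖ + ‖k‖ ^ 2) < η / 2 := by
      have hc : Continuous fun k : E => 1 / δ * (4 * ‖ζ.1‖ * ‖k‖ + ‖k‖ ^ 2) := by fun_prop
      have := hc.tendsto 0
      simp only [norm_zero, mul_zero, ne_eq, OfNat.ofNat_ne_zero, not_false_eq_true, zero_pow,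
        add_zero] at this
      exact this.eventually (gt_mem_nhds (by positivity))
    filter_upwards [hi.eventually (hexp (η / 2) (by positivity)), hsmall] with k hk hk2
    have h1 := (hU (z + (k, 0))).2 w hw
    rw [show z + (k, 0) - w = ζ + (k, 0) by rw [hζ]; abel] at h1
    have h2 := div_le_div_of_nonneg_right (kernel_add_space_le ζ k) hδ.le
    have h3 : ‖((k, 0) : E × ℝ)‖ = ‖k‖ := by simp [Prod.norm_def]
    have h4 := mul_le_mul_of_nonneg_right hk2.le (sq_nonneg ‖k‖)
    rw [h3] at hk
    simp only [i, _root_.add_apply, ContinuousLinearMap.comp_apply, _root_.smul_apply,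
      ContinuousLinearMap.inl_apply, smul_eq_mul, ContinuousLinearMap.bilinearComp_apply,
      innerBilin_apply, real_inner_self_eq_norm_sq]
    have e : (kernel ζ + kernelDeriv ζ (k, 0) + 6 * ‖ζ.1‖ ^ 2 * ‖k‖ ^ 2 +
        (4 * ‖ζ.1‖ * ‖k‖ + ‖k‖ ^ 2) * ‖k‖ ^ 2) / δ = kernel ζ / δ +
        1 / δ * kernelDeriv ζ (k, 0) + 6 / δ * ‖ζ.1‖ ^ 2 * ‖k‖ ^ 2 +
        1 / δ * (4 * ‖ζ.1‖ * ‖k‖ + ‖k‖ ^ 2) * ‖k‖ ^ 2 := by ring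
    linarith

end SupConvolution

end TugOfWar

end

noncomputable section

namespace TugOfWar

variable {n : ℕ}

local notation "𝔼" n => EuclideanSpace ℝ (Fin n)

/-! ### Parabolic jets -/

/-- Trace of a bilinear form in the standard basis. -/
def bilinTrace (X : (𝔼 n) →L[ℝ] (𝔼 n) →L[ℝ] ℝ) : ℝ :=
  ∑ i, X (EuclideanSpace.single i 1) (EuclideanSpace.single i 1)

/-- `(a, g, X)` is a second-order expansion from above of `f` at `z` relative to `K`, up to an
error `κ |t - s|` in time. -/
def HasSuperjet (f : SpaceTime n → ℝ) (K : Set (SpaceTime n)) (z : SpaceTime n) (κ a : ℝ)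
    (g : 𝔼 n) (X : (𝔼 n) →L[ℝ] (𝔼 n) →L[ℝ] ℝ) : Prop :=
  ∀ η > 0, ∀ᶠ w in 𝓝[K] z, f w ≤ f z + a * (w.2 - z.2) + κ * |w.2 - z.2| + inner ℝ g (w.1 - z.1) +
    1 / 2 * X (w.1 - z.1) (w.1 - z.1) + η * (‖w.1 - z.1‖ ^ 2 + |w.2 - z.2|)

/-- The subsolution inequality for a jet. -/
def JetIneq (p a : ℝ) (g : 𝔼 n) (X : (𝔼 n) →L[ℝ] (𝔼 n) →L[ℝ] ℝ) : Prop :=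
  (g ≠ 0 → (n + p) * a ≤ (p - 2) * (X g g / ‖g‖ ^ 2) + bilinTrace X) ∧
  (g = 0 → ∀ l : ℝ, 0 ≤ l → (∀ h, X h h ≤ l * ‖h‖ ^ 2) →
    (n + p) * a ≤ (p - 2) * l + bilinTrace X)

theorem bilinTrace_neg (X : (𝔼 n) →L[ℝ] (𝔼 n) →L[ℝ] ℝ) : bilinTrace (-X) = -bilinTrace X := by
  simp [bilinTrace]

theorem bilinTrace_le {X : (𝔼 n) →L[ℝ] (𝔼 n) →L[ℝ] ℝ} {l : ℝ} (h : ∀ k, X k k ≤ l * ‖k‖ ^ 2) :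
    bilinTrace X ≤ n * l := by
  unfold bilinTrace
  refine (Finset.sum_le_card_nsmul _ _ l fun i _ => ?_).trans ?_
  · simpa using h (EuclideanSpace.single i 1)
  · simp

/-- For nonnegative `l` both alternatives imply the same bound, so small gradients can be treated
without knowing whether they vanish. -/
theorem JetIneq.le_of_le {p a : ℝ} (hp : 2 ≤ p) {g : 𝔼 n} {X : (𝔼 n) →L[ℝ] (𝔼 n) →L[ℝ] ℝ}
    (hj : JetIneq p a g X) {l : ℝ} (hl : 0 ≤ l) (h : ∀ k, X k k ≤ l * ‖k‖ ^ 2) :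
    (n + p) * a ≤ (p - 2) * l + n * l := by
  have ht := bilinTrace_le h
  rcases eq_or_ne g 0 with hg | hg
  · exact (hj.2 hg l hl h).trans (by linarith)
  · refine (hj.1 hg).trans (add_le_add (mul_le_mul_of_nonneg_left ?_ (by linarith)) ht)
    rw [div_le_iff₀ (by positivity)]
    exact h g

/-- Two normalized vectors are close if the vectors are close and one is not small. -/
theorem norm_normalize_sub_le {F : Type*} [NormedAddCommGroup F] [NormedSpace ℝ F] {x y : F}
    (hx : x ≠ 0) (hy : y ≠ 0) : ‖‖x‖⁻¹ • x - ‖y‖⁻¹ • y‖ ≤ 2 * ‖x - y‖ / ‖x‖ := by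
  have hx' : 0 < ‖x‖ := norm_pos_iff.2 hx
  have hy' : 0 < ‖y‖ := norm_pos_iff.2 hy
  have e : ‖x‖⁻¹ • x - ‖y‖⁻¹ • y = ‖x‖⁻¹ • (x - y) + (‖x‖⁻¹ - ‖y‖⁻¹) • y := by
    rw [smul_sub, sub_smul]; abel
  rw [e]
  refine (norm_add_le _ _).trans ?_
  rw [norm_smul, norm_smul, norm_inv, norm_norm]
  have h1 : ‖‖x‖⁻¹ - ‖y‖⁻¹‖ * ‖y‖ = |‖y‖ - ‖x‖| / ‖x‖ := by
    have : ‖x‖⁻¹ - ‖y‖⁻¹ = (‖y‖ - ‖x‖) / (‖x‖ * ‖y‖) := by field_simp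
    rw [this, Real.norm_eq_abs, abs_div, abs_of_pos (mul_pos hx' hy')]
    field_simp
  rw [h1]
  have h2 : |‖y‖ - ‖x‖| ≤ ‖x - y‖ := by
    rw [abs_sub_comm]; exact abs_norm_sub_norm_le x y
  have h3 : ‖x‖⁻¹ * ‖x - y‖ = ‖x - y‖ / ‖x‖ := by ring
  rw [h3, ← add_div]
  gcongr
  linarith

/-- The jet inequalities for opposite Hessians and nearly opposite nonzero gradients. -/
theorem JetIneq.add_le {p a₁ a₂ Λ : ℝ} (hp : 2 ≤ p) {g₁ g₂ : 𝔼 n}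
    {X : (𝔼 n) →L[ℝ] (𝔼 n) →L[ℝ] ℝ} (h₁ : JetIneq p a₁ g₁ X) (h₂ : JetIneq p a₂ g₂ (-X))
    (hg₁ : g₁ ≠ 0) (hg₂ : g₂ ≠ 0) (hX : ‖X‖ ≤ Λ) :
    (n + p) * (a₁ + a₂) ≤ (p - 2) * (4 * Λ * ‖g₁ + g₂‖ / ‖g₁‖) := by
  have e₁ := h₁.1 hg₁
  have e₂ := h₂.1 hg₂
  rw [bilinTrace_neg] at e₂
  have hn1 : 0 < ‖g₁‖ := norm_pos_iff.2 hg₁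
  have hn2 : 0 < ‖g₂‖ := norm_pos_iff.2 hg₂
  have hq : ∀ g : 𝔼 n, g ≠ 0 → X g g / ‖g‖ ^ 2 = X (‖g‖⁻¹ • g) (‖g‖⁻¹ • g) := by
    intro g hg
    have : ‖g‖ ≠ 0 := norm_ne_zero_iff.2 hg
    simp only [map_smul, _root_.smul_apply, smul_eq_mul]
    field_simp
  -- On adding the two inequalities the traces cancel. What remains is the difference of `X` at the
  -- unit vectors along `g₁` and `-g₂`.
  set u := ‖g₁‖⁻¹ • g₁ with hu
  set v := ‖-g₂‖⁻¹ • -g₂ with hv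
  have hu1 : ‖u‖ = 1 := by
    rw [hu, norm_smul, norm_inv, norm_norm]; field_simp
  have hv1 : ‖v‖ = 1 := by
    rw [hv, norm_smul, norm_inv, norm_norm, norm_neg]; field_simp
  have huv : ‖u - v‖ ≤ 2 * ‖g₁ + g₂‖ / ‖g₁‖ := by
    have := norm_normalize_sub_le hg₁ (neg_ne_zero.2 hg₂)
    rwa [sub_neg_eq_add] at this
  have hv2 : X g₂ g₂ / ‖g₂‖ ^ 2 = X v v := by
    rw [hv, ← hq _ (neg_ne_zero.2 hg₂)]; simp
  have hΛ : 0 ≤ Λ := (norm_nonneg X).trans hX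
  have hdiff : X u u - X v v ≤ 2 * Λ * ‖u - v‖ := by
    have e : X u u - X v v = X (u - v) u + X v (u - v) := by
      simp only [map_sub, _root_.sub_apply]; ring
    have b : ∀ x y, X x y ≤ Λ * ‖x‖ * ‖y‖ := fun x y =>
      (le_abs_self _).trans ((X.le_opNorm₂ x y).trans (by gcongr))
    rw [e]
    have b1 := b (u - v) u
    have b2 := b v (u - v)
    rw [hu1] at b1
    rw [hv1] at b2
    linarith
  have hneg : (-X) g₂ g₂ / ‖g₂‖ ^ 2 = -(X v v) := by
    rw [← hv2]; simp [neg_div]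
  rw [hneg] at e₂
  rw [hq g₁ hg₁] at e₁
  have h3 : X u u - X v v ≤ 4 * Λ * ‖g₁ + g₂‖ / ‖g₁‖ := by
    refine hdiff.trans ?_
    calc 2 * Λ * ‖u - v‖ ≤ 2 * Λ * (2 * ‖g₁ + g₂‖ / ‖g₁‖) := by gcongr
      _ = _ := by ring
  have h4 := mul_le_mul_of_nonneg_left h3 (sub_nonneg.2 hp)
  linarith

/-- A full second-order expansion in space-time gives a parabolic superjet. -/
theorem hasSuperjet_of_expansion {f : SpaceTime n → ℝ} {K : Set (SpaceTime n)} {z : SpaceTime n}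
    {g : SpaceTime n →L[ℝ] ℝ} {B : SpaceTime n →L[ℝ] SpaceTime n →L[ℝ] ℝ}
    (h : ∀ η > 0, ∀ᶠ h in 𝓝 (0 : SpaceTime n), z + h ∈ K →
      f (z + h) ≤ f z + g h + 1 / 2 * B h h + η * ‖h‖ ^ 2) :
    HasSuperjet f K z 0 (g (0, 1))
      ((InnerProductSpace.toDual ℝ (𝔼 n)).symm (g.comp (ContinuousLinearMap.inl ℝ (𝔼 n) ℝ)))
      (B.bilinearComp (ContinuousLinearMap.inl ℝ (𝔼 n) ℝ)
        (ContinuousLinearMap.inl ℝ (𝔼 n) ℝ)) := by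
  intro η hη
  have hz : Tendsto (fun w : SpaceTime n => w - z) (𝓝 z) (𝓝 0) := by
    have : Continuous fun w : SpaceTime n => w - z := by fun_prop
    simpa using this.tendsto z
  -- Mixed and pure time terms of `B` are at most `2 * ‖B‖ * ‖k‖ * |t|` and are absorbed by the
  -- error `η * |t|`; the second bound gives `t ^ 2 ≤ |t|`.
  have hsm : ∀ᶠ k in 𝓝 (0 : SpaceTime n), ‖B‖ * ‖k‖ < η / 4 ∧ ‖k‖ < 1 / 2 := by
    have c1 : Tendsto (fun k : SpaceTime n => ‖B‖ * ‖k‖) (𝓝 0) (𝓝 0) := by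
      have : Continuous fun k : SpaceTime n => ‖B‖ * ‖k‖ := by fun_prop
      simpa using this.tendsto 0
    have c2 : Tendsto (fun k : SpaceTime n => ‖k‖) (𝓝 0) (𝓝 0) := by
      simpa using (continuous_norm (E := SpaceTime n)).tendsto 0
    exact (c1.eventually (gt_mem_nhds (by positivity))).and
      (c2.eventually (gt_mem_nhds (by norm_num)))
  filter_upwards [(hz.eventually ((h (η / 2) (by positivity)).and hsm)).filter_mono
    nhdsWithin_le_nhds, self_mem_nhdsWithin] with w hw hwK
  obtain ⟨h1, h2, h3⟩ := hw
  rw [add_sub_cancel] at h1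
  have h1 := h1 hwK
  rw [InnerProductSpace.toDual_symm_apply]
  set k := w - z with hk
  obtain ⟨x, t⟩ := k
  have hx : w.1 - z.1 = x := by rw [← Prod.fst_sub, ← hk]
  have ht : w.2 - z.2 = t := by rw [← Prod.snd_sub, ← hk]
  rw [hx, ht]
  simp only [ContinuousLinearMap.comp_apply, ContinuousLinearMap.inl_apply,
    ContinuousLinearMap.bilinearComp_apply]
  have hsplit : ((x, t) : SpaceTime n) = (x, 0) + t • (0, 1) := by simp
  have hg : g (x, t) = g (x, 0) + t * g (0, 1) := by
    rw [hsplit, map_add, map_smul, smul_eq_mul]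
  have hxn : ‖x‖ ≤ ‖((x, t) : SpaceTime n)‖ := by rw [Prod.norm_def]; exact le_max_left _ _
  have htn : |t| ≤ ‖((x, t) : SpaceTime n)‖ := by rw [Prod.norm_def]; exact le_max_right _ _
  have hB : B (x, t) (x, t) ≤ B (x, 0) (x, 0) + 2 * (‖B‖ * ‖((x, t) : SpaceTime n)‖) * |t| := by
    have hsplit2 : ((x, t) : SpaceTime n) = (x, 0) + (0, t) := by simp
    have e : B (x, t) (x, t) = B (x, 0) (x, 0) + B (x, 0) (0, t) + B (0, t) (x, t) := by
      have : B (x, t) (x, t) = B ((x, 0) + (0, t)) (x, t) := by rw [← hsplit2]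
      rw [this, map_add, _root_.add_apply]
      have : B (x, 0) (x, t) = B (x, 0) ((x, 0) + (0, t)) := by rw [← hsplit2]
      rw [this, map_add]
    have n1 : ‖((x, 0) : SpaceTime n)‖ = ‖x‖ := by simp [Prod.norm_def]
    have n2 : ‖((0, t) : SpaceTime n)‖ = |t| := by simp [Prod.norm_def]
    have b1 := (le_abs_self _).trans (B.le_opNorm₂ (x, 0) (0, t))
    have b2 := (le_abs_self _).trans (B.le_opNorm₂ (0, t) (x, t))
    rw [n1, n2] at b1
    rw [n2] at b2
    have b3 : ‖B‖ * ‖x‖ * |t| ≤ ‖B‖ * ‖((x, t) : SpaceTime n)‖ * |t| := by gcongr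
    rw [e]
    nlinarith
  have hnorm : ‖((x, t) : SpaceTime n)‖ ^ 2 ≤ ‖x‖ ^ 2 + |t| := by
    have ht1 : |t| ^ 2 ≤ |t| := by
      have := abs_nonneg t
      nlinarith
    have : ‖((x, t) : SpaceTime n)‖ = max ‖x‖ |t| := rfl
    rw [this]
    rcases max_cases ‖x‖ |t| with ⟨e, -⟩ | ⟨e, -⟩ <;> rw [e]
    · linarith [abs_nonneg t]
    · nlinarith [sq_nonneg ‖x‖]
  have m1 := mul_le_mul_of_nonneg_right h2.le (abs_nonneg t)
  have m2 := mul_le_mul_of_nonneg_left hnorm hη.le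
  rw [hg] at h1
  nlinarith [sq_nonneg ‖x‖]

/-! ### The comparison principle -/

/-- Points at which the sum of two upper semicontinuous functions is large and which are close to
each other stay away from the set where the sum is small. -/
theorem exists_close_imp {Y : Type*} [PseudoMetricSpace Y] {K : Set Y} (hK : IsCompact K)
    {P : Y → Y → Prop} (hP : ∀ y ∈ K, ∀ᶠ q in 𝓝[K] y ×ˢ 𝓝[K] y, P q.1 q.2) :
    ∃ ω > 0, ∀ a ∈ K, ∀ b ∈ K, dist a b < ω → P a b := by
  -- Otherwise there are pairs at distance tending to zero; by compactness both members converge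
  -- along a subsequence to one point, where the local hypothesis applies.
  by_contra! hcon
  choose a ha b hb hab hnP using fun k : ℕ => hcon (1 / ((k : ℝ) + 1)) (by positivity)
  obtain ⟨y, hy, φ, hφ, hlim⟩ := hK.tendsto_subseq ha
  have hd : Tendsto (fun k => dist (a (φ k)) (b (φ k))) atTop (𝓝 0) :=
    squeeze_zero (fun _ => dist_nonneg) (fun k => (hab (φ k)).le)
      (tendsto_one_div_add_atTop_nhds_zero_nat.comp hφ.tendsto_atTop)
  have hlimb : Tendsto (b ∘ φ) atTop (𝓝 y) := (tendsto_iff_of_dist hd).1 hlim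
  have h1 : Tendsto (a ∘ φ) atTop (𝓝[K] y) :=
    tendsto_nhdsWithin_iff.2 ⟨hlim, Eventually.of_forall fun k => ha _⟩
  have h2 : Tendsto (b ∘ φ) atTop (𝓝[K] y) :=
    tendsto_nhdsWithin_iff.2 ⟨hlimb, Eventually.of_forall fun k => hb _⟩
  obtain ⟨k, hk⟩ := ((h1.prodMk h2).eventually (hP y hy)).exists
  exact hnP (φ k) hk

end TugOfWar

end

noncomputable section

namespace TugOfWar

variable {n : ℕ}

local notation "𝔼" n => EuclideanSpace ℝ (Fin n)

set_option maxHeartbeats 1000000 in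
/-- Comparison of a subsolution `u` of the obstacle problem with (the negative `w` of) a
supersolution on a compact set `K` with boundary part `Γ`. -/
theorem add_nonpos_of_jet_subsolutions {p : ℝ} (hp : 2 ≤ p) {K Γ : Set (SpaceTime n)}
    (hK : IsCompact K) (hΓ : IsClosed Γ) {T : ℝ} (hT : ∀ z ∈ K, 0 ≤ z.2 ∧ z.2 ≤ T)
    {u w ψ : SpaceTime n → ℝ} (hu : UpperSemicontinuousOn u K) (hw : UpperSemicontinuousOn w K)
    (hψ : Continuous ψ) (hΓuw : ∀ z ∈ K, z ∈ Γ → u z + w z ≤ 0) (hwψ : ∀ z ∈ K, w z ≤ -ψ z)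
    (hju : ∀ z ∈ K, z ∉ Γ → ∀ a g X, HasSuperjet u K z 0 a g X → u z ≤ ψ z ∨ JetIneq p a g X)
    (hjw : ∀ z ∈ K, z ∉ Γ → ∀ a g X, HasSuperjet w K z 0 a g X → JetIneq p a g X) :
    ∀ z ∈ K, u z + w z ≤ 0 := by
  by_contra! hcon
  obtain ⟨z₀, hz₀, hpos⟩ := hcon
  set m := u z₀ + w z₀ with hm
  have hT0 : 0 ≤ T := (hT z₀ hz₀).1.trans (hT z₀ hz₀).2
  -- Near `Γ` semicontinuity keeps the sum below `m / 4`. Elsewhere `w ≤ -ψ` and continuity of `ψ`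
  -- show that a sum of at least `m / 4` leaves the obstacle inactive.
  obtain ⟨ω, hω, hclose⟩ := exists_close_imp hK
    (P := fun a b => m / 4 ≤ u a + w b → a ∉ Γ ∧ b ∉ Γ ∧ ψ a < u a) (by
      intro y hy
      by_cases hyΓ : y ∈ Γ
      · have h0 := hΓuw y hy hyΓ
        have e1 := hu y hy (u y + m / 8) (by linarith)
        have e2 := hw y hy (w y + m / 8) (by linarith)
        filter_upwards [e1.prod_mk e2] with q hq hge
        linarith [hq.1, hq.2]
      · have e0 : ∀ᶠ a in 𝓝[K] y, a ∉ Γ :=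
          (hΓ.isOpen_compl.mem_nhds hyΓ : Γᶜ ∈ 𝓝 y) |> mem_nhdsWithin_of_mem_nhds
        have e1 : ∀ᶠ a in 𝓝[K] y, |ψ a - ψ y| < m / 8 ∧ a ∈ K := by
          refine Eventually.and ?_ self_mem_nhdsWithin
          refine mem_nhdsWithin_of_mem_nhds ?_
          have := (hψ.tendsto y).eventually (Metric.ball_mem_nhds (ψ y) (ε := m / 8) (by linarith))
          exact this
        filter_upwards [(e0.and e1).prod_mk (e0.and e1)] with q hq hge
        refine ⟨hq.1.1, hq.2.1, ?_⟩
        by_contra! hle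
        have h1 := hwψ q.2 hq.2.2.2
        have h2 := abs_lt.1 hq.1.2.1
        have h3 := abs_lt.1 hq.2.2.1
        linarith [h2.2, h3.1])
  -- The tilt `-η₀ * t` makes `u` a strict subsolution and costs at most `m / 4` at `z₀`.
  set η₀ := m / (4 * (T + 1)) with hη₀
  have hη₀pos : 0 < η₀ := by positivity
  have hη₀T : η₀ * T ≤ m / 4 := by
    rw [hη₀, div_mul_eq_mul_div, div_le_div_iff₀ (by positivity) (by norm_num)]
    nlinarith
  set f : SpaceTime n → ℝ := fun z => u z - η₀ * z.2 with hf
  have hfusc : UpperSemicontinuousOn f K := by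
    have hc : Continuous fun z : SpaceTime n => -(η₀ * z.2) := by fun_prop
    have := hu.add (hc.upperSemicontinuous.upperSemicontinuousOn K)
    simp only [hf, sub_eq_add_neg]
    exact this
  have hne : K.Nonempty := ⟨z₀, hz₀⟩
  obtain ⟨zf, hzf, hfmax⟩ := hfusc.exists_isMaxOn hne hK
  obtain ⟨zw, hzw, hwmax⟩ := hw.exists_isMaxOn hne hK
  set M := |f zf| + |w zw| with hMdef
  have hM0 : 0 ≤ M := by positivity
  have hfM : ∀ z ∈ K, ∀ y ∈ K, f z + w y ≤ M := fun z hz y hy =>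
    add_le_add ((hfmax hz).trans (le_abs_self _)) ((hwmax hy).trans (le_abs_self _))
  obtain ⟨D, hD⟩ := hK.isBounded.exists_norm_le
  have hD0 : 0 ≤ D := (norm_nonneg _).trans (hD z₀ hz₀)
  obtain ⟨c, hc, hkc⟩ := exists_kernel_lt_imp (E := 𝔼 n) (half_pos hω)
  -- A penalty of at most `M` then forces distance below `ω / 2`; the bound `δ ≤ 1` transfers the
  -- growth of the kernel to the penalty.
  set δ := min 1 (c / (M + 1)) with hδdef
  have hδ : 0 < δ := by positivity
  have hδ1 : δ ≤ 1 := min_le_left _ _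
  have hδM : δ * M < c := by
    have : δ * (M + 1) ≤ c := by
      rw [← le_div_iff₀ (by positivity)]; exact min_le_right _ _
    nlinarith
  obtain ⟨U, hU⟩ := exists_isSupConvolution hK hne hfusc δ
  obtain ⟨W, hW⟩ := exists_isSupConvolution hK hne hw δ
  have hdiv : ∀ ζ : SpaceTime n, kernel ζ ≤ kernel ζ / δ := fun ζ => by
    rw [le_div_iff₀ hδ]
    exact mul_le_of_le_one_right (kernel_nonneg ζ) hδ1
  have hz₀UW : 3 * m / 4 ≤ U z₀ + W z₀ := by
    have h1 := (hU z₀).2 z₀ hz₀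
    have h2 := (hW z₀).2 z₀ hz₀
    rw [sub_self, kernel_zero, zero_div, sub_zero] at h1 h2
    have h3 : η₀ * z₀.2 ≤ η₀ * T := mul_le_mul_of_nonneg_left (hT z₀ hz₀).2 hη₀pos.le
    simp only [hf] at h1
    linarith
  set R := (M + 3 + 2 * D) + 2 * D with hR
  have hapriori : ∀ q : SpaceTime n →L[ℝ] ℝ, ‖q‖ < 1 → ∀ z,
      U z₀ + W z₀ - q z₀ ≤ U z + W z - q z → ‖z - z₀‖ ≤ R := by
    intro q hq z hz
    obtain ⟨⟨a, ha, hUa⟩, -⟩ := hU z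
    obtain ⟨⟨b, hb, hWb⟩, -⟩ := hW z
    have h1 := hfM a ha b hb
    have h2 := hdiv (z - a)
    have h3 := norm_sq_le_kernel (z - a)
    have h4 : 0 ≤ kernel (z - b) / δ := div_nonneg (kernel_nonneg _) hδ.le
    have h5 : -(q (z - z₀)) ≤ 1 * ‖z - z₀‖ :=
      (neg_le_abs _).trans (q.le_of_opNorm_le hq.le _)
    rw [map_sub] at h5
    have h6 : ‖z - z₀‖ ≤ ‖z - a‖ + 2 * D := by
      calc ‖z - z₀‖ = ‖(z - a) + (a - z₀)‖ := by rw [sub_add_sub_cancel]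
        _ ≤ ‖z - a‖ + (‖a‖ + ‖z₀‖) := (norm_add_le _ _).trans (by gcongr; exact norm_sub_le _ _)
        _ ≤ _ := by linarith [hD a ha, hD z₀ hz₀]
    have h7 : ‖z - a‖ ^ 2 ≤ M + 1 + (‖z - a‖ + 2 * D) := by linarith
    have h8 : ‖z - a‖ ≤ M + 3 + 2 * D := by
      by_contra! hlt
      nlinarith
    linarith
  have hmax : ∀ q : SpaceTime n →L[ℝ] ℝ, ‖q‖ < 1 →
      ∃ z, ∀ y, U y + W y - q y ≤ U z + W z - q z := by
    intro q hq
    have hcont : Continuous fun z => U z + W z - q z :=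
      ((hU.continuous hδ).add (hW.continuous hδ)).sub q.continuous
    have hR0 : 0 ≤ R := by positivity
    obtain ⟨z, hz, hzmax⟩ := (isCompact_closedBall z₀ R).exists_isMaxOn
      ⟨z₀, Metric.mem_closedBall_self hR0⟩ hcont.continuousOn
    refine ⟨z, fun y => ?_⟩
    have h0 := hzmax (Metric.mem_closedBall_self hR0)
    simp only [mem_ofPred_eq] at h0
    by_contra! hlt
    have h1 := hapriori q hq y (h0.trans hlt.le)
    have h2 : y ∈ Metric.closedBall z₀ R := by rwa [mem_closedBall_iff_norm]
    exact absurd (hzmax h2) (not_le.2 hlt)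
  obtain ⟨Λ, hΛ⟩ := exists_second_order_separation ((3 / δ) • spaceTimeInner)
    (hU.support hδ) (hW.support hδ) hmax
  have hnp : 0 < (n : ℝ) + p := by positivity
  -- If both `X` and `-X` are bounded above by `κ'`, the two jet inequalities contradict the time
  -- gain `η₀ / 2`.
  obtain ⟨κ', hκ', hκ'2⟩ : ∃ κ' > 0, 2 * ((p - 2) * κ' + n * κ') < (n + p) * (η₀ / 2) := by
    refine ⟨η₀ / 8, by positivity, ?_⟩
    nlinarith [mul_pos hnp hη₀pos, Nat.cast_nonneg (α := ℝ) n]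
  -- A kernel gradient below `κ` forces the displacement `x` to be small, and with it the Hessian
  -- bound `12 / δ * ‖x‖ ^ 2`.
  obtain ⟨κ, hκ, hκ2⟩ : ∃ κ > 0, ∀ x : 𝔼 n,
      2 / δ * kernelSlope (‖x‖ ^ 2) * ‖x‖ < κ → 12 / δ * ‖x‖ ^ 2 ≤ κ' := by
    set s := δ * κ' / 12 with hs
    have hs0 : 0 < s := by positivity
    refine ⟨2 / δ * kernelSlope s * √s, by have := kernelSlope_pos hs0; positivity, fun x hx => ?_⟩
    by_contra! hlt
    have h1 : s ≤ ‖x‖ ^ 2 := by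
      rw [hs]
      rw [div_mul_eq_mul_div, lt_div_iff₀ hδ] at hlt
      linarith
    have h2 : √s ≤ ‖x‖ := by
      rw [Real.sqrt_le_left (norm_nonneg _)]; exact h1
    have h3 := kernelSlope_mono hs0.le h1
    have h4 := kernelSlope_nonneg hs0.le
    have h6 := kernelSlope_nonneg (sq_nonneg ‖x‖)
    have h5 : 2 / δ * kernelSlope s * √s ≤ 2 / δ * kernelSlope (‖x‖ ^ 2) * ‖x‖ := by gcongr
    linarith
  have hΛ0 : 0 ≤ |Λ| := abs_nonneg Λ
  -- Since `Λ` does not depend on `r`, the tilt can be taken small against the gain `η₀`, the height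
  -- `m`, the threshold `κ` and the error in `JetIneq.add_le`.
  obtain ⟨r, hr, hr1, hrη, hrm, hrκ, hrΛ⟩ : ∃ r > 0, r ≤ 1 ∧ r < η₀ / 2 ∧ r * R ≤ m / 4 ∧
      r ≤ κ / 2 ∧ (p - 2) * (4 * |Λ| * r / (κ / 2)) < (n + p) * (η₀ / 2) := by
    have hR0 : 0 ≤ R := by positivity
    have key : ∀ᶠ r in 𝓝[>] (0 : ℝ), r ≤ 1 ∧ r < η₀ / 2 ∧ r * R < m / 4 ∧
      r < κ / 2 ∧ (p - 2) * (4 * |Λ| * r / (κ / 2)) < (n + p) * (η₀ / 2) := by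
      have t : Tendsto (fun r : ℝ => r) (𝓝[>] 0) (𝓝 0) := nhdsWithin_le_nhds
      have t1 : Tendsto (fun r : ℝ => r * R) (𝓝[>] 0) (𝓝 0) := by
        simpa using t.mul_const R
      have t2 : Tendsto (fun r : ℝ => (p - 2) * (4 * |Λ| * r / (κ / 2))) (𝓝[>] 0) (𝓝 0) := by
        simpa using ((t.const_mul (4 * |Λ|)).div_const (κ / 2)).const_mul (p - 2)
      refine (t.eventually (ge_mem_nhds one_pos)).and ((t.eventually (gt_mem_nhds ?_)).and
        ((t1.eventually (gt_mem_nhds ?_)).and ((t.eventually (gt_mem_nhds ?_)).and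
        (t2.eventually (gt_mem_nhds ?_))))) <;> positivity
    obtain ⟨r, ⟨h1, h2, h3, h4, h5⟩, hr⟩ := (key.and self_mem_nhdsWithin).exists
    exact ⟨r, hr, h1, h2, h3.le, h4.le, h5⟩
  obtain ⟨q, g, B, z, hq, hB, hzmax, hUexp, hWexp⟩ := hΛ r hr
  obtain ⟨⟨a, ha, hUa⟩, -⟩ := hU z
  obtain ⟨⟨b, hb, hWb⟩, -⟩ := hW z
  have hzR := hapriori q (hq.trans_le hr1) z (hzmax z₀)
  have hmz : m / 2 ≤ U z + W z := by
    have h1 := hzmax z₀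
    have h2 : -(q (z - z₀)) ≤ r * R :=
      (neg_le_abs _).trans ((q.le_of_opNorm_le hq.le _).trans (by gcongr))
    rw [map_sub] at h2
    linarith
  have hka : 0 ≤ kernel (z - a) / δ := div_nonneg (kernel_nonneg _) hδ.le
  have hkb : 0 ≤ kernel (z - b) / δ := div_nonneg (kernel_nonneg _) hδ.le
  have hfab := hfM a ha b hb
  have hdist : ∀ y, kernel (z - y) / δ ≤ M → ‖z - y‖ < ω / 2 := by
    intro y hy
    refine hkc _ (lt_of_le_of_lt ?_ hδM)
    rw [div_le_iff₀ hδ] at hy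
    linarith
  have hda := hdist a (by linarith)
  have hdb := hdist b (by linarith)
  have hab : dist a b < ω := by
    have h1 : dist z a < ω / 2 := by rwa [dist_eq_norm]
    have h2 : dist z b < ω / 2 := by rwa [dist_eq_norm]
    linarith [dist_triangle_left a b z]
  have hfa : f a ≤ u a := by
    simp only [hf]
    linarith [mul_nonneg hη₀pos.le (hT a ha).1]
  obtain ⟨haΓ, hbΓ, hψa⟩ := hclose a ha b hb hab (by linarith)
  set i := ContinuousLinearMap.inl ℝ (𝔼 n) ℝ with hi
  set G₁ := (InnerProductSpace.toDual ℝ (𝔼 n)).symm (g.comp i) with hG₁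
  set G₂ := (InnerProductSpace.toDual ℝ (𝔼 n)).symm ((q - g).comp i) with hG₂
  set X := B.bilinearComp i i with hX
  have hju' : JetIneq p (g (0, 1) + η₀) G₁ X := by
    -- Undoing the tilt raises the time slope by `η₀` and leaves the spatial jet unchanged.
    have hjet : HasSuperjet u K a 0 ((g + η₀ • ContinuousLinearMap.snd ℝ (𝔼 n) ℝ) (0, 1))
        ((InnerProductSpace.toDual ℝ (𝔼 n)).symm
          ((g + η₀ • ContinuousLinearMap.snd ℝ (𝔼 n) ℝ).comp i)) X := by
      refine hasSuperjet_of_expansion fun η hη => ?_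
      filter_upwards [hU.expansion hUa hUexp hη] with h hh hhK
      have := hh hhK
      simp only [hf, Prod.snd_add] at this
      simp only [_root_.add_apply, _root_.smul_apply, ContinuousLinearMap.coe_snd', smul_eq_mul]
      linarith
    have e1 : (g + η₀ • ContinuousLinearMap.snd ℝ (𝔼 n) ℝ) (0, 1) = g (0, 1) + η₀ := by simp
    have e2 : (g + η₀ • ContinuousLinearMap.snd ℝ (𝔼 n) ℝ).comp i = g.comp i := by
      ext x; simp [hi]
    rw [e1, e2] at hjet
    exact (hju a ha haΓ _ _ _ hjet).resolve_left (not_le.2 hψa)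
  have hWexp' : ∀ η > 0, ∀ᶠ h in 𝓝 (0 : SpaceTime n),
      W (z + h) ≤ W z + (q - g) h + 1 / 2 * (-B) h h + η * ‖h‖ ^ 2 := by
    intro η hη
    filter_upwards [hWexp η hη] with h hh
    simp only [_root_.neg_apply]
    linarith
  have hjw' : JetIneq p ((q - g) (0, 1)) G₂ (-X) :=
    hjw b hb hbΓ _ _ _ (hasSuperjet_of_expansion fun η hη => hW.expansion hWb hWexp' hη)
  obtain ⟨hg1, hX1⟩ := hU.gradient_hessian hδ ha hUa hUexp
  obtain ⟨hg2, hX2⟩ := hW.gradient_hessian hδ hb hWb hWexp'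
  have hq01 : q (0, 1) ≤ r := by
    have h1 := (le_abs_self _).trans (q.le_of_opNorm_le hq.le (0, 1))
    have h2 : ‖((0, 1) : SpaceTime n)‖ = 1 := by simp [Prod.norm_def]
    rwa [h2, mul_one] at h1
  have hq01' : -r ≤ q (0, 1) := by
    have h1 := (neg_le_abs _).trans (q.le_of_opNorm_le hq.le (0, 1))
    have h2 : ‖((0, 1) : SpaceTime n)‖ = 1 := by simp [Prod.norm_def]
    rw [h2, mul_one] at h1
    linarith
  have hsum : (n + p) * (η₀ / 2) < (n + p) * (g (0, 1) + η₀ + (q - g) (0, 1)) := by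
    refine mul_lt_mul_of_pos_left ?_ hnp
    simp only [_root_.sub_apply]
    linarith
  have hinl : ‖i‖ ≤ 1 := ContinuousLinearMap.norm_inl_le_one ℝ (𝔼 n) ℝ
  have hGsum : ‖G₁ + G₂‖ ≤ r := by
    rw [hG₁, hG₂, ← map_add, LinearIsometryEquiv.norm_map, ← ContinuousLinearMap.add_comp,
      add_sub_cancel]
    calc ‖q.comp i‖ ≤ ‖q‖ * ‖i‖ := ContinuousLinearMap.opNorm_comp_le _ _
      _ ≤ r * 1 := by gcongr
      _ = r := mul_one r
  have hvec : ∀ (ζ : 𝔼 n) (l : SpaceTime n →L[ℝ] ℝ),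
      (∀ h, l (h, 0) = -(2 / δ * kernelSlope (‖ζ‖ ^ 2) * inner ℝ ζ h)) →
      ‖(InnerProductSpace.toDual ℝ (𝔼 n)).symm (l.comp i)‖ =
        2 / δ * kernelSlope (‖ζ‖ ^ 2) * ‖ζ‖ := by
    intro ζ l hl
    have : l.comp i = InnerProductSpace.toDual ℝ (𝔼 n)
        (-(2 / δ * kernelSlope (‖ζ‖ ^ 2)) • ζ) := by
      ext h
      rw [InnerProductSpace.toDual_apply_apply, inner_smul_left]
      simp only [hi, ContinuousLinearMap.comp_apply, ContinuousLinearMap.inl_apply, hl h]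
      simp
    rw [this, LinearIsometryEquiv.symm_apply_apply, norm_smul, norm_neg,
      Real.norm_of_nonneg]
    have := kernelSlope_nonneg (sq_nonneg ‖ζ‖)
    positivity
  have hXnorm : ‖X‖ ≤ |Λ| := by
    refine X.opNorm_le_bound₂ hΛ0 fun x y => ?_
    simp only [hX, hi, ContinuousLinearMap.bilinearComp_apply, ContinuousLinearMap.inl_apply]
    have h1 := B.le_opNorm₂ (x, 0) (y, 0)
    have n1 : ∀ x : 𝔼 n, ‖((x, 0) : SpaceTime n)‖ = ‖x‖ := fun x => by simp [Prod.norm_def]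
    rw [n1, n1] at h1
    refine h1.trans ?_
    have := hB.trans (le_abs_self Λ)
    gcongr
  -- If both gradients are small, the lower Hessian bounds are used crosswise: the one for `W`
  -- bounds `X` from above, the one for `U` bounds `-X`. Otherwise both gradients are at least `κ /
  -- 2`, as their sum has norm at most `r`.
  by_cases hsmall : ‖G₁‖ < κ ∧ ‖G₂‖ < κ
  · have hk1 := hκ2 _ (by rw [← hvec _ g hg1]; exact hsmall.1)
    have hk2 := hκ2 _ (by rw [← hvec _ (q - g) hg2]; exact hsmall.2)
    have l1 : ∀ k, X k k ≤ κ' * ‖k‖ ^ 2 := by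
      intro k
      have h1 := hX2 k
      have h2 := mul_le_mul_of_nonneg_right hk2 (sq_nonneg ‖k‖)
      simp only [_root_.neg_apply] at h1
      simp only [hX, hi, ContinuousLinearMap.bilinearComp_apply, ContinuousLinearMap.inl_apply]
      linarith
    have l2 : ∀ k, (-X) k k ≤ κ' * ‖k‖ ^ 2 := by
      intro k
      have h1 := hX1 k
      have h2 := mul_le_mul_of_nonneg_right hk1 (sq_nonneg ‖k‖)
      simp only [hX, hi, _root_.neg_apply, ContinuousLinearMap.bilinearComp_apply,
        ContinuousLinearMap.inl_apply]
      linarith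
    have j1 := hju'.le_of_le hp hκ'.le l1
    have j2 := hjw'.le_of_le hp hκ'.le l2
    linarith
  · have hlarge : κ / 2 ≤ ‖G₁‖ ∧ κ / 2 ≤ ‖G₂‖ := by
      have t1 : ‖G₁‖ ≤ ‖G₁ + G₂‖ + ‖G₂‖ := by
        simpa using norm_sub_le (G₁ + G₂) G₂
      have t2 : ‖G₂‖ ≤ ‖G₁ + G₂‖ + ‖G₁‖ := by
        simpa using norm_sub_le (G₁ + G₂) G₁
      rw [not_and_or, not_lt, not_lt] at hsmall
      rcases hsmall with h | h <;> constructor <;> linarith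
    have hG1 : G₁ ≠ 0 := norm_pos_iff.1 (by linarith [hlarge.1])
    have hG2 : G₂ ≠ 0 := norm_pos_iff.1 (by linarith [hlarge.2])
    have j := hju'.add_le hp hjw' hG1 hG2 hXnorm
    have : (p - 2) * (4 * |Λ| * ‖G₁ + G₂‖ / ‖G₁‖) ≤ (p - 2) * (4 * |Λ| * r / (κ / 2)) := by
      have := hlarge.1
      have : 0 ≤ p - 2 := by linarith
      gcongr
    linarith

end TugOfWar

end

noncomputable section

namespace TugOfWar

variable {n : ℕ}

local notation "𝔼" n => EuclideanSpace ℝ (Fin n)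

/-! ### Moments of balls -/

theorem setIntegral_ball_comp_isometry (L : (𝔼 n) ≃ₗᵢ[ℝ] (𝔼 n)) (f : (𝔼 n) → ℝ) (ε : ℝ) :
    ∫ h in Metric.ball 0 ε, f (L h) = ∫ h in Metric.ball 0 ε, f h := by
  have h1 := L.measurePreserving.setIntegral_preimage_emb L.toHomeomorph.measurableEmbedding f
    (Metric.ball 0 ε)
  rwa [L.preimage_ball, map_zero] at h1

/-- The integrand is odd under reflection of the `i`-th coordinate. -/
theorem setIntegral_ball_mul_eq_zero {i j : Fin n} (hij : i ≠ j) (ε : ℝ) :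
    ∫ h : 𝔼 n in Metric.ball 0 ε, h i * h j = 0 := by
  let L : (𝔼 n) ≃ₗᵢ[ℝ] (𝔼 n) := LinearIsometryEquiv.piLpCongrRight 2 fun k =>
    if k = i then LinearIsometryEquiv.neg ℝ else LinearIsometryEquiv.refl ℝ ℝ
  have h1 := setIntegral_ball_comp_isometry L (fun h => h i * h j) ε
  have h2 : ∀ h : 𝔼 n, (L h) i * (L h) j = -(h i * h j) := by
    intro h
    simp [L, hij.symm]
  simp only [h2] at h1
  rw [integral_neg] at h1
  linarith

theorem setIntegral_ball_sq_eq (i j : Fin n) (ε : ℝ) :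
    ∫ h : 𝔼 n in Metric.ball 0 ε, h i * h i = ∫ h : 𝔼 n in Metric.ball 0 ε, h j * h j := by
  let L : (𝔼 n) ≃ₗᵢ[ℝ] (𝔼 n) := LinearIsometryEquiv.piLpCongrLeft 2 ℝ ℝ (Equiv.swap i j)
  have h1 := setIntegral_ball_comp_isometry L (fun h => h j * h j) ε
  have h2 : ∀ h : 𝔼 n, (L h) j = h i := by
    intro h
    simp [L, LinearIsometryEquiv.piLpCongrLeft_apply, Equiv.piCongrLeft']
  simpa only [h2] using h1

/-- Polar coordinates reduce both this integral and the volume to powers of `ε`. By symmetry each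
coordinate carries an equal share, which fixes the constant `ε ^ 2 / (n + 2)` of the second moments.
-/
theorem setIntegral_ball_norm_sq {ε : ℝ} (hε : 0 < ε) (hn : 0 < n) :
    ∫ h : 𝔼 n in Metric.ball 0 ε, ‖h‖ ^ 2 =
      n * (ε ^ 2 / (n + 2)) * volume.real (Metric.ball (0 : 𝔼 n) ε) := by
  have : Nonempty (Fin n) := ⟨⟨0, hn⟩⟩
  have h1 := integral_fun_norm_addHaar (volume : Measure (𝔼 n))
    ((Iio ε).indicator fun y => y ^ 2)
  have h2 : ∀ x : 𝔼 n, (Iio ε).indicator (fun y : ℝ => y ^ 2) ‖x‖ =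
      (Metric.ball (0 : 𝔼 n) ε).indicator (fun h => ‖h‖ ^ 2) x := by
    intro x
    by_cases hx : ‖x‖ < ε
    · rw [indicator_of_mem (by exact hx), indicator_of_mem (by simpa using hx)]
    · rw [indicator_of_notMem (by exact hx), indicator_of_notMem (by simpa using hx)]
  simp only [h2] at h1
  rw [integral_indicator measurableSet_ball] at h1
  rw [h1, finrank_euclideanSpace_fin]
  have h3 : ∫ y in Ioi (0 : ℝ), y ^ (n - 1) • (Iio ε).indicator (fun y => y ^ 2) y =
      ε ^ (n + 2) / (n + 2) := by
    have e : ∀ y : ℝ, y ^ (n - 1) • (Iio ε).indicator (fun y => y ^ 2) y =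
        (Iio ε).indicator (fun y => y ^ (n + 1)) y := by
      intro y
      by_cases hy : y < ε
      · rw [indicator_of_mem (by exact hy), indicator_of_mem (by exact hy), smul_eq_mul, ← pow_add]
        congr 1
        omega
      · rw [indicator_of_notMem (by exact hy), indicator_of_notMem (by exact hy), smul_zero]
    simp only [e]
    rw [setIntegral_indicator measurableSet_Iio, Ioi_inter_Iio, ← integral_Ioc_eq_integral_Ioo,
      ← intervalIntegral.integral_of_le hε.le, integral_pow]
    push_cast
    rw [zero_pow (by omega)]
    ring
  have h4 : volume.real (Metric.ball (0 : 𝔼 n) ε) =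
      ε ^ n * volume.real (Metric.ball (0 : 𝔼 n) 1) := by
    rw [Measure.real, Measure.addHaar_ball_of_pos _ _ hε, finrank_euclideanSpace_fin,
      ENNReal.toReal_mul, ENNReal.toReal_ofReal (by positivity)]
    rfl
  rw [h3, h4, nsmul_eq_mul, smul_eq_mul]
  ring

theorem integrableOn_ball_of_continuous {f : (𝔼 n) → ℝ} (hf : Continuous f) (x : 𝔼 n) (ε : ℝ) :
    IntegrableOn f (Metric.ball x ε) :=
  (hf.continuousOn.integrableOn_compact (isCompact_closedBall x ε)).mono_set
    Metric.ball_subset_closedBall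

theorem setIntegral_ball_coord_sq {ε : ℝ} (hε : 0 < ε) (i : Fin n) :
    ∫ h : 𝔼 n in Metric.ball 0 ε, h i * h i =
      ε ^ 2 / (n + 2) * volume.real (Metric.ball (0 : 𝔼 n) ε) := by
  have hn : 0 < n := i.pos
  have h1 := setIntegral_ball_norm_sq hε hn
  have h2 : ∀ h : 𝔼 n, ‖h‖ ^ 2 = ∑ j, h j * h j := fun h => by
    rw [EuclideanSpace.real_norm_sq_eq]
    exact Finset.sum_congr rfl fun j _ => sq _
  simp only [h2] at h1
  rw [integral_finsetSum _ fun j _ => integrableOn_ball_of_continuous (by fun_prop) _ _,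
    Finset.sum_congr rfl fun j _ => setIntegral_ball_sq_eq j i ε, Finset.sum_const,
    Finset.card_univ, Fintype.card_fin, nsmul_eq_mul, mul_assoc] at h1
  exact mul_left_cancel₀ (by positivity) h1

theorem bilin_apply_eq_sum (X : (𝔼 n) →L[ℝ] (𝔼 n) →L[ℝ] ℝ) (h : 𝔼 n) :
    X h h = ∑ i, ∑ j, h i * h j *
      X (EuclideanSpace.single i 1) (EuclideanSpace.single j 1) := by
  have e : h = ∑ i, h i • EuclideanSpace.single i (1 : ℝ) := by
    have := (EuclideanSpace.basisFun (Fin n) ℝ).sum_repr h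
    simpa using this.symm
  conv_lhs => rw [e]
  simp only [map_sum, map_smul, _root_.sum_apply, _root_.smul_apply, smul_eq_mul]
  simp only [Finset.mul_sum, mul_assoc]
  rw [Finset.sum_comm]
  refine Finset.sum_congr rfl fun i _ => Finset.sum_congr rfl fun j _ => ?_
  ring

theorem setIntegral_ball_bilin (X : (𝔼 n) →L[ℝ] (𝔼 n) →L[ℝ] ℝ) {ε : ℝ} (hε : 0 < ε) :
    ∫ h : 𝔼 n in Metric.ball 0 ε, X h h =
      ε ^ 2 / (n + 2) * bilinTrace X * volume.real (Metric.ball (0 : 𝔼 n) ε) := by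
  simp only [bilin_apply_eq_sum X]
  have hint : ∀ i j, IntegrableOn (fun h : 𝔼 n => h i * h j *
      X (EuclideanSpace.single i 1) (EuclideanSpace.single j 1)) (Metric.ball 0 ε) :=
    fun i j => integrableOn_ball_of_continuous (by fun_prop) _ _
  rw [integral_finsetSum _ fun i _ => integrable_finsetSum _ fun j _ => hint i j, bilinTrace,
    Finset.mul_sum, Finset.sum_mul]
  refine Finset.sum_congr rfl fun i _ => ?_
  rw [integral_finsetSum _ fun j _ => hint i j, Finset.sum_eq_single i]
  · rw [integral_mul_const, setIntegral_ball_coord_sq hε i]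
    ring
  · intro j _ hj
    rw [integral_mul_const, setIntegral_ball_mul_eq_zero hj.symm, zero_mul]
  · simp

theorem setIntegral_ball_linear (l : (𝔼 n) →L[ℝ] ℝ) (ε : ℝ) :
    ∫ h : 𝔼 n in Metric.ball 0 ε, l h = 0 := by
  have h1 := setIntegral_ball_comp_isometry (LinearIsometryEquiv.neg ℝ) l ε
  simp only [LinearIsometryEquiv.coe_neg, map_neg, integral_neg] at h1
  linarith

theorem setAverage_ball_quadratic (c : ℝ) (l : (𝔼 n) →L[ℝ] ℝ)
    (X : (𝔼 n) →L[ℝ] (𝔼 n) →L[ℝ] ℝ) (x : 𝔼 n) {ε : ℝ} (hε : 0 < ε) :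
    ⨍ y in Metric.ball x ε, (c + l (y - x) + 1 / 2 * X (y - x) (y - x)) =
      c + ε ^ 2 / (2 * (n + 2)) * bilinTrace X := by
  have hvol : 0 < volume.real (Metric.ball (0 : 𝔼 n) ε) :=
    ENNReal.toReal_pos (Metric.measure_ball_pos _ _ hε).ne' measure_ball_lt_top.ne
  have hvx : volume.real (Metric.ball x ε) = volume.real (Metric.ball (0 : 𝔼 n) ε) := by
    rw [Measure.addHaar_real_ball_center]
  have h1 : ∫ y in Metric.ball x ε, (c + l (y - x) + 1 / 2 * X (y - x) (y - x)) =
      ∫ h in Metric.ball (0 : 𝔼 n) ε, (c + l h + 1 / 2 * X h h) := by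
    have := (measurePreserving_sub_right (volume : Measure (𝔼 n)) x).setIntegral_preimage_emb
      (MeasurableEquiv.subRight x).measurableEmbedding
      (fun h => c + l h + 1 / 2 * X h h) (Metric.ball 0 ε)
    rw [← this]
    congr 2
    ext y
    simp [dist_eq_norm]
  have i1 : IntegrableOn (fun _ : 𝔼 n => c) (Metric.ball 0 ε) :=
    integrableOn_ball_of_continuous continuous_const _ _
  have i2 : IntegrableOn (fun h : 𝔼 n => l h) (Metric.ball 0 ε) :=
    integrableOn_ball_of_continuous l.continuous _ _
  have i3 : IntegrableOn (fun h : 𝔼 n => 1 / 2 * X h h) (Metric.ball 0 ε) :=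
    integrableOn_ball_of_continuous (by fun_prop) _ _
  have i12 : IntegrableOn (fun h : 𝔼 n => c + l h) (Metric.ball 0 ε) := i1.add i2
  rw [setAverage_eq, h1, hvx, integral_add i12 i3, integral_add i1 i2,
    setIntegral_ball_linear, integral_const_mul, setIntegral_ball_bilin X hε, setIntegral_const,
    smul_eq_mul, smul_eq_mul]
  field_simp
  ring

/-! ### The one-step operator of the game -/

/-- The value of one step of the game without obstacle. -/
def gameStep (p ε : ℝ) (f : (𝔼 n) → ℝ) (x : 𝔼 n) : ℝ :=
  (p - 2) / (p + n) / 2 * ((⨆ y : Metric.ball x ε, f y) + ⨅ y : Metric.ball x ε, f y) +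
    (n + 2) / (p + n) * ⨍ y in Metric.ball x ε, f y

/-- Supremum and infimum have equal weights and are exchanged by negation. This allows
supersolutions to be treated as negatives of subsolutions. -/
theorem gameStep_neg (p ε : ℝ) (f : (𝔼 n) → ℝ) (x : 𝔼 n) :
    gameStep p ε (fun y => -f y) x = -gameStep p ε f x := by
  have h1 : ∀ g : Metric.ball x ε → ℝ, (⨆ y, -g y) = -⨅ y, g y := by
    intro g
    have : range (fun y => -g y) = -range g := by
      ext r
      simp only [mem_range, Set.mem_neg]
      exact exists_congr fun y => neg_eq_iff_eq_neg
    rw [iSup, this, Real.sSup_neg, iInf]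
  have h2 : (⨅ y : Metric.ball x ε, -f y) = -⨆ y : Metric.ball x ε, f y := by
    have := h1 fun y => -f y
    simp only [neg_neg] at this
    rw [this, neg_neg]
  have h3 : ⨍ y in Metric.ball x ε, -f y = -⨍ y in Metric.ball x ε, f y := by
    rw [setAverage_eq, setAverage_eq, integral_neg, smul_neg]
  unfold gameStep
  rw [h1 fun y => f y, h2, h3]
  ring

theorem gameStep_le_of_le {p ε M : ℝ} (hp : 2 ≤ p) (hε : 0 < ε) {f : (𝔼 n) → ℝ}
    {x : 𝔼 n} (hf : ∀ y ∈ Metric.ball x ε, |f y| ≤ M) : gameStep p ε f x ≤ M := by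
  have : Nonempty (Metric.ball x ε) := ⟨⟨x, Metric.mem_ball_self hε⟩⟩
  have hsup : (⨆ y : Metric.ball x ε, f y) ≤ M := ciSup_le fun y => (abs_le.1 (hf y y.2)).2
  have hinf : (⨅ y : Metric.ball x ε, f y) ≤ M :=
    (ciInf_le ⟨-M, by rintro r ⟨y, rfl⟩; exact (abs_le.1 (hf y y.2)).1⟩
      (⟨x, Metric.mem_ball_self hε⟩ : Metric.ball x ε)).trans
      (abs_le.1 (hf x (Metric.mem_ball_self hε))).2
  have hvol : 0 < volume.real (Metric.ball x ε) :=
    ENNReal.toReal_pos (Metric.measure_ball_pos _ _ hε).ne' measure_ball_lt_top.ne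
  have havg : ⨍ y in Metric.ball x ε, f y ≤ M := by
    rw [setAverage_eq, smul_eq_mul, inv_mul_le_iff₀ hvol]
    have := norm_setIntegral_le_of_norm_le_const (f := f) (C := M)
      (measure_ball_lt_top (μ := volume) (x := x) (r := ε)) (fun y hy => hf y hy)
    rw [mul_comm]
    exact (le_abs_self _).trans this
  have hpn : 0 < p + n := by positivity
  have e : (p - 2) / (p + n) / 2 * (M + M) + (n + 2) / (p + n) * M = M := by field_simp; ring
  unfold gameStep
  have hp2 : 0 ≤ p - 2 := by linarith
  calc _ ≤ (p - 2) / (p + n) / 2 * (M + M) + (n + 2) / (p + n) * M := by gcongr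
    _ = M := e

/-- One step of the game for a function with a quadratic bound from above. -/
theorem gameStep_le_quadratic {p ε M c : ℝ} (hp : 2 ≤ p) (hε : 0 < ε) {f : (𝔼 n) → ℝ} {x : 𝔼 n}
    (hM : ∀ y ∈ Metric.ball x ε, |f y| ≤ M) (hint : IntegrableOn f (Metric.ball x ε)) {G : 𝔼 n}
    {X : (𝔼 n) →L[ℝ] (𝔼 n) →L[ℝ] ℝ}
    (hf : ∀ h, ‖h‖ < ε → f (x + h) ≤ c + inner ℝ G h + 1 / 2 * X h h) :
    ∃ h₁ : 𝔼 n, ‖h₁‖ ≤ ε ∧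
      (∀ h, ‖h‖ ≤ ε → inner ℝ G h + 1 / 2 * X h h ≤ inner ℝ G h₁ + 1 / 2 * X h₁ h₁) ∧
      gameStep p ε f x ≤ c + ε ^ 2 / (2 * (n + p)) *
        ((p - 2) * (X h₁ h₁ / ε ^ 2) + bilinTrace X) := by
  have hcont : Continuous fun h : 𝔼 n => inner ℝ G h + 1 / 2 * X h h := by fun_prop
  obtain ⟨h₁, hh₁, hmax⟩ := (isCompact_closedBall (0 : 𝔼 n) ε).exists_isMaxOn
    ⟨0, Metric.mem_closedBall_self hε.le⟩ hcont.continuousOn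
  rw [mem_closedBall_zero_iff] at hh₁
  have hmax' : ∀ h, ‖h‖ ≤ ε → inner ℝ G h + 1 / 2 * X h h ≤ inner ℝ G h₁ + 1 / 2 * X h₁ h₁ :=
    fun h hh => hmax (mem_closedBall_zero_iff.2 hh)
  refine ⟨h₁, hh₁, hmax', ?_⟩
  have : Nonempty (Metric.ball x ε) := ⟨⟨x, Metric.mem_ball_self hε⟩⟩
  have hfy : ∀ y ∈ Metric.ball x ε,
      f y ≤ c + inner ℝ G (y - x) + 1 / 2 * X (y - x) (y - x) := by
    intro y hy
    have := hf (y - x) (by rwa [← dist_eq_norm])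
    rwa [add_sub_cancel] at this
  have hsup : (⨆ y : Metric.ball x ε, f y) ≤ c + (inner ℝ G h₁ + 1 / 2 * X h₁ h₁) := by
    refine ciSup_le fun y => ?_
    have h1 := hfy y y.2
    have h2 := hmax' (y - x) (by rw [← dist_eq_norm]; exact (Metric.mem_ball.1 y.2).le)
    linarith
  -- The infimum is tested at the antipode of `h₁`, where the linear term changes sign. As `h₁` may
  -- lie on the sphere, the antipode is approached from inside the open ball.
  have hinf : (⨅ y : Metric.ball x ε, f y) ≤ c + (-inner ℝ G h₁ + 1 / 2 * X h₁ h₁) := by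
    have hle : ∀ s ∈ Ioo (0 : ℝ) 1, (⨅ y : Metric.ball x ε, f y) ≤
        c + (-(s * inner ℝ G h₁) + 1 / 2 * (s ^ 2 * X h₁ h₁)) := by
      intro s hs
      have hn : ‖-(s • h₁)‖ < ε := by
        rw [norm_neg, norm_smul, Real.norm_of_nonneg hs.1.le]
        calc s * ‖h₁‖ ≤ s * ε := by gcongr; exact hs.1.le
          _ < 1 * ε := by gcongr; exact hs.2
          _ = ε := one_mul ε
      have hmem : x + -(s • h₁) ∈ Metric.ball x ε := by
        rw [mem_ball_iff_norm, add_sub_cancel_left]; exact hn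
      have h1 := ciInf_le (f := fun y : Metric.ball x ε => f y)
        ⟨-M, by rintro r ⟨y, rfl⟩; exact (abs_le.1 (hM y y.2)).1⟩ ⟨_, hmem⟩
      have h2 := hf _ hn
      simp only [inner_neg_right, inner_smul_right, map_neg, map_smul, _root_.neg_apply,
        _root_.smul_apply, smul_eq_mul] at h2
      refine h1.trans (h2.trans (le_of_eq ?_))
      ring
    have ht : Tendsto (fun s : ℝ => c + (-(s * inner ℝ G h₁) + 1 / 2 * (s ^ 2 * X h₁ h₁))) (𝓝[<] 1)
        (𝓝 (c + (-(1 * inner ℝ G h₁) + 1 / 2 * (1 ^ 2 * X h₁ h₁)))) :=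
      (Continuous.tendsto (by fun_prop) 1).mono_left nhdsWithin_le_nhds
    have := ge_of_tendsto ht (by
      filter_upwards [Ioo_mem_nhdsLT (zero_lt_one' ℝ)] with s hs using hle s hs)
    simpa using this
  have havg : ⨍ y in Metric.ball x ε, f y ≤ c + ε ^ 2 / (2 * (n + 2)) * bilinTrace X := by
    rw [← setAverage_ball_quadratic c (innerSL ℝ G) X x hε, setAverage_eq, setAverage_eq,
      smul_eq_mul, smul_eq_mul]
    refine mul_le_mul_of_nonneg_left ?_ (by positivity)
    refine setIntegral_mono_on hint (integrableOn_ball_of_continuous (by fun_prop) _ _)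
      measurableSet_ball fun y hy => ?_
    simpa using hfy y hy
  have hpn : 0 < p + n := by positivity
  have hp2 : 0 ≤ p - 2 := by linarith
  have hnp : (n : ℝ) + p ≠ 0 := by positivity
  unfold gameStep
  -- The weights sum to one and turn the two second-order contributions into the common factor `ε ^
  -- 2 / (2 * (n + p))`.
  calc _ ≤ (p - 2) / (p + n) / 2 * ((c + (inner ℝ G h₁ + 1 / 2 * X h₁ h₁)) +
        (c + (-inner ℝ G h₁ + 1 / 2 * X h₁ h₁))) +
        (n + 2) / (p + n) * (c + ε ^ 2 / (2 * (n + 2)) * bilinTrace X) := by gcongr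
    _ = _ := by
      rw [add_comm p (n : ℝ)]
      have : (n : ℝ) + 2 ≠ 0 := by positivity
      field_simp
      ring

/-- The maximizer of a quadratic function over a small ball points in the gradient direction. -/
theorem bilin_maximizer_le {ε : ℝ} (hε : 0 < ε) {G h₁ : 𝔼 n} {X : (𝔼 n) →L[ℝ] (𝔼 n) →L[ℝ] ℝ}
    (hG : G ≠ 0) (hh₁ : ‖h₁‖ ≤ ε)
    (hmax : ∀ h, ‖h‖ ≤ ε → inner ℝ G h + 1 / 2 * X h h ≤ inner ℝ G h₁ + 1 / 2 * X h₁ h₁) :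
    X h₁ h₁ / ε ^ 2 ≤ X G G / ‖G‖ ^ 2 + 2 * ‖X‖ * √(2 * ‖X‖ * ε / ‖G‖) := by
  have hG' : 0 < ‖G‖ := norm_pos_iff.2 hG
  -- Comparison with the maximizer of the linear part alone: the quadratic part is of order `ε ^ 2`,
  -- so `h₁` differs from `e` by `O(ε ^ (3 / 2))`.
  set e : 𝔼 n := (ε / ‖G‖) • G with he
  have hen : ‖e‖ = ε := by
    rw [he, norm_smul, Real.norm_of_nonneg (by positivity)]; field_simp
  have hb : ∀ x y, |X x y| ≤ ‖X‖ * ‖x‖ * ‖y‖ := fun x y => X.le_opNorm₂ x y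
  have hinner : inner ℝ G e = ε * ‖G‖ := by
    rw [he, inner_smul_right, real_inner_self_eq_norm_sq]; field_simp
  have h1 := hmax e hen.le
  have h2 : ε * ‖G‖ - ‖X‖ * ε ^ 2 ≤ inner ℝ G h₁ := by
    have b1 := (abs_le.1 (hb e e)).1
    have b2 := (abs_le.1 (hb h₁ h₁)).2
    have b3 : ‖X‖ * ‖h₁‖ * ‖h₁‖ ≤ ‖X‖ * ε * ε := by gcongr
    rw [hen] at b1
    rw [hinner] at h1
    linarith [sq ε, mul_assoc ‖X‖ ε ε]
  have h3 : ‖h₁ - e‖ ^ 2 ≤ ε ^ 2 * (2 * ‖X‖ * ε / ‖G‖) := by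
    rw [norm_sub_sq_real, hen]
    have e1 : inner ℝ h₁ e = ε / ‖G‖ * inner ℝ G h₁ := by
      rw [he, inner_smul_right, real_inner_comm]
    have e2 : ‖h₁‖ ^ 2 ≤ ε ^ 2 := by gcongr
    have e3 := mul_le_mul_of_nonneg_left h2 (by positivity : 0 ≤ ε / ‖G‖)
    have e4 : ε / ‖G‖ * (ε * ‖G‖ - ‖X‖ * ε ^ 2) = ε ^ 2 - ‖X‖ * ε ^ 3 / ‖G‖ := by field_simp
    have e5 : ε ^ 2 * (2 * ‖X‖ * ε / ‖G‖) = 2 * (‖X‖ * ε ^ 3 / ‖G‖) := by ring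
    rw [e1, e5]
    linarith
  have h4 : ‖h₁ - e‖ ≤ ε * √(2 * ‖X‖ * ε / ‖G‖) := by
    have := Real.sqrt_le_sqrt h3
    rwa [Real.sqrt_sq (norm_nonneg _), Real.sqrt_mul (by positivity), Real.sqrt_sq hε.le] at this
  have h5 : X h₁ h₁ ≤ X e e + 2 * ‖X‖ * ε * ‖h₁ - e‖ := by
    have e1 : X h₁ h₁ = X e e + X (h₁ - e) h₁ + X e (h₁ - e) := by
      simp only [map_sub, _root_.sub_apply]; ring
    have b1 := (abs_le.1 (hb (h₁ - e) h₁)).2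
    have b2 := (abs_le.1 (hb e (h₁ - e))).2
    have b3 : ‖X‖ * ‖h₁ - e‖ * ‖h₁‖ ≤ ‖X‖ * ‖h₁ - e‖ * ε := by gcongr
    rw [hen] at b2
    rw [e1]
    linarith
  have h6 : X e e = ε ^ 2 * (X G G / ‖G‖ ^ 2) := by
    simp only [he, map_smul, _root_.smul_apply, smul_eq_mul]
    field_simp
  rw [div_le_iff₀ (by positivity)]
  have h7 : 2 * ‖X‖ * ε * ‖h₁ - e‖ ≤ 2 * ‖X‖ * ε * (ε * √(2 * ‖X‖ * ε / ‖G‖)) := by gcongr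
  rw [h6] at h5
  linarith

end TugOfWar

end

noncomputable section

namespace TugOfWar

variable {n : ℕ}

local notation "𝔼" n => EuclideanSpace ℝ (Fin n)

/-! ### Half-relaxed limits -/

section RelaxedLimit

variable {Y : Type*} [TopologicalSpace Y]

/-- The upper half-relaxed limit as `ε → 0⁺` of functions `f ε` defined on sets `D ε`. -/
def upperLimit (D : ℝ → Set Y) (f : ℝ → Y → ℝ) (z : Y) : ℝ :=
  sInf {c | ∀ᶠ q in 𝓝[>] (0 : ℝ) ×ˢ 𝓝 z, q.2 ∈ D q.1 → f q.1 q.2 ≤ c}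

variable {D : ℝ → Set Y} {f : ℝ → Y → ℝ} {M : ℝ} {z : Y}

theorem eventually_abs_le (hM : ∀ᶠ ε in 𝓝[>] (0 : ℝ), ∀ w ∈ D ε, |f ε w| ≤ M) (z : Y) :
    ∀ᶠ q in 𝓝[>] (0 : ℝ) ×ˢ 𝓝 z, q.2 ∈ D q.1 → |f q.1 q.2| ≤ M := by
  filter_upwards [hM.prod_inl (𝓝 z)] with q hq hqD
  exact hq _ hqD

theorem eventually_lt_of_upperLimit_lt (hM : ∀ᶠ ε in 𝓝[>] (0 : ℝ), ∀ w ∈ D ε, |f ε w| ≤ M)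
    {c : ℝ} (hc : upperLimit D f z < c) :
    ∀ᶠ q in 𝓝[>] (0 : ℝ) ×ˢ 𝓝 z, q.2 ∈ D q.1 → f q.1 q.2 < c := by
  have hne : {c | ∀ᶠ q in 𝓝[>] (0 : ℝ) ×ˢ 𝓝 z, q.2 ∈ D q.1 → f q.1 q.2 ≤ c}.Nonempty :=
    ⟨M, (eventually_abs_le hM z).mono fun q hq hqD => (abs_le.1 (hq hqD)).2⟩
  obtain ⟨c', hc', hlt⟩ := exists_lt_of_csInf_lt hne hc
  rw [mem_ofPred_eq] at hc'
  exact hc'.mono fun q hq hqD => (hq hqD).trans_lt hlt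

/-- The frequency hypothesis bounds the defining set from below, so its `sInf` is not a default
value. -/
theorem upperLimit_le_of_eventually (hM : ∀ᶠ ε in 𝓝[>] (0 : ℝ), ∀ w ∈ D ε, |f ε w| ≤ M)
    (hz : ∃ᶠ q in 𝓝[>] (0 : ℝ) ×ˢ 𝓝 z, q.2 ∈ D q.1) {c : ℝ}
    (hc : ∀ᶠ q in 𝓝[>] (0 : ℝ) ×ˢ 𝓝 z, q.2 ∈ D q.1 → f q.1 q.2 ≤ c) : upperLimit D f z ≤ c := by
  refine csInf_le ⟨-M, fun c' hc' => ?_⟩ hc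
  rw [mem_ofPred_eq] at hc'
  obtain ⟨q, hqD, hq1, hq2⟩ := (hz.and_eventually (hc'.and (eventually_abs_le hM z))).exists
  exact (abs_le.1 (hq2 hqD)).1.trans (hq1 hqD)

theorem frequently_lt_of_lt_upperLimit (hM : ∀ᶠ ε in 𝓝[>] (0 : ℝ), ∀ w ∈ D ε, |f ε w| ≤ M)
    (hz : ∃ᶠ q in 𝓝[>] (0 : ℝ) ×ˢ 𝓝 z, q.2 ∈ D q.1) {c : ℝ} (hc : c < upperLimit D f z) :
    ∃ᶠ q in 𝓝[>] (0 : ℝ) ×ˢ 𝓝 z, q.2 ∈ D q.1 ∧ c < f q.1 q.2 := by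
  intro hcon
  refine absurd (upperLimit_le_of_eventually hM hz ?_) (not_le.2 hc)
  filter_upwards [hcon] with q hq hqD
  by_contra! hlt
  exact hq ⟨hqD, hlt⟩

theorem abs_upperLimit_le (hM : ∀ᶠ ε in 𝓝[>] (0 : ℝ), ∀ w ∈ D ε, |f ε w| ≤ M)
    (hz : ∃ᶠ q in 𝓝[>] (0 : ℝ) ×ˢ 𝓝 z, q.2 ∈ D q.1) : |upperLimit D f z| ≤ M := by
  rw [abs_le]
  constructor
  · by_contra! hlt
    obtain ⟨q, hqD, hq1, hq2⟩ := (hz.and_eventually ((eventually_lt_of_upperLimit_lt hM hlt).and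
      (eventually_abs_le hM z))).exists
    exact absurd (hq1 hqD) (not_lt.2 (abs_le.1 (hq2 hqD)).1)
  · exact upperLimit_le_of_eventually hM hz
      ((eventually_abs_le hM z).mono fun q hq hqD => (abs_le.1 (hq hqD)).2)

theorem upperSemicontinuousOn_upperLimit (hM : ∀ᶠ ε in 𝓝[>] (0 : ℝ), ∀ w ∈ D ε, |f ε w| ≤ M)
    {K : Set Y} (hK : ∀ z ∈ K, ∃ᶠ q in 𝓝[>] (0 : ℝ) ×ˢ 𝓝 z, q.2 ∈ D q.1) :
    UpperSemicontinuousOn (upperLimit D f) K := by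
  intro z hz c hc
  obtain ⟨c', hc1, hc2⟩ := exists_between hc
  obtain ⟨P, hP, Q, hQ, hPQ⟩ := eventually_prod_iff.1 (eventually_lt_of_upperLimit_lt hM hc1)
  filter_upwards [self_mem_nhdsWithin, mem_nhdsWithin_of_mem_nhds (eventually_nhds_iff.2
    (eventually_nhds_iff.1 hQ.eventually_nhds))] with w hwK hw
  refine lt_of_le_of_lt (upperLimit_le_of_eventually hM (hK w hwK) ?_) hc2
  exact (hP.prod_mk hw).mono fun q hq hqD => (hPQ hq.1 hq.2 hqD).le

/-- Uniform version on compact sets of a property that holds locally near each point. -/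
theorem eventually_forall_of_compact {ι : Type*} {l : Filter ι} {K : Set Y} (hK : IsCompact K)
    {P : ι → Y → Prop} (hP : ∀ y ∈ K, ∀ᶠ q in l ×ˢ 𝓝 y, P q.1 q.2) :
    ∀ᶠ i in l, ∀ y ∈ K, P i y := by
  refine hK.induction_on (p := fun s => ∀ᶠ i in l, ∀ y ∈ s, P i y) (by simp)
    (fun s t hst ht => ht.mono fun i hi y hy => hi y (hst hy))
    (fun s t hs ht => (hs.and ht).mono fun i hi y hy => hy.elim (hi.1 y) (hi.2 y)) fun y hy => ?_
  obtain ⟨A, hA, B, hB, hAB⟩ := eventually_prod_iff.1 (hP y hy)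
  exact ⟨{y | B y}, mem_nhdsWithin_of_mem_nhds hB, hA.mono fun i hi y' hy' => hAB hi hy'⟩

end RelaxedLimit

/-! ### The domain of the game -/

/-- The domain of the value function of the game with step `ε`. -/
def gameDomain (Ω : Set (𝔼 n)) (T ε : ℝ) : Set (SpaceTime n) :=
  cylinder Ω T ∪ parabolicStrip Ω T ε

theorem outerStrip_mono (Ω : Set (𝔼 n)) {ε ε' : ℝ} (h : ε ≤ ε') :
    outerStrip Ω ε ⊆ outerStrip Ω ε' := fun _ hx => ⟨hx.1, hx.2.trans h⟩

theorem parabolicStrip_mono (Ω : Set (𝔼 n)) (T : ℝ) {ε ε' : ℝ} (h0 : 0 ≤ ε) (h : ε ≤ ε') :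
    parabolicStrip Ω T ε ⊆ parabolicStrip Ω T ε' := by
  have hsq : -(ε' ^ 2 / 2) ≤ -(ε ^ 2 / 2) := by
    have : ε ^ 2 ≤ ε' ^ 2 := by gcongr
    linarith
  rintro z (⟨h1, h2⟩ | ⟨h1, h2⟩)
  · exact Or.inl ⟨outerStrip_mono Ω h h1, hsq.trans_lt h2.1, h2.2⟩
  · exact Or.inr ⟨h1, hsq.trans_lt h2.1, h2.2⟩

theorem frontier_subset_outerStrip {Ω : Set (𝔼 n)} (hΩ : IsOpen Ω) {ε : ℝ} (hε : 0 ≤ ε) :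
    frontier Ω ⊆ outerStrip Ω ε := by
  intro x hx
  refine ⟨fun h => ?_, ?_⟩
  · rw [hΩ.frontier_eq] at hx
    exact hx.2 h
  · rw [Metric.infDist_zero_of_mem hx]; exact hε

theorem parabolicBoundary_subset_strip {Ω : Set (𝔼 n)} (hΩ : IsOpen Ω) (T : ℝ) {ε : ℝ}
    (hε : 0 < ε) : parabolicBoundary Ω T ⊆ parabolicStrip Ω T ε := by
  have : -(ε ^ 2 / 2) < 0 := by
    have : 0 < ε ^ 2 / 2 := by positivity
    linarith
  rintro z (⟨h1, h2⟩ | ⟨h1, h2⟩)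
  · exact Or.inl ⟨frontier_subset_outerStrip hΩ hε.le h1, this.trans_le h2.1, h2.2⟩
  · rw [mem_singleton_iff] at h2
    exact Or.inr ⟨h1, by rw [h2]; exact this, h2.le⟩

/-- Otherwise interior and exterior would disconnect the segment. It places positions that leave `Ω`
in one step within distance `ε` of the frontier. -/
theorem exists_mem_segment_frontier {Ω : Set (𝔼 n)} {x y : 𝔼 n} (hx : x ∈ Ω) (hy : y ∉ Ω) :
    ∃ w ∈ segment ℝ x y, w ∈ frontier Ω := by
  by_contra! h
  obtain ⟨w, -, hw1, hw2⟩ := (convex_segment x y).isPreconnected (interior Ω) (closure Ω)ᶜ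
    isOpen_interior isClosed_closure.isOpen_compl
    (fun w hw => by
      by_cases hc : w ∈ closure Ω
      · exact Or.inl (by_contra fun hi => h w hw ⟨hc, hi⟩)
      · exact Or.inr hc)
    ⟨x, left_mem_segment ℝ _ _,
      by_contra fun hi => h x (left_mem_segment ℝ _ _) ⟨subset_closure hx, hi⟩⟩
    ⟨y, right_mem_segment ℝ _ _,
      fun hc => h y (right_mem_segment ℝ _ _) ⟨hc, fun hi => hy (interior_subset hi)⟩⟩
  exact hw2 (interior_subset_closure hw1)

/-- A position that is reachable in one step of the game lies in its domain. -/
theorem step_mem_gameDomain {Ω : Set (𝔼 n)} {T ε : ℝ} (hε : 0 < ε) {z : SpaceTime n}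
    (hz : z ∈ cylinder Ω T) {y : 𝔼 n} (hy : y ∈ Metric.ball z.1 ε) :
    (y, z.2 - ε ^ 2 / 2) ∈ gameDomain Ω T ε := by
  have hsq : 0 < ε ^ 2 / 2 := by positivity
  obtain ⟨hx, ht0, htT⟩ := hz
  by_cases hyΩ : y ∈ Ω
  · rcases le_or_gt (z.2 - ε ^ 2 / 2) 0 with h | h
    · refine Or.inr (Or.inr ⟨hyΩ, ?_, h⟩)
      change -(ε ^ 2 / 2) < z.2 - ε ^ 2 / 2
      linarith
    · refine Or.inl ⟨hyΩ, h, ?_⟩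
      change z.2 - ε ^ 2 / 2 < T
      linarith
  · refine Or.inr (Or.inl ⟨⟨hyΩ, ?_⟩, ?_, ?_⟩)
    · obtain ⟨w, hw1, hw2⟩ := exists_mem_segment_frontier hx hyΩ
      refine (Metric.infDist_le_dist_of_mem hw2).trans ?_
      have h1 := dist_add_dist_of_mem_segment hw1
      rw [dist_comm]
      have h2 := Metric.mem_ball'.1 hy
      linarith [dist_nonneg (x := z.1) (y := w)]
    · change -(ε ^ 2 / 2) < z.2 - ε ^ 2 / 2
      linarith
    · change z.2 - ε ^ 2 / 2 ≤ T
      linarith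

theorem frontier_nonempty_of_bounded {Ω : Set (𝔼 n)} (hn : 0 < n) (hne : Ω.Nonempty)
    (hb : Bornology.IsBounded Ω) : (frontier Ω).Nonempty := by
  have : Nonempty (Fin n) := ⟨⟨0, hn⟩⟩
  rw [nonempty_iff_ne_empty, Ne, ← isClopen_iff_frontier_eq_empty, isClopen_iff]
  rintro (h | h)
  · exact hne.ne_empty h
  · rw [h] at hb
    exact NormedSpace.unbounded_univ ℝ (𝔼 n) hb

theorem closure_cylinder (Ω : Set (𝔼 n)) {T : ℝ} (hT : 0 < T) :
    closure (cylinder Ω T) = closure Ω ×ˢ Icc 0 T := by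
  rw [cylinder, closure_prod_eq, closure_Ioo hT.ne]

theorem isClosed_parabolicBoundary {Ω : Set (𝔼 n)} {T : ℝ} (hT : 0 < T) :
    IsClosed (parabolicBoundary Ω T) := by
  -- The bottom may be closed up, since its rim already belongs to the lateral part.
  have : parabolicBoundary Ω T = frontier Ω ×ˢ Icc 0 T ∪ closure Ω ×ˢ {0} := by
    refine Subset.antisymm (union_subset_union_right _ (prod_mono subset_closure le_rfl)) ?_
    rintro z (h | ⟨h1, h2⟩)
    · exact Or.inl h
    · by_cases hz : z.1 ∈ Ω
      · exact Or.inr ⟨hz, h2⟩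
      · refine Or.inl ⟨⟨h1, fun h => hz (interior_subset h)⟩, ?_⟩
        rw [mem_singleton_iff.1 h2]
        exact ⟨le_rfl, hT.le⟩
  rw [this]
  exact (isClosed_frontier.prod isClosed_Icc).union (isClosed_closure.prod isClosed_singleton)

theorem parabolicBoundary_subset_closure {Ω : Set (𝔼 n)} {T : ℝ} (hT : 0 < T) :
    parabolicBoundary Ω T ⊆ closure (cylinder Ω T) := by
  rw [closure_cylinder Ω hT]
  rintro z (⟨h1, h2⟩ | ⟨h1, h2⟩)
  · exact ⟨frontier_subset_closure h1, h2⟩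
  · rw [mem_singleton_iff] at h2
    exact ⟨subset_closure h1, by rw [h2]; exact ⟨le_rfl, hT.le⟩⟩

theorem mem_of_closure_of_notMem_boundary {Ω : Set (𝔼 n)} {T : ℝ} (hΩ : IsOpen Ω) (hT : 0 < T)
    {z : SpaceTime n} (hz : z ∈ closure (cylinder Ω T)) (hzΓ : z ∉ parabolicBoundary Ω T) :
    z.1 ∈ Ω ∧ 0 < z.2 := by
  rw [closure_cylinder Ω hT] at hz
  have h1 : z.1 ∈ Ω := by
    by_contra h
    refine hzΓ (Or.inl ⟨?_, hz.2⟩)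
    rw [hΩ.frontier_eq]
    exact ⟨hz.1, h⟩
  refine ⟨h1, lt_of_le_of_ne hz.2.1 fun h => hzΓ (Or.inr ⟨h1, h.symm⟩)⟩

theorem frequently_mem_gameDomain {Ω : Set (𝔼 n)} {T : ℝ} {z : SpaceTime n}
    (hz : z ∈ closure (cylinder Ω T)) :
    ∃ᶠ q in 𝓝[>] (0 : ℝ) ×ˢ 𝓝 z, q.2 ∈ gameDomain Ω T q.1 := by
  intro hcon
  obtain ⟨P, hP, Q, hQ, hPQ⟩ := eventually_prod_iff.1 hcon
  obtain ⟨ε, hε⟩ := hP.exists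
  obtain ⟨w, hw, hwc⟩ := ((mem_closure_iff_frequently.1 hz).and_eventually hQ).exists
  exact hPQ hε hwc (Or.inl hw)

/-- The boundary strips have no width left in the limit. Nonemptiness of the frontier matters
because `infDist` to the empty set is zero by default. -/
theorem eventually_notMem_gameDomain {Ω : Set (𝔼 n)} {T : ℝ} (hT : 0 < T)
    (hfr : (frontier Ω).Nonempty) {z : SpaceTime n} (hz : z ∉ closure (cylinder Ω T)) :
    ∀ᶠ q in 𝓝[>] (0 : ℝ) ×ˢ 𝓝 z, q.2 ∉ gameDomain Ω T q.1 := by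
  have tε : Tendsto (fun q : ℝ × SpaceTime n => q.1) (𝓝[>] (0 : ℝ) ×ˢ 𝓝 z) (𝓝 0) :=
    tendsto_fst.mono_right nhdsWithin_le_nhds
  have tz : Tendsto (fun q : ℝ × SpaceTime n => q.2) (𝓝[>] (0 : ℝ) ×ˢ 𝓝 z) (𝓝 z) := tendsto_snd
  have tx := (continuous_fst.tendsto z).comp tz
  have tt := (continuous_snd.tendsto z).comp tz
  rw [closure_cylinder Ω hT] at hz
  by_cases hx : z.1 ∈ closure Ω
  · have ht : z.2 < 0 ∨ T < z.2 := by
      by_contra! h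
      exact hz ⟨hx, h.1, h.2⟩
    rcases ht with ht | ht
    · have t1 : Tendsto (fun q : ℝ × SpaceTime n => q.2.2 + q.1 ^ 2 / 2)
          (𝓝[>] (0 : ℝ) ×ˢ 𝓝 z) (𝓝 (z.2 + 0 ^ 2 / 2)) := tt.add ((tε.pow 2).div_const 2)
      filter_upwards [t1.eventually (gt_mem_nhds (by simpa using ht)),
        tt.eventually (gt_mem_nhds ht)] with q hq hq0
      have hq0 : q.2.2 < 0 := hq0
      rintro (⟨-, h⟩ | ⟨-, h⟩ | ⟨-, h⟩)
      · exact absurd h.1 (not_lt.2 hq0.le)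
      · linarith [h.1]
      · linarith [h.1]
    · filter_upwards [tt.eventually (lt_mem_nhds ht)] with q hq
      have hq : T < q.2.2 := hq
      rintro (⟨-, h⟩ | ⟨-, h⟩ | ⟨-, h⟩)
      · linarith [h.2]
      · linarith [h.2]
      · linarith [h.2]
  · have hpos : 0 < Metric.infDist z.1 (frontier Ω) :=
      (isClosed_frontier.notMem_iff_infDist_pos hfr).1 fun h => hx (frontier_subset_closure h)
    have t1 : Tendsto (fun q : ℝ × SpaceTime n => Metric.infDist q.2.1 (frontier Ω) - q.1)
        (𝓝[>] (0 : ℝ) ×ˢ 𝓝 z) (𝓝 (Metric.infDist z.1 (frontier Ω) - 0)) :=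
      (((Metric.continuous_infDist_pt _).tendsto z.1).comp tx).sub tε
    have t2 := tx.eventually (isClosed_closure.isOpen_compl.mem_nhds hx : (closure Ω)ᶜ ∈ 𝓝 z.1)
    filter_upwards [t1.eventually (lt_mem_nhds (by simpa using hpos)), t2] with q hq1 hq2
    have hq2 : q.2.1 ∉ Ω := fun h => hq2 (subset_closure h)
    rintro (⟨h, -⟩ | ⟨h, -⟩ | ⟨h, -⟩)
    · exact hq2 h
    · linarith [h.2]
    · exact hq2 h

end TugOfWar

end

noncomputable section

namespace TugOfWar

variable {n : ℕ}

local notation "𝔼" n => EuclideanSpace ℝ (Fin n)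

/-! ### Subsolutions of the dynamic programming principle -/

/-- A uniformly bounded family of subsolutions of the dynamic programming principle with obstacle
`ψ` and boundary values `F`. -/
structure IsGameSubsolution (Ω : Set (𝔼 n)) (T p ε₀ M : ℝ) (F ψ : SpaceTime n → ℝ)
    (f : ℝ → SpaceTime n → ℝ) : Prop where
  borel : ∀ ε, 0 < ε → ε ≤ ε₀ → Measurable fun z : ↥(gameDomain Ω T ε) => f ε z
  bounded : ∀ ε, 0 < ε → ε ≤ ε₀ → ∀ z ∈ gameDomain Ω T ε, |f ε z| ≤ M
  interior : ∀ ε, 0 < ε → ε ≤ ε₀ → ∀ z ∈ cylinder Ω T,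
    f ε z ≤ ψ z ∨ f ε z ≤ gameStep p ε (fun y => f ε (y, z.2 - ε ^ 2 / 2)) z.1
  boundary : ∀ ε, 0 < ε → ε ≤ ε₀ → ∀ z ∈ parabolicStrip Ω T ε, f ε z = F z

theorem integrableOn_slice {Ω : Set (𝔼 n)} {T ε M : ℝ} (hε : 0 < ε) {f : SpaceTime n → ℝ}
    (hf : Measurable fun z : ↥(gameDomain Ω T ε) => f z)
    (hM : ∀ z ∈ gameDomain Ω T ε, |f z| ≤ M) {z : SpaceTime n} (hz : z ∈ cylinder Ω T) :
    IntegrableOn (fun y => f (y, z.2 - ε ^ 2 / 2)) (Metric.ball z.1 ε) := by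
  have hmeas : Measurable fun y : Metric.ball z.1 ε => f (y, z.2 - ε ^ 2 / 2) := by
    have hg : Measurable fun y : Metric.ball z.1 ε =>
        (⟨(y, z.2 - ε ^ 2 / 2), step_mem_gameDomain hε hz y.2⟩ : ↥(gameDomain Ω T ε)) :=
      Measurable.subtype_mk (by fun_prop)
    exact hf.comp hg
  have hae : AEMeasurable (fun y => f (y, z.2 - ε ^ 2 / 2))
      (volume.restrict (Metric.ball z.1 ε)) :=
    aemeasurable_restrict_of_measurable_subtype measurableSet_ball hmeas
  refine IntegrableOn.of_bound measure_ball_lt_top hae.aestronglyMeasurable M ?_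
  exact (ae_restrict_iff' measurableSet_ball).2
    (Eventually.of_forall fun y hy => hM _ (step_mem_gameDomain hε hz hy))

/-- The perturbed test function of a jet. -/
def jetTest (z : SpaceTime n) (κ a : ℝ) (g : 𝔼 n) (X : (𝔼 n) →L[ℝ] (𝔼 n) →L[ℝ] ℝ) (η : ℝ)
    (w : SpaceTime n) : ℝ :=
  a * (w.2 - z.2) + κ * |w.2 - z.2| + inner ℝ g (w.1 - z.1) +
    1 / 2 * X (w.1 - z.1) (w.1 - z.1) + η * (‖w.1 - z.1‖ ^ 2 + |w.2 - z.2|)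

theorem continuous_jetTest (z : SpaceTime n) (κ a : ℝ) (g : 𝔼 n)
    (X : (𝔼 n) →L[ℝ] (𝔼 n) →L[ℝ] ℝ) (η : ℝ) : Continuous (jetTest z κ a g X η) := by
  unfold jetTest
  fun_prop

theorem jetTest_self (z : SpaceTime n) (κ a : ℝ) (g : 𝔼 n)
    (X : (𝔼 n) →L[ℝ] (𝔼 n) →L[ℝ] ℝ) (η : ℝ) : jetTest z κ a g X η z = 0 := by
  simp [jetTest]

section Limit

variable {Ω : Set (𝔼 n)} {T p ε₀ M : ℝ} {F ψ : SpaceTime n → ℝ} {f : ℝ → SpaceTime n → ℝ}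

theorem eventually_Ioc_zero (hε₀ : 0 < ε₀) : ∀ᶠ ε in 𝓝[>] (0 : ℝ), 0 < ε ∧ ε ≤ ε₀ :=
  Ioc_mem_nhdsGT hε₀

theorem IsGameSubsolution.eventually_bounded (hf : IsGameSubsolution Ω T p ε₀ M F ψ f)
    (hε₀ : 0 < ε₀) : ∀ᶠ ε in 𝓝[>] (0 : ℝ), ∀ w ∈ gameDomain Ω T ε, |f ε w| ≤ M :=
  (eventually_Ioc_zero hε₀).mono fun ε hε => hf.bounded ε hε.1 hε.2

/-- Near a point at which a superjet exists and the obstacle and boundary alternatives fail, the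
functions `f ε` have approximate contact points with the perturbed test function. -/
theorem IsGameSubsolution.exists_contact (hf : IsGameSubsolution Ω T p ε₀ M F ψ f)
    (hΩ : IsOpen Ω) (hT : 0 < T) (hfr : (frontier Ω).Nonempty) (hε₀ : 0 < ε₀)
    (hψ : Continuous ψ) (hF : ContinuousOn F (parabolicStrip Ω T ε₀)) {z : SpaceTime n}
    (hz : z ∈ closure (cylinder Ω T)) {κ a : ℝ} {g : 𝔼 n} {X : (𝔼 n) →L[ℝ] (𝔼 n) →L[ℝ] ℝ}
    (hjet : HasSuperjet (upperLimit (gameDomain Ω T) f) (closure (cylinder Ω T)) z κ a g X)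
    (hzψ : ψ z < upperLimit (gameDomain Ω T) f z)
    (hzF : z ∈ parabolicBoundary Ω T → F z < upperLimit (gameDomain Ω T) f z)
    {η : ℝ} (hη : 0 < η) {r₀ : ℝ} (hr₀ : 0 < r₀) :
    ∃ ε, 0 < ε ∧ ε < r₀ ∧ ε ≤ ε₀ ∧ ∃ w ∈ cylinder Ω T, dist w z < r₀ ∧
      f ε w ≤ gameStep p ε (fun y => f ε (y, w.2 - ε ^ 2 / 2)) w.1 ∧
      ∀ y ∈ Metric.ball w.1 ε, f ε (y, w.2 - ε ^ 2 / 2) ≤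
        f ε w - jetTest z κ a g X (2 * η) w + jetTest z κ a g X (2 * η) (y, w.2 - ε ^ 2 / 2) +
          ε ^ 3 := by
  set K := closure (cylinder Ω T) with hK
  set u := upperLimit (gameDomain Ω T) f with hu
  set Φ := jetTest z κ a g X (2 * η) with hΦ
  have hΦc : Continuous Φ := continuous_jetTest _ _ _ _ _ _
  have hΦ0 : Φ z = 0 := jetTest_self _ _ _ _ _ _
  have hM := hf.eventually_bounded hε₀
  let N : SpaceTime n → ℝ := fun w => ‖w.1 - z.1‖ ^ 2 + |w.2 - z.2|
  -- The test function carries `2 * η` while the jet holds with `η`; the margin `η * N` makes the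
  -- maximum at `z` strict.
  obtain ⟨r, hr, hrK⟩ : ∃ r > 0, ∀ w ∈ K, dist w z ≤ r → u w ≤ u z + Φ w - η * N w := by
    have := hjet η hη
    rw [eventually_nhdsWithin_iff] at this
    obtain ⟨r, hr, h⟩ := Metric.eventually_nhds_iff.1 this
    refine ⟨r / 2, by positivity, fun w hwK hw => ?_⟩
    have h1 := h (lt_of_le_of_lt hw (by linarith)) hwK
    simp only [hΦ, jetTest, N]
    linarith
  have tz : Tendsto (fun q : ℝ × SpaceTime n => q.2) (𝓝[>] (0 : ℝ) ×ˢ 𝓝 z) (𝓝 z) := tendsto_snd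
  -- A gap of size `3 * θ` above the obstacle and, near `z`, above the boundary payoff will exclude
  -- both alternatives at the contact point.
  obtain ⟨θ, hθ, hθψ, hθF⟩ : ∃ θ > 0, ψ z < u z - 3 * θ ∧
      ∀ᶠ q in 𝓝[>] (0 : ℝ) ×ˢ 𝓝 z, q.2 ∈ parabolicStrip Ω T q.1 → F q.2 < u z - 3 * θ := by
    by_cases hzΓ : z ∈ parabolicBoundary Ω T
    · have h1 := hzF hzΓ
      set θ := min (u z - ψ z) (u z - F z) / 4 with hθ
      have hθ0 : 0 < θ := by
        have : 0 < min (u z - ψ z) (u z - F z) := lt_min (by linarith) (by linarith)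
        positivity
      have e1 : 4 * θ ≤ u z - ψ z := by
        have := min_le_left (u z - ψ z) (u z - F z); linarith
      have e2 : 4 * θ ≤ u z - F z := by
        have := min_le_right (u z - ψ z) (u z - F z); linarith
      refine ⟨θ, hθ0, by linarith, ?_⟩
      have hFz := (hF z (parabolicBoundary_subset_strip hΩ T hε₀ hzΓ)).eventually
        (gt_mem_nhds (show F z < u z - 3 * θ by linarith))
      rw [eventually_nhdsWithin_iff] at hFz
      filter_upwards [tz.eventually hFz, (eventually_Ioc_zero hε₀).prod_inl (𝓝 z)] with q hq hε hqs
      exact hq (parabolicStrip_mono Ω T hε.1.le hε.2 hqs)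
    · obtain ⟨hzΩ, hzt⟩ := mem_of_closure_of_notMem_boundary hΩ hT hz hzΓ
      refine ⟨(u z - ψ z) / 4, by linarith, by linarith, ?_⟩
      have h1 : ∀ᶠ w : SpaceTime n in 𝓝 z, w.1 ∈ Ω ∧ 0 < w.2 :=
        ((continuous_fst.tendsto z).eventually (hΩ.mem_nhds hzΩ)).and
          ((continuous_snd.tendsto z).eventually (lt_mem_nhds hzt))
      filter_upwards [tz.eventually h1] with q hq
      rintro (⟨h, -⟩ | ⟨-, h⟩)
      · exact absurd hq.1 h.1
      · exact absurd hq.2 (not_lt.2 h.2)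
  obtain ⟨P, hP, Q, hQ, hPQ⟩ := eventually_prod_iff.1 hθF
  have hnear : ∀ᶠ w in 𝓝 z, Q w ∧ ψ w < u z - 3 * θ ∧ |Φ w| < θ := by
    refine hQ.and (((hψ.tendsto z).eventually (gt_mem_nhds hθψ)).and ?_)
    have := (hΦc.tendsto z).abs
    rw [hΦ0, abs_zero] at this
    exact this.eventually (gt_mem_nhds hθ)
  obtain ⟨ρ', hρ', hball⟩ := Metric.eventually_nhds_iff.1 hnear
  set ρ := min ρ' (min (r / 2) r₀) with hρdef
  have hρ : 0 < ρ := by positivity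
  have hρr : ρ ≤ r / 2 := (min_le_right _ _).trans (min_le_left _ _)
  have hρr₀ : ρ ≤ r₀ := (min_le_right _ _).trans (min_le_right _ _)
  obtain ⟨m, hm, hmθ, hmN⟩ : ∃ m > 0, m ≤ θ ∧ ∀ w, ρ ≤ dist w z → 3 * m ≤ η * N w := by
    refine ⟨min θ (η * min (ρ ^ 2) ρ / 3), by positivity, min_le_left _ _, fun w hw => ?_⟩
    have h1 : min (ρ ^ 2) ρ ≤ N w := by
      rw [Prod.dist_eq, le_max_iff, dist_eq_norm, Real.dist_eq] at hw
      rcases hw with hw | hw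
      · refine (min_le_left _ _).trans ?_
        have : ρ ^ 2 ≤ ‖w.1 - z.1‖ ^ 2 := by gcongr
        simp only [N]
        linarith [abs_nonneg (w.2 - z.2)]
      · refine (min_le_right _ _).trans ?_
        simp only [N]
        linarith [sq_nonneg ‖w.1 - z.1‖]
    have h2 := min_le_right θ (η * min (ρ ^ 2) ρ / 3)
    have h3 := mul_le_mul_of_nonneg_left h1 hη.le
    linarith
  set A := Metric.closedBall z r \ Metric.ball z ρ with hA
  have hAc : IsCompact A := (isCompact_closedBall z r).diff Metric.isOpen_ball
  -- Strictness passes to small `ε` uniformly on the compact annulus, so near-maximizers lie in the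
  -- inner ball.
  have hAmax : ∀ᶠ ε in 𝓝[>] (0 : ℝ), ∀ w ∈ A, w ∈ gameDomain Ω T ε →
      f ε w - Φ w < u z - 2 * m := by
    refine eventually_forall_of_compact hAc fun w hw => ?_
    by_cases hwK : w ∈ K
    · have h1 := hrK w hwK (Metric.mem_closedBall.1 hw.1)
      have h2 := hmN w (by
        have := hw.2
        rw [Metric.mem_ball, not_lt] at this
        exact this)
      have h3 := eventually_lt_of_upperLimit_lt (z := w) hM
        (show upperLimit (gameDomain Ω T) f w < u w + m / 4 by rw [← hu]; linarith)
      have h4 : ∀ᶠ q in 𝓝[>] (0 : ℝ) ×ˢ 𝓝 w, Φ w - m / 4 < Φ q.2 :=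
        ((hΦc.tendsto w).comp tendsto_snd).eventually (lt_mem_nhds (by linarith))
      filter_upwards [h3, h4] with q hq1 hq2 hqD
      have := hq1 hqD
      linarith
    · filter_upwards [eventually_notMem_gameDomain hT hfr hwK] with q hq hqD
      exact absurd hqD hq
  have hfreq := frequently_lt_of_lt_upperLimit hM (frequently_mem_gameDomain hz)
    (show u z - m / 2 < upperLimit (gameDomain Ω T) f z by rw [← hu]; linarith)
  have hsmall : ∀ᶠ ε in 𝓝[>] (0 : ℝ), ε < r₀ ∧ ε < r / 2 ∧ ε ^ 2 / 2 < r / 2 ∧ ε ^ 3 < m := by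
    have t : Tendsto (fun ε : ℝ => ε) (𝓝[>] 0) (𝓝 0) := nhdsWithin_le_nhds
    have t2 : Tendsto (fun ε : ℝ => ε ^ 2 / 2) (𝓝[>] 0) (𝓝 0) := by
      simpa using (t.pow 2).div_const 2
    have t3 : Tendsto (fun ε : ℝ => ε ^ 3) (𝓝[>] 0) (𝓝 0) := by simpa using t.pow 3
    exact (t.eventually (gt_mem_nhds hr₀)).and ((t.eventually (gt_mem_nhds (by positivity))).and
      ((t2.eventually (gt_mem_nhds (by positivity))).and (t3.eventually (gt_mem_nhds hm))))
  have hΦsm : ∀ᶠ w in 𝓝 z, |Φ w| < m / 2 := by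
    have := (hΦc.tendsto z).abs
    rw [hΦ0, abs_zero] at this
    exact this.eventually (gt_mem_nhds (by positivity))
  obtain ⟨⟨ε, w₀⟩, ⟨hw₀D, hw₀f⟩, hεall, hw₀Φ, hw₀ρ⟩ := (hfreq.and_eventually
    (((hP.and ((eventually_Ioc_zero hε₀).and (hAmax.and hsmall))).prod_inl (𝓝 z)).and
      ((tz.eventually hΦsm).and (tz.eventually (Metric.ball_mem_nhds z hρ))))).exists
  obtain ⟨hPε, ⟨hε, hεε₀⟩, hA', hεr₀, hεr, hε2, hε3⟩ := hεall
  simp only at hw₀D hw₀f hw₀Φ hw₀ρ hPε hε hεε₀ hA' hεr₀ hεr hε2 hε3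
  set S := (fun w => f ε w - Φ w) '' (gameDomain Ω T ε ∩ Metric.closedBall z r) with hS
  have hw₀r : w₀ ∈ Metric.closedBall z r :=
    Metric.ball_subset_closedBall (Metric.ball_subset_ball (by linarith) hw₀ρ)
  have hSne : S.Nonempty := ⟨_, w₀, ⟨hw₀D, hw₀r⟩, rfl⟩
  have hSbdd : BddAbove S := by
    obtain ⟨C, hC⟩ := (isCompact_closedBall z r).exists_bound_of_continuousOn hΦc.continuousOn
    refine ⟨M + C, ?_⟩
    rintro _ ⟨w, ⟨hwD, hwr⟩, rfl⟩
    have h1 := (abs_le.1 (hf.bounded ε hε hεε₀ w hwD)).2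
    have h2 := (abs_le.1 (hC w hwr)).1
    simp only
    linarith
  -- The supremum need not be attained by a Borel function. An error `ε ^ 3` is negligible against
  -- the step `ε ^ 2 / 2`.
  obtain ⟨_, ⟨w, ⟨hwD, hwr⟩, rfl⟩, hwS⟩ := exists_lt_of_lt_csSup hSne
    (show sSup S - ε ^ 3 < sSup S by linarith [pow_pos hε 3])
  have hSge : ∀ y ∈ gameDomain Ω T ε, y ∈ Metric.closedBall z r →
      f ε y - Φ y ≤ f ε w - Φ w + ε ^ 3 := by
    intro y hy hyr
    have := le_csSup hSbdd ⟨y, ⟨hy, hyr⟩, rfl⟩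
    linarith
  have hwbig : u z - 2 * m < f ε w - Φ w := by
    have h1 := hSge w₀ hw₀D hw₀r
    have h2 := (abs_lt.1 hw₀Φ).2
    linarith
  have hwρ : dist w z < ρ := by
    by_contra! hcon
    have := hA' w ⟨hwr, fun h => absurd (Metric.mem_ball.1 h) (not_lt.2 hcon)⟩ hwD
    linarith
  obtain ⟨hQw, hψw, hΦw⟩ := hball (hwρ.trans_le (min_le_left _ _))
  have hfw : u z - 3 * θ < f ε w := by
    have := (abs_lt.1 hΦw).1
    linarith
  have hwcyl : w ∈ cylinder Ω T := by
    rcases hwD with h | h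
    · exact h
    · exfalso
      have h1 := hf.boundary ε hε hεε₀ w h
      have h2 := hPQ hPε hQw h
      simp only at h2
      linarith
  refine ⟨ε, hε, hεr₀, hεε₀, w, hwcyl, hwρ.trans_le hρr₀, ?_, fun y hy => ?_⟩
  · refine (hf.interior ε hε hεε₀ w hwcyl).resolve_left fun h => ?_
    linarith
  · have hyD := step_mem_gameDomain hε hwcyl hy
    have hd : dist ((y, w.2 - ε ^ 2 / 2) : SpaceTime n) w < r / 2 := by
      rw [Prod.dist_eq, max_lt_iff]
      constructor
      · exact (Metric.mem_ball.1 hy).trans hεr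
      · rw [Real.dist_eq]
        simp only [sub_sub_cancel_left, abs_neg]
        rwa [abs_of_nonneg (by positivity)]
    have hyr : ((y, w.2 - ε ^ 2 / 2) : SpaceTime n) ∈ Metric.closedBall z r := by
      rw [Metric.mem_closedBall]
      linarith [dist_triangle ((y, w.2 - ε ^ 2 / 2) : SpaceTime n) w z]
    have := hSge _ hyD hyr
    linarith

end Limit

end TugOfWar

end

/-! ### The one-step inequality at contact points and its limit -/

noncomputable section

namespace TugOfWar

variable {n : ℕ}

local notation "𝔼" n => EuclideanSpace ℝ (Fin n)

/-- The gradient of the quadratic function `⟨g, d⟩ + X d d / 2 + 2 η ‖d‖ ^ 2` at `d`. -/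
def quadGradient (g : 𝔼 n) (X : (𝔼 n) →L[ℝ] (𝔼 n) →L[ℝ] ℝ) (η : ℝ) (d : 𝔼 n) : 𝔼 n :=
  g + (1 / 2 : ℝ) • (InnerProductSpace.toDual ℝ (𝔼 n)).symm (X d + X.flip d) + (4 * η) • d

theorem inner_quadGradient (g : 𝔼 n) (X : (𝔼 n) →L[ℝ] (𝔼 n) →L[ℝ] ℝ) (η : ℝ) (d h : 𝔼 n) :
    inner ℝ (quadGradient g X η d) h =
      inner ℝ g h + 1 / 2 * (X d h + X h d) + 4 * η * inner ℝ d h := by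
  simp only [quadGradient, inner_add_left, real_inner_smul_left,
    InnerProductSpace.toDual_symm_apply, _root_.add_apply, ContinuousLinearMap.flip_apply]

theorem continuous_quadGradient (g : 𝔼 n) (X : (𝔼 n) →L[ℝ] (𝔼 n) →L[ℝ] ℝ) (η : ℝ) :
    Continuous (quadGradient g X η) := by
  unfold quadGradient
  have := (InnerProductSpace.toDual ℝ (𝔼 n)).symm.continuous
  fun_prop

theorem quadGradient_zero (g : 𝔼 n) (X : (𝔼 n) →L[ℝ] (𝔼 n) →L[ℝ] ℝ) (η : ℝ) :
    quadGradient g X η 0 = g := by simp [quadGradient]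

/-- Addition of a multiple of the inner product to a bilinear form. -/
def shiftBilin (X : (𝔼 n) →L[ℝ] (𝔼 n) →L[ℝ] ℝ) (c : ℝ) : (𝔼 n) →L[ℝ] (𝔼 n) →L[ℝ] ℝ :=
  X + c • innerBilin

theorem shiftBilin_apply (X : (𝔼 n) →L[ℝ] (𝔼 n) →L[ℝ] ℝ) (c : ℝ) (h k : 𝔼 n) :
    shiftBilin X c h k = X h k + c * inner ℝ h k := by
  simp [shiftBilin]

theorem bilinTrace_shiftBilin (X : (𝔼 n) →L[ℝ] (𝔼 n) →L[ℝ] ℝ) (c : ℝ) :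
    bilinTrace (shiftBilin X c) = bilinTrace X + c * n := by
  simp [bilinTrace, shiftBilin, Finset.sum_add_distrib, mul_comm]

/-- The spatial expansion is exact. The time step contributes `-a * (ε ^ 2 / 2)`, and the kinks in
time cost at most `(κ + 2 * η) * (ε ^ 2 / 2)`. -/
theorem jetTest_step_le {z w : SpaceTime n} {κ a η ε : ℝ} (hκ : 0 ≤ κ) (hη : 0 < η) (g : 𝔼 n)
    (X : (𝔼 n) →L[ℝ] (𝔼 n) →L[ℝ] ℝ) (h : 𝔼 n) :
    jetTest z κ a g X (2 * η) (w.1 + h, w.2 - ε ^ 2 / 2) ≤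
      jetTest z κ a g X (2 * η) w - (a - κ - 2 * η) * (ε ^ 2 / 2) +
        inner ℝ (quadGradient g X η (w.1 - z.1)) h +
        1 / 2 * shiftBilin X (4 * η) h h := by
  rw [inner_quadGradient]
  simp only [jetTest]
  set d := w.1 - z.1 with hd
  rw [show w.1 + h - z.1 = d + h by rw [hd]; abel,
    show w.2 - ε ^ 2 / 2 - z.2 = (w.2 - z.2) - ε ^ 2 / 2 by ring]
  have h1 : |w.2 - z.2 - ε ^ 2 / 2| ≤ |w.2 - z.2| + ε ^ 2 / 2 := by
    refine (abs_sub _ _).trans ?_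
    rw [abs_of_nonneg (by positivity : 0 ≤ ε ^ 2 / 2)]
  have h2 := mul_le_mul_of_nonneg_left h1 (by positivity : 0 ≤ κ + 2 * η)
  rw [norm_add_sq_real]
  simp only [map_add, inner_add_right, _root_.add_apply, shiftBilin_apply, real_inner_self_eq_norm_sq]
  linarith

section Limit

variable {Ω : Set (𝔼 n)} {T p ε₀ M : ℝ} {F ψ : SpaceTime n → ℝ} {f : ℝ → SpaceTime n → ℝ}

/-- The one-step inequality at an approximate contact point. -/
theorem IsGameSubsolution.jet_le_of_contact (hf : IsGameSubsolution Ω T p ε₀ M F ψ f)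
    (hp : 2 ≤ p) {z w : SpaceTime n} {κ a η ε : ℝ} (hκ : 0 ≤ κ) (hη : 0 < η) {g : 𝔼 n}
    {X : (𝔼 n) →L[ℝ] (𝔼 n) →L[ℝ] ℝ} (hε : 0 < ε) (hεε₀ : ε ≤ ε₀) (hw : w ∈ cylinder Ω T)
    (hstep : f ε w ≤ gameStep p ε (fun y => f ε (y, w.2 - ε ^ 2 / 2)) w.1)
    (hcontact : ∀ y ∈ Metric.ball w.1 ε, f ε (y, w.2 - ε ^ 2 / 2) ≤
        f ε w - jetTest z κ a g X (2 * η) w + jetTest z κ a g X (2 * η) (y, w.2 - ε ^ 2 / 2) +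
          ε ^ 3) :
    ∃ h₁ : 𝔼 n, ‖h₁‖ ≤ ε ∧
      (∀ h, ‖h‖ ≤ ε → inner ℝ (quadGradient g X η (w.1 - z.1)) h +
        1 / 2 * shiftBilin X (4 * η) h h ≤ inner ℝ (quadGradient g X η (w.1 - z.1)) h₁ +
        1 / 2 * shiftBilin X (4 * η) h₁ h₁) ∧
      (n + p) * (a - κ - 2 * η) ≤ (p - 2) * (shiftBilin X (4 * η) h₁ h₁ / ε ^ 2) +
        bilinTrace X + 4 * η * n + 2 * (n + p) * ε := by
  have hint := integrableOn_slice hε (hf.borel ε hε hεε₀) (hf.bounded ε hε hεε₀) hw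
  obtain ⟨h₁, hh₁, hmax, hle⟩ := gameStep_le_quadratic (M := M)
    (c := f ε w - (a - κ - 2 * η) * (ε ^ 2 / 2) + ε ^ 3)
    (G := quadGradient g X η (w.1 - z.1)) (X := shiftBilin X (4 * η)) hp hε
    (fun y hy => hf.bounded ε hε hεε₀ _ (step_mem_gameDomain hε hw hy)) hint (fun h hh => by
      have h1 := hcontact (w.1 + h) (by simpa [mem_ball_iff_norm] using hh)
      have h2 := jetTest_step_le (z := z) (w := w) (a := a) (ε := ε) hκ hη g X h
      linarith)
  refine ⟨h₁, hh₁, hmax, ?_⟩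
  have h1 := hstep.trans hle
  rw [bilinTrace_shiftBilin] at h1
  have hnp : 0 < (n : ℝ) + p := by positivity
  set Y := (p - 2) * (shiftBilin X (4 * η) h₁ h₁ / ε ^ 2) +
    (bilinTrace X + 4 * η * n) with hY
  have h2 : (a - κ - 2 * η) * (ε ^ 2 / 2) ≤ ε ^ 3 + ε ^ 2 / (2 * (n + p)) * Y := by linarith
  -- Dividing by `ε ^ 2 / 2` turns the contact error `ε ^ 3` into `2 * ε`.
  have h3 : ε ^ 3 + ε ^ 2 / (2 * (n + p)) * Y =
      (ε ^ 2 / 2) * (2 * ε + Y / (n + p)) := by field_simp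
  rw [h3, mul_comm] at h2
  have h4 := le_of_mul_le_mul_left h2 (by positivity)
  have h5 := mul_le_mul_of_nonneg_left h4 hnp.le
  have h6 : (n + p) * (2 * ε + Y / (n + p)) = 2 * (n + p) * ε + Y := by field_simp
  linarith

/-- The upper half-relaxed limit of game subsolutions satisfies the parabolic inequality for
superjets, unless it is below the obstacle or the boundary values. -/
theorem IsGameSubsolution.upperLimit_jet (hf : IsGameSubsolution Ω T p ε₀ M F ψ f) (hp : 2 ≤ p)
    (hΩ : IsOpen Ω) (hT : 0 < T) (hfr : (frontier Ω).Nonempty) (hε₀ : 0 < ε₀)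
    (hψ : Continuous ψ) (hF : ContinuousOn F (parabolicStrip Ω T ε₀)) {z : SpaceTime n}
    (hz : z ∈ closure (cylinder Ω T)) {κ a : ℝ} (hκ : 0 ≤ κ) {g : 𝔼 n}
    {X : (𝔼 n) →L[ℝ] (𝔼 n) →L[ℝ] ℝ}
    (hjet : HasSuperjet (upperLimit (gameDomain Ω T) f) (closure (cylinder Ω T)) z κ a g X) :
    upperLimit (gameDomain Ω T) f z ≤ ψ z ∨
      (z ∈ parabolicBoundary Ω T ∧ upperLimit (gameDomain Ω T) f z ≤ F z) ∨
      JetIneq p (a - κ) g X := by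
  by_contra! hcon
  obtain ⟨hzψ, hzF, hnot⟩ := hcon
  refine hnot ?_
  have hcontact := fun {η : ℝ} (hη : 0 < η) {r : ℝ} (hr : 0 < r) =>
    hf.exists_contact hΩ hT hfr hε₀ hψ hF hz hjet hzψ hzF hη hr
  have hnp : 0 < (n : ℝ) + p := by positivity
  have hp2 : 0 ≤ p - 2 := by linarith
  constructor
  · intro hg
    refine le_of_forall_pos_le_add fun e he => ?_
    obtain ⟨η, hη, hηe⟩ : ∃ η > 0, η * ((n + p) * 4 + (p - 2) * 5 + 4 * n) ≤ e := by
      refine ⟨e / ((n + p) * 4 + (p - 2) * 5 + 4 * n), by positivity, ?_⟩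
      rw [div_mul_cancel₀]
      positivity
    set X' := shiftBilin X (4 * η) with hX'
    let G : SpaceTime n → 𝔼 n := fun w => quadGradient g X η (w.1 - z.1)
    -- The bound of `bilin_maximizer_le` as a function of `(ε, w)`. It is continuous at `(0, z)`
    -- because the gradient there is `g ≠ 0`.
    let Ψ : ℝ × SpaceTime n → ℝ := fun q =>
      X' (G q.2) (G q.2) / ‖G q.2‖ ^ 2 + 2 * ‖X'‖ * √(2 * ‖X'‖ * q.1 / ‖G q.2‖)
    have hGc : Continuous G :=
      (continuous_quadGradient g X η).comp (continuous_fst.sub continuous_const)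
    have hGz : G z = g := by simp only [G, sub_self, quadGradient_zero]
    have hΨ0 : Ψ (0, z) = X g g / ‖g‖ ^ 2 + 4 * η := by
      have : ‖g‖ ≠ 0 := norm_ne_zero_iff.2 hg
      simp only [Ψ, hGz, hX', mul_zero, zero_div, Real.sqrt_zero, add_zero, shiftBilin_apply,
        real_inner_self_eq_norm_sq]
      field_simp
    have hΨc : ContinuousAt Ψ (0, z) := by
      have hGq : Continuous fun q : ℝ × SpaceTime n => G q.2 := hGc.comp continuous_snd
      have hgn : ‖G z‖ ≠ 0 := by rw [hGz]; exact norm_ne_zero_iff.2 hg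
      refine ContinuousAt.add (ContinuousAt.div ?_ ?_ (pow_ne_zero 2 hgn)) ?_
      · exact Continuous.continuousAt (by fun_prop)
      · exact Continuous.continuousAt (by fun_prop)
      · refine ContinuousAt.mul continuousAt_const (Real.continuous_sqrt.continuousAt.comp ?_)
        refine ContinuousAt.div (Continuous.continuousAt (by fun_prop))
          (Continuous.continuousAt (by fun_prop)) hgn
    have hev : ∀ᶠ q in 𝓝 ((0, z) : ℝ × SpaceTime n),
        Ψ q < X g g / ‖g‖ ^ 2 + 5 * η ∧ G q.2 ≠ 0 ∧ q.1 < η := by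
      refine (hΨc.eventually (gt_mem_nhds (by rw [hΨ0]; linarith))).and (Eventually.and ?_ ?_)
      · have : ContinuousAt (fun q : ℝ × SpaceTime n => G q.2) (0, z) :=
          (hGc.comp continuous_snd).continuousAt
        exact this.eventually_ne (by simpa only [hGz] using hg)
      · exact (continuous_fst.tendsto ((0, z) : ℝ × SpaceTime n)).eventually (gt_mem_nhds hη)
    obtain ⟨r, hr, hball⟩ := Metric.eventually_nhds_iff.1 hev
    obtain ⟨ε, hε, hεr, hεε₀, w, hw, hwr, hstep, hcon⟩ := hcontact hη hr
    obtain ⟨h₁, hh₁, hmax, hle⟩ := hf.jet_le_of_contact hp hκ hη hε hεε₀ hw hstep hcon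
    obtain ⟨hq1, hq2, hq3⟩ := @hball (ε, w) (by
      rw [Prod.dist_eq, max_lt_iff]
      refine ⟨?_, hwr⟩
      rwa [Real.dist_eq, sub_zero, abs_of_pos hε])
    have hb := bilin_maximizer_le hε hq2 hh₁ hmax
    have hb2 : X' h₁ h₁ / ε ^ 2 ≤ X g g / ‖g‖ ^ 2 + 5 * η := hb.trans hq1.le
    have hb3 := mul_le_mul_of_nonneg_left hb2 hp2
    have hb4 := mul_le_mul_of_nonneg_left hq3.le hnp.le
    simp only at hb4
    linarith
  · intro hg l hl hX
    refine le_of_forall_pos_le_add fun e he => ?_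
    obtain ⟨η, hη, hηe⟩ : ∃ η > 0, η * ((n + p) * 4 + (p - 2) * 4 + 4 * n) ≤ e := by
      refine ⟨e / ((n + p) * 4 + (p - 2) * 4 + 4 * n), by positivity, ?_⟩
      rw [div_mul_cancel₀]
      positivity
    obtain ⟨ε, hε, hεr, hεε₀, w, hw, hwr, hstep, hcon⟩ := hcontact hη hη
    obtain ⟨h₁, hh₁, hmax, hle⟩ := hf.jet_le_of_contact hp hκ hη hε hεε₀ hw hstep hcon
    -- The direction of `h₁` is unknown and its length may be less than `ε`, so only a nonnegative
    -- bound survives.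
    have hb2 : shiftBilin X (4 * η) h₁ h₁ / ε ^ 2 ≤ l + 4 * η := by
      rw [div_le_iff₀ (by positivity)]
      simp only [shiftBilin_apply, real_inner_self_eq_norm_sq]
      have h1 := hX h₁
      have h2 : ‖h₁‖ ^ 2 ≤ ε ^ 2 := by gcongr
      have h3 := mul_le_mul_of_nonneg_left h2 (by positivity : 0 ≤ l + 4 * η)
      linarith
    have hb3 := mul_le_mul_of_nonneg_left hb2 hp2
    have hb4 := mul_le_mul_of_nonneg_left hεr.le hnp.le
    linarith

end Limit

end TugOfWar

end

noncomputable section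

namespace TugOfWar

variable {n : ℕ}

local notation "𝔼" n => EuclideanSpace ℝ (Fin n)

/-! ### Boundary values of the relaxed limit -/

theorem HasSuperjet.of_isMaxOn_sub {f P : SpaceTime n → ℝ} {K : Set (SpaceTime n)}
    {z : SpaceTime n} {κ a : ℝ} {g : 𝔼 n} {X : (𝔼 n) →L[ℝ] (𝔼 n) →L[ℝ] ℝ}
    (hmax : ∀ᶠ w in 𝓝[K] z, f w - P w ≤ f z - P z) (hP : HasSuperjet P K z κ a g X) :
    HasSuperjet f K z κ a g X := by
  intro η hη
  filter_upwards [hmax, hP η hη] with w h1 h2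
  linarith

section Limit

variable {Ω : Set (𝔼 n)} {T p ε₀ M : ℝ} {F ψ : SpaceTime n → ℝ} {f : ℝ → SpaceTime n → ℝ}

/-- The relaxed limit is below the boundary values at points where barriers exist. -/
theorem IsGameSubsolution.upperLimit_le_of_barrier (hf : IsGameSubsolution Ω T p ε₀ M F ψ f)
    (hp : 2 ≤ p) (hΩ : IsOpen Ω) (hb : Bornology.IsBounded Ω) (hT : 0 < T)
    (hfr : (frontier Ω).Nonempty) (hε₀ : 0 < ε₀) (hψ : Continuous ψ)
    (hF : ContinuousOn F (parabolicStrip Ω T ε₀)) {z₀ : SpaceTime n}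
    (hz₀ : z₀ ∈ parabolicBoundary Ω T) (hψF : ψ z₀ ≤ F z₀)
    (hbar : ∀ r > 0, ∃ P : SpaceTime n → ℝ, Continuous P ∧ P z₀ = 0 ∧
      (∀ w ∈ closure (cylinder Ω T), 0 ≤ P w) ∧
      (∀ w ∈ closure (cylinder Ω T), r ≤ dist w z₀ → 2 * M < P w) ∧
      ∀ w ∈ closure (cylinder Ω T), ∃ a g X,
        HasSuperjet P (closure (cylinder Ω T)) w 0 a g X ∧ ¬ JetIneq p a g X) :
    upperLimit (gameDomain Ω T) f z₀ ≤ F z₀ := by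
  by_contra! hlt
  set u := upperLimit (gameDomain Ω T) f with hu
  set K := closure (cylinder Ω T) with hK
  have hKc : IsCompact K := by
    rw [hK, closure_cylinder Ω hT]
    exact hb.isCompact_closure.prod isCompact_Icc
  have hz₀K : z₀ ∈ K := parabolicBoundary_subset_closure hT hz₀
  have hM := hf.eventually_bounded hε₀
  have huM : ∀ w ∈ K, |u w| ≤ M := fun w hw =>
    abs_upperLimit_le hM (frequently_mem_gameDomain hw)
  have husc : UpperSemicontinuousOn u K :=
    upperSemicontinuousOn_upperLimit hM fun w hw => frequently_mem_gameDomain hw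
  have hnear : ∀ᶠ w in 𝓝 z₀, ψ w < u z₀ ∧ (w ∈ parabolicBoundary Ω T → F w < u z₀) := by
    refine ((hψ.tendsto z₀).eventually (gt_mem_nhds (by linarith))).and ?_
    have := (hF z₀ (parabolicBoundary_subset_strip hΩ T hε₀ hz₀)).eventually (gt_mem_nhds hlt)
    rw [eventually_nhdsWithin_iff] at this
    filter_upwards [this] with w hw hwΓ
    exact hw (parabolicBoundary_subset_strip hΩ T hε₀ hwΓ)
  obtain ⟨r, hr, hball⟩ := Metric.eventually_nhds_iff.1 hnear
  obtain ⟨P, hPc, hP0, hPnn, hPbig, hPjet⟩ := hbar r hr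
  have hsub : UpperSemicontinuousOn (fun w => u w - P w) K := by
    have := husc.add (hPc.neg.upperSemicontinuous.upperSemicontinuousOn K)
    simp only [sub_eq_add_neg]
    exact this
  -- The size of `P` keeps this maximum near `z₀`, and `u w ≥ u z₀` rules out obstacle and boundary
  -- values there. The jet of `P` would then satisfy the inequality it violates by construction.
  obtain ⟨w, hwK, hmax⟩ := hsub.exists_isMaxOn ⟨z₀, hz₀K⟩ hKc
  have hw0 : u z₀ ≤ u w - P w := by
    have : u z₀ - P z₀ ≤ u w - P w := hmax hz₀K
    rwa [hP0, sub_zero] at this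
  have hwr : dist w z₀ < r := by
    by_contra! hge
    have h1 := hPbig w hwK hge
    have h2 := (abs_le.1 (huM w hwK)).2
    have h3 := (abs_le.1 (huM z₀ hz₀K)).1
    linarith
  obtain ⟨hψw, hFw⟩ := hball hwr
  have hPw := hPnn w hwK
  obtain ⟨a, g, X, hjet, hnot⟩ := hPjet w hwK
  have hjetu : HasSuperjet u K w 0 a g X :=
    HasSuperjet.of_isMaxOn_sub (eventually_mem_nhdsWithin.mono fun y hy => hmax hy) hjet
  rcases hf.upperLimit_jet hp hΩ hT hfr hε₀ hψ hF hwK le_rfl hjetu with h | ⟨h1, h2⟩ | h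
  · have : u w ≤ ψ w := h
    linarith
  · have h2 : u w ≤ F w := h2
    have := hFw h1
    linarith
  · rw [sub_zero] at h
    exact hnot h

end Limit

/-- A paraboloid `l * t + μ * ‖x - x₀‖ ^ 2` with `μ` fixed by the required height and `l` then so
large that the time derivative dominates all second-order terms. -/
theorem exists_initial_barrier {p M : ℝ} (hp : 2 ≤ p) (hM : 0 ≤ M) {K : Set (SpaceTime n)}
    (hK : ∀ w ∈ K, 0 ≤ w.2) (x₀ : 𝔼 n) {r : ℝ} (hr : 0 < r) :
    ∃ P : SpaceTime n → ℝ, Continuous P ∧ P (x₀, 0) = 0 ∧ (∀ w ∈ K, 0 ≤ P w) ∧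
      (∀ w ∈ K, r ≤ dist w (x₀, 0) → 2 * M < P w) ∧
      ∀ w ∈ K, ∃ a g X, HasSuperjet P K w 0 a g X ∧ ¬ JetIneq p a g X := by
  have hnp : 0 < (n : ℝ) + p := by positivity
  have hp2 : 0 ≤ p - 2 := by linarith
  obtain ⟨μ, hμ, hμr⟩ : ∃ μ > 0, 2 * M < μ * r ^ 2 := by
    refine ⟨(2 * M + 1) / r ^ 2, by positivity, ?_⟩
    rw [div_mul_cancel₀ _ (by positivity)]
    linarith
  obtain ⟨l, hl, hlr, hlμ⟩ : ∃ l > 0, 2 * M < l * r ∧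
      (p - 2) * (2 * μ) + n * (2 * μ) < (n + p) * l := by
    refine ⟨(2 * M + 1) / r + ((p - 2) * (2 * μ) + n * (2 * μ) + 1) / (n + p), by positivity, ?_, ?_⟩
    · rw [add_mul, div_mul_cancel₀ _ hr.ne']
      have : 0 ≤ ((p - 2) * (2 * μ) + n * (2 * μ) + 1) / (n + p) * r := by positivity
      linarith
    · rw [mul_add, mul_div_cancel₀ _ hnp.ne']
      have : 0 ≤ (n + p) * ((2 * M + 1) / r) := by positivity
      linarith
  refine ⟨fun w => l * w.2 + μ * ‖w.1 - x₀‖ ^ 2, by fun_prop, by simp, fun w hw => ?_,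
    fun w hw hwr => ?_, fun w hw => ?_⟩
  · have := hK w hw
    positivity
  · have h0 := hK w hw
    rw [Prod.dist_eq, le_max_iff, dist_eq_norm, Real.dist_eq] at hwr
    simp only [sub_zero] at hwr
    rcases hwr with h | h
    · have h1 : r ^ 2 ≤ ‖w.1 - x₀‖ ^ 2 := by gcongr
      have h2 := mul_le_mul_of_nonneg_left h1 hμ.le
      have h3 := mul_nonneg hl.le h0
      linarith
    · rw [abs_of_nonneg h0] at h
      have h2 := mul_le_mul_of_nonneg_left h hl.le
      have h3 : 0 ≤ μ * ‖w.1 - x₀‖ ^ 2 := by positivity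
      linarith
  · refine ⟨l, (2 * μ) • (w.1 - x₀), (2 * μ) • innerBilin, fun η hη => ?_, fun hj => ?_⟩
    · refine Eventually.of_forall fun y => ?_
      have e : ‖y.1 - x₀‖ ^ 2 = ‖w.1 - x₀‖ ^ 2 + 2 * inner ℝ (w.1 - x₀) (y.1 - w.1) +
          ‖y.1 - w.1‖ ^ 2 := by
        rw [← norm_add_sq_real]; congr 2; abel
      have : 0 ≤ η * (‖y.1 - w.1‖ ^ 2 + |y.2 - w.2|) := by positivity
      simp only [e, inner_smul_left, _root_.smul_apply, innerBilin_apply,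
        real_inner_self_eq_norm_sq, smul_eq_mul, RCLike.conj_to_real, zero_mul]
      linarith
    · have := hj.le_of_le hp (l := 2 * μ) (by positivity) fun k => by
        simp only [_root_.smul_apply, innerBilin_apply, real_inner_self_eq_norm_sq, smul_eq_mul]
        exact le_rfl
      linarith

/-- The Hessian of `x ↦ -exp (-m ‖x‖ ^ 2)` up to the factor `exp (-m ‖x‖ ^ 2)`. -/
def gaussianHessian (m : ℝ) (y : 𝔼 n) : (𝔼 n) →L[ℝ] (𝔼 n) →L[ℝ] ℝ :=
  (2 * m) • innerBilin - (4 * m ^ 2) • (innerBilin y).smulRight (innerBilin y)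

theorem gaussianHessian_apply (m : ℝ) (y h k : 𝔼 n) :
    gaussianHessian m y h k = 2 * m * inner ℝ h k - 4 * m ^ 2 * (inner ℝ y h * inner ℝ y k) := by
  simp [gaussianHessian]

theorem bilinTrace_gaussianHessian (m : ℝ) (y : 𝔼 n) :
    bilinTrace (gaussianHessian m y) = 2 * m * n - 4 * m ^ 2 * ‖y‖ ^ 2 := by
  have : ‖y‖ ^ 2 = ∑ i, y i * y i := by
    rw [EuclideanSpace.real_norm_sq_eq]
    exact Finset.sum_congr rfl fun j _ => sq _
  simp only [bilinTrace, gaussianHessian_apply, this, Finset.sum_sub_distrib, ← Finset.mul_sum]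
  simp [mul_comm, EuclideanSpace.inner_single_right]

theorem neg_exp_neg_le {v : ℝ} (hv : |v| ≤ 1) : -Real.exp (-v) ≤ -1 + v - v ^ 2 / 2 + |v| ^ 3 := by
  have h := Real.exp_bound (x := -v) (by rwa [abs_neg]) (n := 3) (by norm_num)
  have h1 := (abs_le.1 h).1
  simp only [Finset.sum_range_succ, Finset.sum_range_zero, abs_neg] at h1
  norm_num [Nat.factorial] at h1
  have h2 : 0 ≤ |v| ^ 3 := by positivity
  nlinarith

/-- Second-order expansion from above of `x ↦ -exp (-m ‖x‖ ^ 2)`. -/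
theorem neg_gaussian_expansion {m : ℝ} (hm : 0 < m) (y : 𝔼 n) {η : ℝ} (hη : 0 < η) :
    ∀ᶠ h in 𝓝 (0 : 𝔼 n), -Real.exp (-(m * ‖y + h‖ ^ 2)) ≤ Real.exp (-(m * ‖y‖ ^ 2)) *
      (-1 + 2 * m * inner ℝ y h + 1 / 2 * gaussianHessian m y h h + η * ‖h‖ ^ 2) := by
  set C := m * (2 * ‖y‖ + 1) with hC
  have hC0 : 0 < C := by positivity
  have t : Tendsto (fun h : 𝔼 n => ‖h‖) (𝓝 0) (𝓝 0) := by
    simpa using (continuous_norm (E := 𝔼 n)).tendsto 0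
  have t1 : Tendsto (fun h : 𝔼 n => C * ‖h‖) (𝓝 0) (𝓝 0) := by simpa using t.const_mul C
  have t2 : Tendsto (fun h : 𝔼 n => (2 * m ^ 2 * ‖y‖ + C ^ 3) * ‖h‖) (𝓝 0) (𝓝 0) := by
    simpa using t.const_mul (2 * m ^ 2 * ‖y‖ + C ^ 3)
  filter_upwards [t.eventually (gt_mem_nhds one_pos), t1.eventually (gt_mem_nhds one_pos),
    t2.eventually (gt_mem_nhds hη)] with h h1 h2 h3
  set v := m * (2 * inner ℝ y h + ‖h‖ ^ 2) with hv
  have hin := abs_le.1 (abs_real_inner_le_norm y h)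
  have hh0 := norm_nonneg h
  have hvC : |v| ≤ C * ‖h‖ := by
    rw [hv, abs_mul, abs_of_pos hm, hC, mul_assoc]
    refine mul_le_mul_of_nonneg_left ?_ hm.le
    rw [abs_le]
    constructor <;> nlinarith
  have hsplit : Real.exp (-(m * ‖y + h‖ ^ 2)) = Real.exp (-(m * ‖y‖ ^ 2)) * Real.exp (-v) := by
    rw [← Real.exp_add, norm_add_sq_real, hv]
    congr 1
    ring
  rw [hsplit, ← mul_neg]
  refine mul_le_mul_of_nonneg_left ((neg_exp_neg_le (hvC.trans h2.le)).trans ?_) (Real.exp_pos _).le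
  rw [gaussianHessian_apply, real_inner_self_eq_norm_sq]
  have hv3 : |v| ^ 3 ≤ C ^ 3 * ‖h‖ * ‖h‖ ^ 2 := by
    calc |v| ^ 3 ≤ (C * ‖h‖) ^ 3 := by gcongr
      _ = _ := by ring
  have hv2 : -(v ^ 2 / 2) ≤ -(2 * m ^ 2 * (inner ℝ y h * inner ℝ y h)) +
      2 * m ^ 2 * ‖y‖ * ‖h‖ * ‖h‖ ^ 2 := by
    have e : v ^ 2 / 2 = 2 * m ^ 2 * (inner ℝ y h * inner ℝ y h) +
        2 * m ^ 2 * ‖h‖ ^ 2 * inner ℝ y h + m ^ 2 * ‖h‖ ^ 4 / 2 := by rw [hv]; ring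
    have e1 := mul_le_mul_of_nonneg_left hin.1 (by positivity : 0 ≤ 2 * m ^ 2 * ‖h‖ ^ 2)
    have e2 : 0 ≤ m ^ 2 * ‖h‖ ^ 4 / 2 := by positivity
    rw [e]
    nlinarith
  have h4 := mul_le_mul_of_nonneg_right h3.le (sq_nonneg ‖h‖)
  nlinarith

end TugOfWar

end

noncomputable section

namespace TugOfWar

variable {n : ℕ}

local notation "𝔼" n => EuclideanSpace ℝ (Fin n)

/-! ### Lateral barriers -/

theorem lateralBarrier_hasSuperjet {m : ℝ} (hm : 0 < m) {l ν : ℝ} (hl : 0 < l)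
    (ξ : 𝔼 n) (R t₀ : ℝ) (K : Set (SpaceTime n)) (w : SpaceTime n) :
    HasSuperjet (fun z => l * (Real.exp (-(m * R ^ 2)) - Real.exp (-(m * ‖z.1 - ξ‖ ^ 2))) +
        ν * (z.2 - t₀) ^ 2) K w 0 (2 * ν * (w.2 - t₀))
      ((2 * m * (l * Real.exp (-(m * ‖w.1 - ξ‖ ^ 2)))) • (w.1 - ξ))
      ((l * Real.exp (-(m * ‖w.1 - ξ‖ ^ 2))) • gaussianHessian m (w.1 - ξ)) := by
  intro η hη
  set e := Real.exp (-(m * ‖w.1 - ξ‖ ^ 2)) with he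
  have he0 : 0 < e := Real.exp_pos _
  have t1 : Tendsto (fun z : SpaceTime n => z.1 - w.1) (𝓝[K] w) (𝓝 0) := by
    have : Tendsto (fun z : SpaceTime n => z.1 - w.1) (𝓝 w) (𝓝 (w.1 - w.1)) :=
      (by fun_prop : Continuous fun z : SpaceTime n => z.1 - w.1).tendsto w
    rw [sub_self] at this
    exact this.mono_left nhdsWithin_le_nhds
  have t2 : Tendsto (fun z : SpaceTime n => ν * |z.2 - w.2|) (𝓝[K] w) (𝓝 0) := by
    have : Tendsto (fun z : SpaceTime n => ν * |z.2 - w.2|) (𝓝 w) (𝓝 (ν * |w.2 - w.2|)) :=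
      (by fun_prop : Continuous fun z : SpaceTime n => ν * |z.2 - w.2|).tendsto w
    rw [sub_self, abs_zero, mul_zero] at this
    exact this.mono_left nhdsWithin_le_nhds
  filter_upwards [t1.eventually (neg_gaussian_expansion hm (w.1 - ξ)
    (show 0 < η / (l * e) by positivity)), t2.eventually (gt_mem_nhds hη)] with z h1 h2
  rw [show w.1 - ξ + (z.1 - w.1) = z.1 - ξ by abel, ← he] at h1
  have h3 := mul_le_mul_of_nonneg_left h1 hl.le
  have h4 : l * (e * (η / (l * e) * ‖z.1 - w.1‖ ^ 2)) = η * ‖z.1 - w.1‖ ^ 2 := by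
    field_simp
  have h5 := mul_le_mul_of_nonneg_right h2.le (abs_nonneg (z.2 - w.2))
  have h6 : |z.2 - w.2| * |z.2 - w.2| = (z.2 - w.2) * (z.2 - w.2) := abs_mul_abs_self _
  simp only [inner_smul_left, _root_.smul_apply, smul_eq_mul, RCLike.conj_to_real]
  rw [mul_assoc, h6] at h5
  nlinarith

theorem gaussianHessian_self (m : ℝ) (y : 𝔼 n) :
    gaussianHessian m y y y = (2 * m - 4 * m ^ 2 * ‖y‖ ^ 2) * ‖y‖ ^ 2 := by
  rw [gaussianHessian_apply, real_inner_self_eq_norm_sq]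
  ring

/-- The Hessian is strongly negative in the radial direction, which is also the direction of the
gradient. The operator gives `2 * m * l * (p - 2 + n - 2 * m * ‖y‖ ^ 2 * (p - 1))`, at most `-2 * m
* l` by the choice of `m`. -/
theorem not_jetIneq_lateralBarrier {p m l R b : ℝ} (hp : 2 ≤ p) (hm : 0 < m) (hl : 0 < l)
    (hR : 0 < R) (hmR : p - 2 + n + 1 ≤ 2 * m * R ^ 2 * (p - 1)) {y : 𝔼 n} (hy : R ≤ ‖y‖)
    (hb : -(2 * m * l) < (n + p) * b) : ¬ JetIneq p b ((2 * m * l) • y) (l • gaussianHessian m y) := by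
  intro hj
  have hy0 : y ≠ 0 := by
    rintro rfl
    rw [norm_zero] at hy
    linarith
  have hy1 : 0 < ‖y‖ := norm_pos_iff.2 hy0
  have hc : 0 < 2 * m * l := by positivity
  have h := hj.1 (smul_ne_zero hc.ne' hy0)
  have htr : bilinTrace (l • gaussianHessian m y) = l * (2 * m * n - 4 * m ^ 2 * ‖y‖ ^ 2) := by
    rw [← bilinTrace_gaussianHessian]
    simp [bilinTrace, Finset.mul_sum]
  rw [htr] at h
  have hq : (l • gaussianHessian m y) ((2 * m * l) • y) ((2 * m * l) • y) /
      ‖(2 * m * l) • y‖ ^ 2 = l * (2 * m - 4 * m ^ 2 * ‖y‖ ^ 2) := by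
    simp only [map_smul, _root_.smul_apply, gaussianHessian_self, norm_smul, smul_eq_mul,
      Real.norm_of_nonneg hc.le]
    field_simp
  rw [hq] at h
  have h1 : R ^ 2 ≤ ‖y‖ ^ 2 := by gcongr
  have h2 : 2 * m * R ^ 2 * (p - 1) ≤ 2 * m * ‖y‖ ^ 2 * (p - 1) := by
    have : 0 ≤ p - 1 := by linarith
    gcongr
  have h3 := mul_le_mul_of_nonneg_left (hmR.trans h2) hc.le
  nlinarith

/-- A Gaussian profile around `ξ` controls the distance in space and a parabola in `t` the distance
in time. The parameters are fixed in the order `m`, `ν`, `l`: the last one must lift the spatial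
part above `2 * M` and beat the time derivative of the parabola, using the lower bound `e₀` of the
Gaussian on `K`. -/
theorem exists_lateral_barrier {p M T : ℝ} (hp : 2 ≤ p) (hM : 0 ≤ M) {K : Set (SpaceTime n)}
    {ξ x₀ : 𝔼 n} {R D t₀ : ℝ} (hR : 0 < R) (hx₀ : ‖x₀ - ξ‖ = R) (ht₀ : 0 ≤ t₀ ∧ t₀ ≤ T)
    (hKt : ∀ w ∈ K, 0 ≤ w.2 ∧ w.2 ≤ T) (hKD : ∀ w ∈ K, ‖w.1 - ξ‖ ≤ D)
    (hKR : ∀ w ∈ K, R ^ 2 + ‖w.1 - x₀‖ ^ 2 / 2 ≤ ‖w.1 - ξ‖ ^ 2) {r : ℝ} (hr : 0 < r) :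
    ∃ P : SpaceTime n → ℝ, Continuous P ∧ P (x₀, t₀) = 0 ∧ (∀ w ∈ K, 0 ≤ P w) ∧
      (∀ w ∈ K, r ≤ dist w (x₀, t₀) → 2 * M < P w) ∧
      ∀ w ∈ K, ∃ a g X, HasSuperjet P K w 0 a g X ∧ ¬ JetIneq p a g X := by
  have hnp : 0 < (n : ℝ) + p := by positivity
  have hp2 : 0 ≤ p - 2 := by linarith
  have hp1 : 0 < p - 1 := by linarith
  have hT : 0 ≤ T := ht₀.1.trans ht₀.2
  obtain ⟨m, hm, hmR⟩ : ∃ m > 0, p - 2 + n + 1 ≤ 2 * m * R ^ 2 * (p - 1) := by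
    refine ⟨(p - 2 + n + 1) / (2 * R ^ 2 * (p - 1)), by positivity, le_of_eq ?_⟩
    field_simp
  obtain ⟨ν, hν, hνr⟩ : ∃ ν > 0, 2 * M < ν * r ^ 2 := by
    refine ⟨(2 * M + 1) / r ^ 2, by positivity, ?_⟩
    rw [div_mul_cancel₀ _ (by positivity)]
    linarith
  set e₀ := Real.exp (-(m * D ^ 2)) with he₀
  have he₀0 : 0 < e₀ := Real.exp_pos _
  set br := Real.exp (-(m * R ^ 2)) - Real.exp (-(m * (R ^ 2 + r ^ 2 / 2))) with hbr
  have hbr0 : 0 < br := by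
    rw [hbr, sub_pos, Real.exp_lt_exp]
    have : 0 < m * (r ^ 2 / 2) := by positivity
    linarith
  obtain ⟨l, hl, hl1, hl2⟩ : ∃ l > 0, 2 * M < l * br ∧
      (n + p) * (2 * ν * T) < 2 * m * (l * e₀) := by
    refine ⟨(2 * M + 1) / br + ((n + p) * (2 * ν * T) + 1) / (2 * m * e₀), by positivity, ?_, ?_⟩
    · rw [add_mul, div_mul_cancel₀ _ hbr0.ne']
      have : 0 ≤ ((n + p) * (2 * ν * T) + 1) / (2 * m * e₀) * br := by positivity
      linarith
    · have h1 : 2 * m * (((2 * M + 1) / br + ((n + p) * (2 * ν * T) + 1) / (2 * m * e₀)) * e₀) =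
          2 * m * e₀ * ((2 * M + 1) / br) + ((n + p) * (2 * ν * T) + 1) := by
        field_simp
      rw [h1]
      have : 0 ≤ 2 * m * e₀ * ((2 * M + 1) / br) := by positivity
      linarith
  have hspace : ∀ w ∈ K, ∀ s, 0 ≤ s → s ≤ ‖w.1 - x₀‖ →
      Real.exp (-(m * R ^ 2)) - Real.exp (-(m * (R ^ 2 + s ^ 2 / 2))) ≤
        Real.exp (-(m * R ^ 2)) - Real.exp (-(m * ‖w.1 - ξ‖ ^ 2)) := by
    intro w hw s hs hsw
    have h1 : s ^ 2 ≤ ‖w.1 - x₀‖ ^ 2 := by gcongr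
    have h2 := hKR w hw
    have h3 : R ^ 2 + s ^ 2 / 2 ≤ ‖w.1 - ξ‖ ^ 2 := by linarith
    gcongr
  have hspace0 : ∀ w ∈ K, 0 ≤ Real.exp (-(m * R ^ 2)) - Real.exp (-(m * ‖w.1 - ξ‖ ^ 2)) := by
    intro w hw
    have := hspace w hw 0 le_rfl (norm_nonneg _)
    simpa using this
  refine ⟨fun z => l * (Real.exp (-(m * R ^ 2)) - Real.exp (-(m * ‖z.1 - ξ‖ ^ 2))) +
      ν * (z.2 - t₀) ^ 2, by fun_prop, by simp [hx₀], fun w hw => ?_, fun w hw hwr => ?_,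
    fun w hw => ⟨_, _, _, lateralBarrier_hasSuperjet hm hl ξ R t₀ K w, ?_⟩⟩
  · have := hspace0 w hw
    positivity
  · have h0 := hspace0 w hw
    rw [Prod.dist_eq, le_max_iff, dist_eq_norm, Real.dist_eq] at hwr
    simp only at hwr
    rcases hwr with h | h
    · have h1 := mul_le_mul_of_nonneg_left (hspace w hw r hr.le h) hl.le
      have h2 : 0 ≤ ν * (w.2 - t₀) ^ 2 := by positivity
      linarith
    · have h1 : r ^ 2 ≤ (w.2 - t₀) ^ 2 := by
        rw [← sq_abs (w.2 - t₀)]; gcongr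
      have h2 := mul_le_mul_of_nonneg_left h1 hν.le
      have h3 := mul_nonneg hl.le h0
      linarith
  · have hRy : R ≤ ‖w.1 - ξ‖ := by
      have h2 := hKR w hw
      have h3 := sq_nonneg ‖w.1 - x₀‖
      exact le_of_sq_le_sq (by linarith) (norm_nonneg _)
    refine not_jetIneq_lateralBarrier hp hm (by positivity) hR hmR hRy ?_
    have hD : e₀ ≤ Real.exp (-(m * ‖w.1 - ξ‖ ^ 2)) := by
      have := hKD w hw
      rw [he₀]
      gcongr
    have h1 : 2 * m * (l * e₀) ≤ 2 * m * (l * Real.exp (-(m * ‖w.1 - ξ‖ ^ 2))) := by gcongr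
    have h2 : -T ≤ w.2 - t₀ := by linarith [(hKt w hw).1]
    have h3 : (n + p) * (2 * ν * -T) ≤ (n + p) * (2 * ν * (w.2 - t₀)) := by gcongr
    linarith

section Limit

variable {Ω : Set (𝔼 n)} {T p ε₀ M : ℝ} {F ψ : SpaceTime n → ℝ} {f : ℝ → SpaceTime n → ℝ}

theorem IsGameSubsolution.upperLimit_le_boundary (hf : IsGameSubsolution Ω T p ε₀ M F ψ f)
    (hp : 2 ≤ p) (hM : 0 ≤ M) (hΩ : IsOpen Ω) (hb : Bornology.IsBounded Ω)
    (hext : ExteriorSphereCondition Ω) (hT : 0 < T)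
    (hfr : (frontier Ω).Nonempty) (hε₀ : 0 < ε₀) (hψ : Continuous ψ)
    (hF : ContinuousOn F (parabolicStrip Ω T ε₀)) {z₀ : SpaceTime n}
    (hz₀ : z₀ ∈ parabolicBoundary Ω T) (hψF : ψ z₀ ≤ F z₀) :
    upperLimit (gameDomain Ω T) f z₀ ≤ F z₀ := by
  refine hf.upperLimit_le_of_barrier hp hΩ hb hT hfr hε₀ hψ hF hz₀ hψF fun r hr => ?_
  have hcl := closure_cylinder Ω hT
  have hKt : ∀ w ∈ closure (cylinder Ω T), 0 ≤ w.2 ∧ w.2 ≤ T := by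
    rw [hcl]
    exact fun w hw => hw.2
  obtain ⟨x₀, t₀⟩ := z₀
  rcases hz₀ with ⟨hx, ht⟩ | ⟨hx, ht⟩
  · obtain ⟨c, δ, hδ, hball, hsph⟩ := hext x₀ hx
    have hdisj : ∀ x ∈ closure Ω, δ ≤ ‖x - c‖ := by
      have hsub : closure Ω ⊆ (Metric.ball c δ)ᶜ :=
        closure_minimal (subset_compl_comm.1 hball) Metric.isOpen_ball.isClosed_compl
      intro x hx
      have := hsub hx
      rwa [mem_compl_iff, Metric.mem_ball, not_lt, dist_eq_norm] at this
    obtain ⟨D, hD⟩ := hb.closure.exists_norm_le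
    rw [Metric.mem_sphere, dist_eq_norm] at hsph
    -- Halving the exterior ball towards `x₀` makes the contact unique and quantitative: the squared
    -- distance to `ξ` exceeds `R ^ 2` by at least `‖x - x₀‖ ^ 2 / 2`.
    set ξ : 𝔼 n := x₀ - (1 / 2 : ℝ) • (x₀ - c) with hξ
    have hx₀ξ : ‖x₀ - ξ‖ = δ / 2 := by
      rw [hξ, sub_sub_cancel, norm_smul, hsph]
      norm_num
      ring
    refine exists_lateral_barrier (ξ := ξ) (R := δ / 2) (D := D + ‖ξ‖) (T := T) hp hM
      (by positivity) hx₀ξ ht hKt ?_ ?_ hr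
    · intro w hw
      rw [hcl] at hw
      exact (norm_sub_le _ _).trans (by have := hD _ hw.1; linarith)
    · intro w hw
      rw [hcl] at hw
      have h1 := hdisj _ hw.1
      have h2 : δ ^ 2 ≤ ‖w.1 - c‖ ^ 2 := by gcongr
      have e1 : w.1 - c = (w.1 - x₀) + (x₀ - c) := by abel
      have e2 : w.1 - ξ = (w.1 - x₀) + (1 / 2 : ℝ) • (x₀ - c) := by rw [hξ]; abel
      rw [e1, norm_add_sq_real, hsph] at h2
      rw [e2, norm_add_sq_real, inner_smul_right, norm_smul, hsph]
      norm_num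
      nlinarith
  · have ht : t₀ = 0 := ht
    subst ht
    exact exists_initial_barrier hp hM (fun w hw => (hKt w hw).1) x₀ hr

end Limit

end TugOfWar

end

noncomputable section

namespace TugOfWar

variable {n : ℕ}

local notation "𝔼" n => EuclideanSpace ℝ (Fin n)

/-! ### Solutions of the dynamic programming principle -/

theorem ParabolicLipschitzOn.exists_abs_le {C : ℝ} {f : SpaceTime n → ℝ} {S : Set (SpaceTime n)}
    (hf : ParabolicLipschitzOn C f S) (hS : Bornology.IsBounded S) : ∃ M, ∀ z ∈ S, |f z| ≤ M := by
  rcases S.eq_empty_or_nonempty with rfl | ⟨z₀, hz₀⟩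
  · exact ⟨0, by simp⟩
  obtain ⟨D, hD⟩ := Metric.isBounded_iff.1 hS
  refine ⟨|f z₀| + |C| * (D + √D), fun z hz => ?_⟩
  have h1 := hf z hz z₀ hz₀
  have h2 := hD hz hz₀
  rw [Prod.dist_eq, max_le_iff, dist_eq_norm, Real.dist_eq] at h2
  have h3 : C * (‖z.1 - z₀.1‖ + √|z.2 - z₀.2|) ≤ |C| * (D + √D) := by
    have := Real.sqrt_le_sqrt h2.2
    have := h2.1
    calc _ ≤ |C| * (‖z.1 - z₀.1‖ + √|z.2 - z₀.2|) := by
          gcongr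
          exact le_abs_self C
      _ ≤ _ := by gcongr
  have h4 := abs_sub_abs_le_abs_sub (f z) (f z₀)
  linarith

theorem ParabolicLipschitzOn.continuousOn {C : ℝ} {f : SpaceTime n → ℝ} {S : Set (SpaceTime n)}
    (hf : ParabolicLipschitzOn C f S) : ContinuousOn f S := by
  intro z hz
  have ht : Tendsto (fun w : SpaceTime n => C * (‖w.1 - z.1‖ + √|w.2 - z.2|)) (𝓝[S] z) (𝓝 0) := by
    have : Tendsto (fun w : SpaceTime n => C * (‖w.1 - z.1‖ + √|w.2 - z.2|)) (𝓝 z)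
        (𝓝 (C * (‖z.1 - z.1‖ + √|z.2 - z.2|))) :=
      (by fun_prop : Continuous fun w : SpaceTime n =>
        C * (‖w.1 - z.1‖ + √|w.2 - z.2|)).tendsto z
    simp only [sub_self, norm_zero, abs_zero, Real.sqrt_zero, add_zero, mul_zero] at this
    exact this.mono_left nhdsWithin_le_nhds
  refine tendsto_iff_dist_tendsto_zero.2 (squeeze_zero' (Eventually.of_forall fun w => dist_nonneg)
    (eventually_mem_nhdsWithin.mono fun w hw => ?_) ht)
  rw [Real.dist_eq]
  exact hf w hw z hz

theorem isBounded_parabolicStrip {Ω : Set (𝔼 n)} (hb : Bornology.IsBounded Ω)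
    (hfr : (frontier Ω).Nonempty) (T ε : ℝ) : Bornology.IsBounded (parabolicStrip Ω T ε) := by
  have hout : Bornology.IsBounded (outerStrip Ω ε) := by
    refine (hb.closure.subset frontier_subset_closure).cthickening (δ := ε) |>.subset fun x hx => ?_
    exact Metric.mem_cthickening_iff.2 ((ENNReal.le_ofReal_iff_toReal_le
      (Metric.infEDist_ne_top hfr) (Metric.infDist_nonneg.trans hx.2)).2 hx.2)
  exact (hout.prod (Metric.isBounded_Ioc _ _)).union (hb.prod (Metric.isBounded_Ioc _ _))

section Solution

variable {Ω : Set (𝔼 n)} {T p ε M : ℝ} {F ψ : SpaceTime n → ℝ} {u : SpaceTime n → ℝ}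

theorem IsDPPSolution.eq_max_gameStep (hu : IsDPPSolution Ω T p F ψ ε u) {z : SpaceTime n}
    (hz : z ∈ cylinder Ω T) :
    u z = max (ψ z) (gameStep p ε (fun y => u (y, z.2 - ε ^ 2 / 2)) z.1) :=
  hu.interior z hz

/-- Each step goes back by `ε ^ 2 / 2` in time and averages earlier values, so induction over time
levels reduces to the strip. The bound does not depend on `ε`. -/
theorem IsDPPSolution.abs_le (hu : IsDPPSolution Ω T p F ψ ε u) (hp : 2 ≤ p) (hε : 0 < ε)
    (hF : ∀ z ∈ parabolicStrip Ω T ε, |F z| ≤ M) (hψ : ∀ z ∈ cylinder Ω T, |ψ z| ≤ M) :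
    ∀ z ∈ gameDomain Ω T ε, |u z| ≤ M := by
  have hstrip : ∀ z ∈ parabolicStrip Ω T ε, |u z| ≤ M := fun z hz => by
    rw [hu.boundary z hz]
    exact hF z hz
  have key : ∀ k : ℕ, ∀ z ∈ gameDomain Ω T ε, z.2 ≤ k * (ε ^ 2 / 2) → |u z| ≤ M := by
    intro k
    induction k with
    | zero =>
      rintro z (hz | hz) hzk
      · rw [Nat.cast_zero, zero_mul] at hzk
        exact absurd hz.2.1 (not_lt.2 hzk)
      · exact hstrip z hz
    | succ k ih =>
      rintro z (hz | hz) hzk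
      · have hball : ∀ y ∈ Metric.ball z.1 ε, |u (y, z.2 - ε ^ 2 / 2)| ≤ M := fun y hy => by
          refine ih _ (step_mem_gameDomain hε hz hy) ?_
          push_cast at hzk
          simp only
          linarith
        have h1 := gameStep_le_of_le hp hε hball
        have h2 : gameStep p ε (fun y => -u (y, z.2 - ε ^ 2 / 2)) z.1 ≤ M :=
          gameStep_le_of_le hp hε fun y hy => by rw [abs_neg]; exact hball y hy
        rw [gameStep_neg] at h2
        rw [hu.eq_max_gameStep hz, _root_.abs_le]
        exact ⟨le_max_of_le_left (_root_.abs_le.1 (hψ z hz)).1,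
          max_le (_root_.abs_le.1 (hψ z hz)).2 h1⟩
      · exact hstrip z hz
  intro z hz
  obtain ⟨k, hk⟩ := exists_nat_ge (z.2 / (ε ^ 2 / 2))
  exact key k z hz ((div_le_iff₀ (by positivity)).1 hk)

end Solution

section Family

variable {Ω : Set (𝔼 n)} {T p ε₀ M : ℝ} {F ψ : SpaceTime n → ℝ} {u : ℝ → SpaceTime n → ℝ}

theorem isGameSubsolution_of_dpp (hu : ∀ ε, 0 < ε → ε ≤ ε₀ → IsDPPSolution Ω T p F ψ ε (u ε))
    (hM : ∀ ε, 0 < ε → ε ≤ ε₀ → ∀ z ∈ gameDomain Ω T ε, |u ε z| ≤ M) :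
    IsGameSubsolution Ω T p ε₀ M F ψ u where
  borel ε h0 h1 := (hu ε h0 h1).borel
  bounded := hM
  interior ε h0 h1 z hz := by
    have := (hu ε h0 h1).eq_max_gameStep hz
    exact le_max_iff.1 this.le
  boundary ε h0 h1 := (hu ε h0 h1).boundary

/-- The maximum dominates the game step, so the second alternative always holds for `-u ε` and the
obstacle `c` is free; it is later chosen below all values. -/
theorem isGameSubsolution_neg_of_dpp
    (hu : ∀ ε, 0 < ε → ε ≤ ε₀ → IsDPPSolution Ω T p F ψ ε (u ε))
    (hM : ∀ ε, 0 < ε → ε ≤ ε₀ → ∀ z ∈ gameDomain Ω T ε, |u ε z| ≤ M) (c : ℝ) :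
    IsGameSubsolution Ω T p ε₀ M (fun z => -F z) (fun _ => c) (fun ε z => -u ε z) where
  borel ε h0 h1 := (hu ε h0 h1).borel.neg
  bounded ε h0 h1 z hz := by
    rw [abs_neg]
    exact hM ε h0 h1 z hz
  interior ε h0 h1 z hz := by
    refine Or.inr ?_
    rw [gameStep_neg, neg_le_neg_iff, (hu ε h0 h1).eq_max_gameStep hz]
    exact le_max_right _ _
  boundary ε h0 h1 z hz := by rw [(hu ε h0 h1).boundary z hz]

end Family

end TugOfWar

end

noncomputable section

namespace TugOfWar

variable {n : ℕ}

local notation "𝔼" n => EuclideanSpace ℝ (Fin n)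

/-! ### Convergence to the relaxed limit -/

section RelaxedLimits

variable {Y : Type*} [TopologicalSpace Y] {D : ℝ → Set Y} {f : ℝ → Y → ℝ} {M : ℝ} {K : Set Y}

theorem add_upperLimit_neg_nonneg (hM : ∀ᶠ ε in 𝓝[>] (0 : ℝ), ∀ w ∈ D ε, |f ε w| ≤ M) {z : Y}
    (hz : ∃ᶠ q in 𝓝[>] (0 : ℝ) ×ˢ 𝓝 z, q.2 ∈ D q.1) :
    0 ≤ upperLimit D f z + upperLimit D (fun ε w => -f ε w) z := by
  have hM' : ∀ᶠ ε in 𝓝[>] (0 : ℝ), ∀ w ∈ D ε, |-f ε w| ≤ M := by simpa only [abs_neg] using hM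
  refine le_of_forall_pos_le_add fun c hc => ?_
  obtain ⟨q, hq, h1, h2⟩ := (hz.and_eventually ((eventually_lt_of_upperLimit_lt hM
    (lt_add_of_pos_right _ (half_pos hc))).and (eventually_lt_of_upperLimit_lt hM'
    (lt_add_of_pos_right _ (half_pos hc))))).exists
  have h1 := h1 hq
  have h2 := h2 hq
  linarith

/-- When the two relaxed limits are opposite, their upper bounds squeeze `f ε` from both sides. -/
theorem eventually_abs_sub_upperLimit_lt (hM : ∀ᶠ ε in 𝓝[>] (0 : ℝ), ∀ w ∈ D ε, |f ε w| ≤ M)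
    {z : Y} (hle : upperLimit D f z + upperLimit D (fun ε w => -f ε w) z ≤ 0) {c : ℝ}
    (hc : 0 < c) :
    ∀ᶠ q in 𝓝[>] (0 : ℝ) ×ˢ 𝓝 z, q.2 ∈ D q.1 → |f q.1 q.2 - upperLimit D f z| < c := by
  have hM' : ∀ᶠ ε in 𝓝[>] (0 : ℝ), ∀ w ∈ D ε, |-f ε w| ≤ M := by simpa only [abs_neg] using hM
  filter_upwards [eventually_lt_of_upperLimit_lt hM (lt_add_of_pos_right _ hc),
    eventually_lt_of_upperLimit_lt hM' (lt_add_of_pos_right _ hc)] with q h1 h2 hq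
  have h1 := h1 hq
  have h2 := h2 hq
  rw [abs_lt]
  constructor <;> linarith

/-- Each relaxed limit is upper semicontinuous, and each is minus the other on `K`. -/
theorem continuousOn_upperLimit (hM : ∀ᶠ ε in 𝓝[>] (0 : ℝ), ∀ w ∈ D ε, |f ε w| ≤ M)
    (hK : ∀ z ∈ K, ∃ᶠ q in 𝓝[>] (0 : ℝ) ×ˢ 𝓝 z, q.2 ∈ D q.1)
    (hle : ∀ z ∈ K, upperLimit D f z + upperLimit D (fun ε w => -f ε w) z ≤ 0) :
    ContinuousOn (upperLimit D f) K := by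
  have hM' : ∀ᶠ ε in 𝓝[>] (0 : ℝ), ∀ w ∈ D ε, |-f ε w| ≤ M := by simpa only [abs_neg] using hM
  refine continuousOn_iff_lower_upperSemicontinuousOn.2
    ⟨?_, upperSemicontinuousOn_upperLimit hM hK⟩
  have h := upperSemicontinuousOn_upperLimit hM' hK
  intro z hz c hc
  have h0 := add_upperLimit_neg_nonneg hM (hK z hz)
  have h1 := hle z hz
  filter_upwards [h z hz (-c) (by linarith), self_mem_nhdsWithin] with w hw hwK
  have h2 := add_upperLimit_neg_nonneg hM (hK w hwK)
  linarith

theorem tendstoUniformlyOn_upperLimit (hM : ∀ᶠ ε in 𝓝[>] (0 : ℝ), ∀ w ∈ D ε, |f ε w| ≤ M)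
    (hKc : IsCompact K) (hK : ∀ z ∈ K, ∃ᶠ q in 𝓝[>] (0 : ℝ) ×ˢ 𝓝 z, q.2 ∈ D q.1)
    (hle : ∀ z ∈ K, upperLimit D f z + upperLimit D (fun ε w => -f ε w) z ≤ 0) {S : Set Y}
    (hSK : S ⊆ K) (hSD : ∀ᶠ ε in 𝓝[>] (0 : ℝ), S ⊆ D ε) :
    TendstoUniformlyOn f (upperLimit D f) (𝓝[>] (0 : ℝ)) S := by
  rw [Metric.tendstoUniformlyOn_iff]
  intro c hc
  have hcont := continuousOn_upperLimit hM hK hle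
  have key : ∀ᶠ ε in 𝓝[>] (0 : ℝ), ∀ z ∈ K, z ∈ K → z ∈ D ε → |f ε z - upperLimit D f z| < c := by
    refine eventually_forall_of_compact (P := fun ε z => z ∈ K → z ∈ D ε →
      |f ε z - upperLimit D f z| < c) hKc fun z hz => ?_
    have h1 := eventually_abs_sub_upperLimit_lt hM (hle z hz) (half_pos hc)
    have h2 := (Metric.continuousWithinAt_iff'.1 (hcont z hz)) (c / 2) (half_pos hc)
    rw [eventually_nhdsWithin_iff] at h2
    filter_upwards [h1, h2.prod_inr (𝓝[>] (0 : ℝ))] with q h1 h2 hqK hqD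
    have h1 := h1 hqD
    have h2 := h2 hqK
    rw [Real.dist_eq] at h2
    have := abs_sub_le (f q.1 q.2) (upperLimit D f z) (upperLimit D f q.2)
    rw [abs_sub_comm (upperLimit D f z)] at this
    linarith
  filter_upwards [key, hSD] with ε h1 h2 z hz
  rw [dist_comm, Real.dist_eq]
  exact h1 z (hSK hz) (hSK hz) (h2 hz)

end RelaxedLimits

theorem obstacle_le_gameDomain {Ω : Set (𝔼 n)} {T p ε₀ : ℝ} {F ψ : SpaceTime n → ℝ}
    {u : ℝ → SpaceTime n → ℝ} (hu : ∀ ε, 0 < ε → ε ≤ ε₀ → IsDPPSolution Ω T p F ψ ε (u ε))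
    (hψF : ∀ z ∈ parabolicStrip Ω T ε₀, ψ z ≤ F z) {ε : ℝ} (h0 : 0 < ε) (h1 : ε ≤ ε₀) :
    ∀ z ∈ gameDomain Ω T ε, ψ z ≤ u ε z := by
  rintro z (hz | hz)
  · rw [(hu ε h0 h1).eq_max_gameStep hz]
    exact le_max_left _ _
  · rw [(hu ε h0 h1).boundary z hz]
    exact hψF z (parabolicStrip_mono Ω T h0.le h1 hz)

theorem upperLimit_neg_le_obstacle {Ω : Set (𝔼 n)} {T p ε₀ M : ℝ} {F ψ : SpaceTime n → ℝ}
    {u : ℝ → SpaceTime n → ℝ} (hε₀ : 0 < ε₀)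
    (hu : ∀ ε, 0 < ε → ε ≤ ε₀ → IsDPPSolution Ω T p F ψ ε (u ε))
    (hM : ∀ ε, 0 < ε → ε ≤ ε₀ → ∀ z ∈ gameDomain Ω T ε, |u ε z| ≤ M)
    (hψF : ∀ z ∈ parabolicStrip Ω T ε₀, ψ z ≤ F z) (hψ : Continuous ψ) {z : SpaceTime n}
    (hz : z ∈ closure (cylinder Ω T)) :
    upperLimit (gameDomain Ω T) (fun ε w => -u ε w) z ≤ -ψ z := by
  have hMev : ∀ᶠ ε in 𝓝[>] (0 : ℝ), ∀ w ∈ gameDomain Ω T ε, |-u ε w| ≤ M :=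
    (isGameSubsolution_neg_of_dpp hu hM 0).eventually_bounded hε₀
  refine le_of_forall_pos_le_add fun c hc => ?_
  refine upperLimit_le_of_eventually hMev (frequently_mem_gameDomain hz) ?_
  have h1 : ∀ᶠ w in 𝓝 z, ψ z - c < ψ w := (hψ.tendsto z).eventually (lt_mem_nhds (by linarith))
  filter_upwards [h1.prod_inr (𝓝[>] (0 : ℝ)), (eventually_Ioc_zero hε₀).prod_inl (𝓝 z)]
    with q h1 h2 hq
  have := obstacle_le_gameDomain hu hψF h2.1 h2.2 q.2 hq
  linarith

end TugOfWar

end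

noncomputable section

namespace TugOfWar

variable {n : ℕ}

local notation "𝔼" n => EuclideanSpace ℝ (Fin n)

/-! ### Test functions with vanishing gradient -/

/-- Away from its base point the test function still has kinks in time; the triangle inequality
charges them to the time error `κ = 2 * η` of the superjet. -/
theorem hasSuperjet_jetTest {z w : SpaceTime n} {a η : ℝ} (hη : 0 < η) (g : 𝔼 n)
    (X : (𝔼 n) →L[ℝ] (𝔼 n) →L[ℝ] ℝ) (K : Set (SpaceTime n)) :
    HasSuperjet (jetTest z 0 a g X (2 * η)) K w (2 * η) a (quadGradient g X η (w.1 - z.1))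
      (shiftBilin X (4 * η)) := by
  refine fun η' hη' => Eventually.of_forall fun y => ?_
  rw [inner_quadGradient]
  simp only [jetTest]
  set d := w.1 - z.1 with hd
  set h := y.1 - w.1 with hh
  rw [show y.1 - z.1 = d + h by rw [hd, hh]; abel]
  have h1 : |y.2 - z.2| ≤ |y.2 - w.2| + |w.2 - z.2| := abs_sub_le _ _ _
  have h2 := mul_le_mul_of_nonneg_left h1 (by positivity : 0 ≤ 2 * η)
  have h3 : 0 ≤ η' * (‖h‖ ^ 2 + |y.2 - w.2|) := by positivity
  rw [norm_add_sq_real]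
  simp only [map_add, inner_add_right, _root_.add_apply, shiftBilin_apply,
    real_inner_self_eq_norm_sq]
  linarith

theorem jetTest_gradient (z w : SpaceTime n) (κ a : ℝ) (g : 𝔼 n)
    (X : (𝔼 n) →L[ℝ] (𝔼 n) →L[ℝ] ℝ) (η : ℝ) :
    jetTest z κ a g X η w = jetTest z κ a 0 X η w + inner ℝ g (w.1 - z.1) := by
  simp only [jetTest, inner_zero_left]
  ring

section Limit

variable {Ω : Set (𝔼 n)} {T p ε₀ M : ℝ} {F ψ : SpaceTime n → ℝ} {f : ℝ → SpaceTime n → ℝ}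

theorem notMem_parabolicBoundary (hΩ : IsOpen Ω) {z : SpaceTime n} (hz : z ∈ cylinder Ω T) :
    z ∉ parabolicBoundary Ω T := by
  rintro (⟨h, -⟩ | ⟨-, h⟩)
  · rw [hΩ.frontier_eq] at h
    exact h.2 hz.1
  · exact hz.2.1.ne' h

/-- A negative bound `l` is out of reach at zero gradient. Tilting the test function by a small `q`
moves the maximum to a nearby `w`, where negative definiteness keeps the gradient from vanishing, so
the nonzero-gradient inequality applies at `w`. -/
theorem IsGameSubsolution.jet_gradient_zero_aux (hf : IsGameSubsolution Ω T p ε₀ M F ψ f)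
    (hn : 0 < n) (hp : 2 ≤ p) (hΩ : IsOpen Ω) (hT : 0 < T) (hfr : (frontier Ω).Nonempty)
    (hε₀ : 0 < ε₀) (hψ : Continuous ψ) (hF : ContinuousOn F (parabolicStrip Ω T ε₀))
    {z : SpaceTime n} (hz : z ∈ cylinder Ω T) {a : ℝ} {X : (𝔼 n) →L[ℝ] (𝔼 n) →L[ℝ] ℝ}
    (hjet : HasSuperjet (upperLimit (gameDomain Ω T) f) (closure (cylinder Ω T)) z 0 a 0 X)
    (hzψ : ψ z < upperLimit (gameDomain Ω T) f z) {l : ℝ} (hl : ∀ h, X h h ≤ l * ‖h‖ ^ 2)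
    {κ : ℝ} (hκ : 0 < κ) (hκl : l + 4 * κ < 0) :
    (n + p) * (a - 2 * κ) ≤ (p - 2) * (l + 4 * κ) + (bilinTrace X + 4 * κ * n) := by
  set u := upperLimit (gameDomain Ω T) f with hu
  set K := closure (cylinder Ω T) with hK
  have husc : UpperSemicontinuousOn u K :=
    upperSemicontinuousOn_upperLimit (hf.eventually_bounded hε₀)
      fun w hw => frequently_mem_gameDomain hw
  set d := u z - ψ z with hd
  have hd0 : 0 < d := sub_pos.2 hzψ
  have hopen : IsOpen (cylinder Ω T) := hΩ.prod isOpen_Ioo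
  have h1 := hjet κ hκ
  rw [eventually_nhdsWithin_iff] at h1
  have h2 : ∀ᶠ w in 𝓝 z, ψ w < ψ z + d / 4 :=
    (hψ.tendsto z).eventually (gt_mem_nhds (by linarith))
  have h3 : ∀ᶠ w in 𝓝 z, -(d / 4) < jetTest z 0 a 0 X (2 * κ) w :=
    ((continuous_jetTest z 0 a 0 X (2 * κ)).tendsto z).eventually
      (lt_mem_nhds (by rw [jetTest_self]; linarith))
  obtain ⟨r₀, hr₀, hball⟩ := Metric.eventually_nhds_iff.1
    (h1.and ((show ∀ᶠ w in 𝓝 z, w ∈ cylinder Ω T from hopen.mem_nhds hz).and (h2.and h3)))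
  obtain ⟨r, hr, hrr₀, hr1⟩ : ∃ r > 0, r < r₀ ∧ r ≤ 1 :=
    ⟨min (r₀ / 2) 1, by positivity, (min_le_left _ _).trans_lt (by linarith), min_le_right _ _⟩
  -- The bound `d / 4` keeps the obstacle inactive at the shifted maximum; `κ * r` keeps that
  -- maximum in the interior of the ball.
  obtain ⟨s, hs, hsd, hsκ⟩ : ∃ s > 0, s ≤ d / 4 ∧ s < κ * r :=
    ⟨min (d / 4) (κ * r / 2), by positivity, min_le_left _ _,
      (min_le_right _ _).trans_lt (by have : 0 < κ * r := by positivity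
                                      linarith)⟩
  set q : 𝔼 n := EuclideanSpace.single ⟨0, hn⟩ s with hq
  have hqs : ‖q‖ = s := by simp [hq, abs_of_pos hs]
  have hq0 : q ≠ 0 := norm_pos_iff.1 (by rw [hqs]; exact hs)
  have hBK : Metric.closedBall z r ⊆ K := fun w hw =>
    subset_closure (hball (lt_of_le_of_lt hw hrr₀)).2.1
  obtain ⟨w, hwB, hmax⟩ := ((husc.mono hBK).add
    ((continuous_jetTest z 0 a q X (2 * κ)).neg.upperSemicontinuous.upperSemicontinuousOn _)
    ).exists_isMaxOn ⟨z, Metric.mem_closedBall_self hr.le⟩ (isCompact_closedBall z r)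
  have hmax' : ∀ y ∈ Metric.closedBall z r,
      u y - jetTest z 0 a q X (2 * κ) y ≤ u w - jetTest z 0 a q X (2 * κ) w := by
    intro y hy
    have : u y + -jetTest z 0 a q X (2 * κ) y ≤ u w + -jetTest z 0 a q X (2 * κ) w := hmax hy
    linarith
  obtain ⟨hw1, hwc, hw2, hw3⟩ := hball (lt_of_le_of_lt hwB hrr₀)
  have hwK : w ∈ K := subset_closure hwc
  have hz1 := hmax' z (Metric.mem_closedBall_self hr.le)
  rw [jetTest_self, sub_zero] at hz1
  have hw1 := hw1 hwK
  have hgr := jetTest_gradient z w 0 a q X (2 * κ)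
  set h := w.1 - z.1 with hh
  have hcs : |inner ℝ q h| ≤ s * ‖h‖ := by
    rw [← hqs]
    exact abs_real_inner_le_norm q h
  have hcs' := abs_le.1 hcs
  have hjt : jetTest z 0 a 0 X (2 * κ) w = a * (w.2 - z.2) + 1 / 2 * X h h +
      2 * κ * (‖h‖ ^ 2 + |w.2 - z.2|) := by
    simp [jetTest, hh]
  have hnn : 0 ≤ κ * (‖h‖ ^ 2 + |w.2 - z.2|) := by positivity
  simp only [inner_zero_left, zero_mul, add_zero] at hw1
  have hkey : κ * (‖h‖ ^ 2 + |w.2 - z.2|) ≤ -inner ℝ q h := by linarith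
  have habs := abs_nonneg (w.2 - z.2)
  have hhr : ‖h‖ < r := by
    by_contra! hge
    have e1 : κ * ‖h‖ ^ 2 ≤ s * ‖h‖ := by
      have := mul_nonneg hκ.le habs
      linarith
    have hpos : 0 < ‖h‖ := hr.trans_le hge
    have e2 : κ * ‖h‖ ≤ s := by
      refine le_of_mul_le_mul_right ?_ hpos
      linarith
    have e3 := mul_le_mul_of_nonneg_left hge hκ.le
    linarith
  have htr : |w.2 - z.2| < r := by
    have e1 : κ * |w.2 - z.2| ≤ s * ‖h‖ := by
      have : 0 ≤ κ * ‖h‖ ^ 2 := by positivity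
      linarith
    have e2 : s * ‖h‖ ≤ s * 1 := by
      gcongr
      linarith
    have e3 : κ * |w.2 - z.2| < κ * r := by linarith
    exact lt_of_mul_lt_mul_left e3 hκ.le
  have hwball : Metric.closedBall z r ∈ 𝓝 w := by
    refine mem_of_superset (Metric.isOpen_ball.mem_nhds (x := w) (s := Metric.ball z r) ?_)
      Metric.ball_subset_closedBall
    rw [Metric.mem_ball, Prod.dist_eq, max_lt_iff, dist_eq_norm, Real.dist_eq]
    exact ⟨hhr, htr⟩
  have hjw : HasSuperjet u K w (2 * κ) a (quadGradient q X κ h) (shiftBilin X (4 * κ)) :=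
    HasSuperjet.of_isMaxOn_sub (mem_nhdsWithin_of_mem_nhds (mem_of_superset hwball hmax'))
      (hasSuperjet_jetTest hκ q X K)
  -- At `h = 0` the gradient is `q`. Otherwise `hkey` gives `⟨q, h⟩ ≤ 0`, and pairing the gradient
  -- with `h` yields at most `(l + 4 * κ) * ‖h‖ ^ 2 < 0`.
  have hg0 : quadGradient q X κ h ≠ 0 := by
    rcases eq_or_ne h 0 with h0 | h0
    · rw [h0, quadGradient_zero]
      exact hq0
    · intro hcon
      have e1 := inner_quadGradient q X κ h h
      rw [hcon, inner_zero_left, real_inner_self_eq_norm_sq] at e1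
      have e2 := hl h
      have e3 : 0 < ‖h‖ ^ 2 := by
        have := norm_pos_iff.2 h0
        positivity
      have e4 : (l + 4 * κ) * ‖h‖ ^ 2 < 0 := mul_neg_of_neg_of_pos hκl e3
      nlinarith
  have huw : ψ w < u w := by
    have e1 : s * ‖h‖ ≤ s * 1 := by
      gcongr
      linarith
    linarith
  rcases hf.upperLimit_jet hp hΩ hT hfr hε₀ hψ hF hwK (by positivity) hjw with hc | ⟨hc, -⟩ | hc
  · exact absurd huw (not_lt.2 hc)
  · exact absurd hc (notMem_parabolicBoundary hΩ hwc)
  · refine (hc.1 hg0).trans ?_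
    rw [bilinTrace_shiftBilin]
    refine add_le_add (mul_le_mul_of_nonneg_left ?_ (by linarith)) le_rfl
    have hpos := norm_pos_iff.2 hg0
    rw [div_le_iff₀ (by positivity), shiftBilin_apply, real_inner_self_eq_norm_sq]
    have := hl (quadGradient q X κ h)
    linarith

/-- At superjets with vanishing gradient the inequality holds with any upper bound of the
second-order part. -/
theorem IsGameSubsolution.jet_gradient_zero (hf : IsGameSubsolution Ω T p ε₀ M F ψ f)
    (hn : 0 < n) (hp : 2 ≤ p) (hΩ : IsOpen Ω) (hT : 0 < T) (hfr : (frontier Ω).Nonempty)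
    (hε₀ : 0 < ε₀) (hψ : Continuous ψ) (hF : ContinuousOn F (parabolicStrip Ω T ε₀))
    {z : SpaceTime n} (hz : z ∈ cylinder Ω T) {a : ℝ} {X : (𝔼 n) →L[ℝ] (𝔼 n) →L[ℝ] ℝ}
    (hjet : HasSuperjet (upperLimit (gameDomain Ω T) f) (closure (cylinder Ω T)) z 0 a 0 X)
    (hzψ : ψ z < upperLimit (gameDomain Ω T) f z) {l : ℝ} (hl : ∀ h, X h h ≤ l * ‖h‖ ^ 2) :
    (n + p) * a ≤ (p - 2) * l + bilinTrace X := by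
  rcases le_or_gt 0 l with h0 | h0
  · rcases hf.upperLimit_jet hp hΩ hT hfr hε₀ hψ hF (subset_closure hz) le_rfl hjet
      with hc | ⟨hc, -⟩ | hc
    · exact absurd hzψ (not_lt.2 hc)
    · exact absurd hc (notMem_parabolicBoundary hΩ hz)
    · have := hc.2 rfl l h0 hl
      rwa [sub_zero] at this
  · have hlim : Tendsto (fun κ : ℝ => (n + p) * (a - 2 * κ)) (𝓝[>] 0) (𝓝 ((n + p) * a)) := by
      have : Tendsto (fun κ : ℝ => (n + p) * (a - 2 * κ)) (𝓝 0) (𝓝 ((n + p) * (a - 2 * 0))) :=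
        (by fun_prop : Continuous fun κ : ℝ => (n + p) * (a - 2 * κ)).tendsto 0
      rw [mul_zero, sub_zero] at this
      exact this.mono_left nhdsWithin_le_nhds
    have hlim' : Tendsto (fun κ : ℝ => (p - 2) * (l + 4 * κ) + (bilinTrace X + 4 * κ * n))
        (𝓝[>] 0) (𝓝 ((p - 2) * l + bilinTrace X)) := by
      have : Tendsto (fun κ : ℝ => (p - 2) * (l + 4 * κ) + (bilinTrace X + 4 * κ * n)) (𝓝 0)
          (𝓝 ((p - 2) * (l + 4 * 0) + (bilinTrace X + 4 * 0 * n))) :=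
        (by fun_prop : Continuous fun κ : ℝ =>
          (p - 2) * (l + 4 * κ) + (bilinTrace X + 4 * κ * n)).tendsto 0
      simp only [mul_zero, zero_mul, add_zero] at this
      exact this.mono_left nhdsWithin_le_nhds
    refine le_of_tendsto_of_tendsto hlim hlim' ?_
    have hsmall : ∀ᶠ κ : ℝ in 𝓝[>] 0, κ < -l / 4 :=
      mem_nhdsWithin_of_mem_nhds (gt_mem_nhds (by linarith))
    filter_upwards [self_mem_nhdsWithin, hsmall] with κ hκ hκl
    exact hf.jet_gradient_zero_aux hn hp hΩ hT hfr hε₀ hψ hF hz hjet hzψ hl hκ (by linarith)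

end Limit

end TugOfWar

end

noncomputable section

namespace TugOfWar

variable {n : ℕ}

local notation "𝔼" n => EuclideanSpace ℝ (Fin n)

/-! ### Extreme eigenvalues -/

theorem bilin_apply_right_eq_sum (B : (𝔼 n) →L[ℝ] (𝔼 n) →L[ℝ] ℝ) (h k : 𝔼 n) :
    B h k = ∑ i, B h (EuclideanSpace.single i 1) * k i := by
  have e : k = ∑ i, k i • EuclideanSpace.single i (1 : ℝ) := by
    ext j
    simp [Finset.sum_apply, Pi.single_apply]
  conv_lhs => rw [e, map_sum]
  exact Finset.sum_congr rfl fun i _ => by rw [map_smul, smul_eq_mul, mul_comm]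

/-- The supremum of the Rayleigh quotient of a symmetric operator is an eigenvalue. Finiteness of
the spectrum makes the `sSup` in `lambdaMax` genuine. -/
theorem bilin_le_lambdaMax (hn : 0 < n) {B : (𝔼 n) →L[ℝ] (𝔼 n) →L[ℝ] ℝ}
    (hB : ∀ h k, B h k = B k h) (h : 𝔼 n) :
    B h h ≤ lambdaMax (Matrix.of fun i j => B (EuclideanSpace.single i 1)
      (EuclideanSpace.single j 1)) * ‖h‖ ^ 2 := by
  set A : Matrix (Fin n) (Fin n) ℝ := Matrix.of fun i j => B (EuclideanSpace.single i 1)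
      (EuclideanSpace.single j 1) with hA
  have : Nontrivial (𝔼 n) := by
    have : Nonempty (Fin n) := ⟨⟨0, hn⟩⟩
    infer_instance
  have hherm : A.IsHermitian := by
    ext i j
    simp [hA, hB]
  have hsymm := Matrix.isSymmetric_toEuclideanLin_iff.2 hherm
  set T := Matrix.toEuclideanLin A with hT
  have hinner : ∀ x, inner ℝ (T x) x = B x x := by
    intro x
    have e1 : ∀ i, (T x) i = B (EuclideanSpace.single i 1) x := by
      intro i
      rw [bilin_apply_right_eq_sum B _ x]
      rfl
    rw [bilin_apply_right_eq_sum B x x, PiLp.inner_apply]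
    refine Finset.sum_congr rfl fun i _ => ?_
    rw [e1, hB]
    simp [mul_comm]
  set μ₀ : ℝ := ⨆ x : {x : 𝔼 n // x ≠ 0}, RCLike.re (inner ℝ (T x) x) / ‖(x : 𝔼 n)‖ ^ 2 with hμ₀
  have heig : Module.End.HasEigenvalue T μ₀ := hsymm.hasEigenvalue_iSup_of_finiteDimensional
  have heig' : Module.End.HasEigenvalue (Matrix.toLin' A) μ₀ := by
    obtain ⟨v, hv⟩ := heig.exists_hasEigenvector
    refine Module.End.hasEigenvalue_of_hasEigenvector (x := v.ofLp)
      ⟨Module.End.mem_eigenspace_iff.2 ?_, fun h0 => hv.2 ?_⟩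
    · have := congrArg WithLp.ofLp hv.apply_eq_smul
      exact this
    · ext i
      exact congrFun h0 i
  have hle : μ₀ ≤ lambdaMax A :=
    le_csSup (Module.End.finite_hasEigenvalue (Matrix.toLin' A)).bddAbove heig'
  rcases eq_or_ne h 0 with rfl | h0
  · simp
  have hpos := norm_pos_iff.2 h0
  have hbdd : BddAbove (range fun x : {x : 𝔼 n // x ≠ 0} =>
      RCLike.re (inner ℝ (T x) (x : 𝔼 n)) / ‖(x : 𝔼 n)‖ ^ 2) := by
    refine ⟨‖B‖, ?_⟩
    rintro _ ⟨⟨x, hx⟩, rfl⟩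
    have hx' := norm_pos_iff.2 hx
    simp only [RCLike.re_to_real, hinner]
    rw [div_le_iff₀ (by positivity), sq, ← mul_assoc]
    exact (le_abs_self _).trans (B.le_opNorm₂ x x)
  have := le_ciSup hbdd ⟨h, h0⟩
  simp only [RCLike.re_to_real, hinner] at this
  rw [div_le_iff₀ (by positivity)] at this
  refine this.trans (mul_le_mul_of_nonneg_right ?_ (by positivity))
  simpa only [hμ₀, RCLike.re_to_real, hinner] using hle

theorem lambdaMax_neg (A : Matrix (Fin n) (Fin n) ℝ) : lambdaMax (-A) = -lambdaMin A := by
  have : {μ : ℝ | Module.End.HasEigenvalue (Matrix.toLin' (-A)) μ} =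
      -{μ : ℝ | Module.End.HasEigenvalue (Matrix.toLin' A) μ} := by
    have key : ∀ (C : Matrix (Fin n) (Fin n) ℝ) (μ : ℝ),
        Module.End.HasEigenvalue (Matrix.toLin' C) μ →
          Module.End.HasEigenvalue (Matrix.toLin' (-C)) (-μ) := by
      intro C μ h
      obtain ⟨v, hv⟩ := h.exists_hasEigenvector
      refine Module.End.hasEigenvalue_of_hasEigenvector (x := v)
        ⟨Module.End.mem_eigenspace_iff.2 ?_, hv.2⟩
      rw [map_neg, LinearMap.neg_apply, hv.apply_eq_smul, neg_smul]
    ext μ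
    rw [Set.mem_neg, mem_ofPred_eq, mem_ofPred_eq]
    refine ⟨fun h => ?_, fun h => ?_⟩
    · simpa using key _ _ h
    · simpa using key _ _ h
  rw [lambdaMax, lambdaMin, this, Real.sSup_neg]

/-! ### Derivatives of test functions -/

theorem timeDeriv_neg (φ : SpaceTime n → ℝ) : timeDeriv (fun w => -φ w) = fun z => -timeDeriv φ z := by
  funext z
  exact deriv.fun_neg

theorem spaceGradient_neg (φ : SpaceTime n → ℝ) :
    spaceGradient (fun w => -φ w) = fun z => -spaceGradient φ z := by
  funext z
  simp [spaceGradient, gradient, fderiv_fun_neg]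

theorem spaceHessian_neg (φ : SpaceTime n → ℝ) :
    spaceHessian (fun w => -φ w) = fun z => -spaceHessian φ z := by
  funext z
  have : (fderiv ℝ fun y => -φ (y, z.2)) = fun x => -fderiv ℝ (fun y => φ (y, z.2)) x := by
    funext x
    exact fderiv_fun_neg
  rw [spaceHessian, this]
  exact fderiv_fun_neg

theorem hessianMatrix_neg (φ : SpaceTime n → ℝ) (z : SpaceTime n) :
    hessianMatrix (fun w => -φ w) z = -hessianMatrix φ z := by
  ext i j
  simp [hessianMatrix, spaceHessian_neg]

theorem _root_.ContinuousOn.fun_neg_normed {Y E : Type*} [TopologicalSpace Y]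
    [NormedAddCommGroup E] {g : Y → E} {s : Set Y} (hg : ContinuousOn g s) :
    ContinuousOn (fun y => -g y) s := hg.neg

theorem IsC21On.neg {φ : SpaceTime n → ℝ} {U : Set (SpaceTime n)} (hφ : IsC21On φ U) :
    IsC21On (fun w => -φ w) U where
  contDiffAt_space z hz := (hφ.contDiffAt_space z hz).neg
  differentiableAt_time z hz := (hφ.differentiableAt_time z hz).neg
  continuousOn := hφ.continuousOn.neg
  continuousOn_gradient := by
    rw [spaceGradient_neg]
    exact hφ.continuousOn_gradient.neg
  continuousOn_hessian := by
    rw [spaceHessian_neg]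
    exact ContinuousOn.fun_neg_normed (E := (𝔼 n) →L[ℝ] (𝔼 n) →L[ℝ] ℝ) hφ.continuousOn_hessian
  continuousOn_timeDeriv := by
    rw [timeDeriv_neg]
    exact hφ.continuousOn_timeDeriv.neg

theorem SubsolutionIneq.of_neg {p : ℝ} {φ : SpaceTime n → ℝ} {z : SpaceTime n}
    (h : SubsolutionIneq p (fun w => -φ w) z) : SupersolutionIneq p φ z := by
  have hL : spaceLaplacian (fun w => -φ w) z = -spaceLaplacian φ z := by
    rw [spaceLaplacian, hessianMatrix_neg, Matrix.trace_neg, spaceLaplacian]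
  have hI : infinityLaplacian (fun w => -φ w) z = -infinityLaplacian φ z := by
    simp [infinityLaplacian, spaceGradient_neg, spaceHessian_neg, neg_div]
  rw [SubsolutionIneq, hL, hI, hessianMatrix_neg, lambdaMax_neg, spaceGradient_neg,
    timeDeriv_neg] at h
  refine ⟨fun h0 => ?_, fun h0 => ?_⟩
  · have := h.1 (neg_ne_zero.2 h0)
    linarith
  · have := h.2 (neg_eq_zero.2 h0)
    linarith

theorem spaceLaplacian_eq (φ : SpaceTime n → ℝ) (z : SpaceTime n) :
    spaceLaplacian φ z = bilinTrace (spaceHessian φ z) := rfl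

theorem IsC21On.hessian_symm {φ : SpaceTime n → ℝ} {U : Set (SpaceTime n)} (hφ : IsC21On φ U)
    {z : SpaceTime n} (hz : z ∈ U) (h k : 𝔼 n) :
    spaceHessian φ z h k = spaceHessian φ z k h :=
  (hφ.contDiffAt_space z hz).isSymmSndFDerivAt (by simp) h k

/-- The increment is split at `(w.1, z.2)`: the mean value inequality with the continuous time
derivative handles the time part, and Taylor expansion on the slice at time `z.2` the space part. -/
theorem IsC21On.hasSuperjet {φ : SpaceTime n → ℝ} {U : Set (SpaceTime n)} (hφ : IsC21On φ U)
    (hU : IsOpen U) {z : SpaceTime n} (hz : z ∈ U) (K : Set (SpaceTime n)) :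
    HasSuperjet φ K z 0 (timeDeriv φ z) (spaceGradient φ z) (spaceHessian φ z) := by
  intro η hη
  refine Eventually.filter_mono (nhdsWithin_le_nhds (s := K) (a := z)) ?_
  have htime : ∀ᶠ w in 𝓝 z, w ∈ U ∧ |timeDeriv φ w - timeDeriv φ z| < η := by
    refine (show ∀ᶠ w in 𝓝 z, w ∈ U from hU.mem_nhds hz).and ?_
    exact ((hφ.continuousOn_timeDeriv z hz).continuousAt (hU.mem_nhds hz)).eventually
      (Metric.ball_mem_nhds _ hη)
  obtain ⟨r, hr, hball⟩ := Metric.eventually_nhds_iff_ball.1 htime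
  have hC2 := hφ.contDiffAt_space z hz
  have hdiff : ∀ᶠ x in 𝓝 z.1, HasFDerivAt (fun y => φ (y, z.2))
      (fderiv ℝ (fun y => φ (y, z.2)) x) x := by
    filter_upwards [hC2.eventually (by simp)] with x hx
    exact (hx.differentiableAt (by simp)).hasFDerivAt
  have hdiff2 : HasFDerivAt (fderiv ℝ fun y => φ (y, z.2)) (spaceHessian φ z) z.1 :=
    ((hC2.fderiv_right (m := 1) (by norm_num)).differentiableAt (by simp)).hasFDerivAt
  have htaylor := taylor_two_of_hasFDerivAt hdiff hdiff2 hη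
  have t1 : Tendsto (fun w : SpaceTime n => w.1 - z.1) (𝓝 z) (𝓝 0) := by
    have : Tendsto (fun w : SpaceTime n => w.1 - z.1) (𝓝 z) (𝓝 (z.1 - z.1)) :=
      (by fun_prop : Continuous fun w : SpaceTime n => w.1 - z.1).tendsto z
    rwa [sub_self] at this
  filter_upwards [t1.eventually htaylor, Metric.ball_mem_nhds z hr] with w h1 hw
  have h2 : φ w - φ (w.1, z.2) ≤ timeDeriv φ z * (w.2 - z.2) + η * |w.2 - z.2| := by
    have hmem : ∀ s ∈ Metric.ball z.2 r, (w.1, s) ∈ Metric.ball z r := by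
      intro s hs
      rw [Metric.mem_ball, Prod.dist_eq, max_lt_iff] at hw ⊢
      exact ⟨hw.1, hs⟩
    have hder : ∀ s ∈ Metric.ball z.2 r, HasDerivWithinAt
        (fun s => φ (w.1, s) - timeDeriv φ z * s) (timeDeriv φ (w.1, s) - timeDeriv φ z)
        (Metric.ball z.2 r) s := by
      intro s hs
      have e1 := (hφ.differentiableAt_time _ (hball _ (hmem s hs)).1).hasDerivAt
      have e2 := (hasDerivAt_id s).const_mul (timeDeriv φ z)
      rw [mul_one] at e2
      exact (e1.sub e2).hasDerivWithinAt
    have hw2 : w.2 ∈ Metric.ball z.2 r := by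
      rw [Metric.mem_ball, Prod.dist_eq, max_lt_iff] at hw
      exact hw.2
    have := (convex_ball z.2 r).norm_image_sub_le_of_norm_hasDerivWithin_le hder
      (fun s hs => (hball _ (hmem s hs)).2.le) (Metric.mem_ball_self hr) hw2
    rw [Real.norm_eq_abs, Real.norm_eq_abs] at this
    have := (abs_le.1 this).2
    simp only [Prod.mk.eta] at this
    linarith
  have h3 := (abs_le.1 h1).2
  have h4 : fderiv ℝ (fun y => φ (y, z.2)) z.1 (w.1 - z.1) =
      inner ℝ (spaceGradient φ z) (w.1 - z.1) := by
    rw [spaceGradient, gradient, InnerProductSpace.toDual_symm_apply]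
  rw [h4, add_sub_cancel] at h3
  simp only [Prod.mk.eta] at h3
  linarith

section Limit

variable {Ω : Set (𝔼 n)} {T p ε₀ M : ℝ} {F ψ : SpaceTime n → ℝ} {f : ℝ → SpaceTime n → ℝ}

theorem IsGameSubsolution.subsolutionIneq (hf : IsGameSubsolution Ω T p ε₀ M F ψ f)
    (hn : 0 < n) (hp : 2 ≤ p) (hΩ : IsOpen Ω) (hT : 0 < T) (hfr : (frontier Ω).Nonempty)
    (hε₀ : 0 < ε₀) (hψ : Continuous ψ) (hF : ContinuousOn F (parabolicStrip Ω T ε₀))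
    {z : SpaceTime n} (hz : z ∈ cylinder Ω T) {φ : SpaceTime n → ℝ} {U : Set (SpaceTime n)}
    (hU : IsOpen U) (hzU : z ∈ U) (hφ : IsC21On φ U)
    (hmax : ∀ᶠ w in 𝓝[closure (cylinder Ω T)] z, upperLimit (gameDomain Ω T) f w - φ w ≤
      upperLimit (gameDomain Ω T) f z - φ z) (hzψ : ψ z < upperLimit (gameDomain Ω T) f z) :
    SubsolutionIneq p φ z := by
  have hjet := HasSuperjet.of_isMaxOn_sub hmax (hφ.hasSuperjet hU hzU _)
  rw [SubsolutionIneq, spaceLaplacian_eq]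
  refine ⟨fun h0 => ?_, fun h0 => ?_⟩
  · rcases hf.upperLimit_jet hp hΩ hT hfr hε₀ hψ hF (subset_closure hz) le_rfl hjet
      with hc | ⟨hc, -⟩ | hc
    · exact absurd hzψ (not_lt.2 hc)
    · exact absurd hc (notMem_parabolicBoundary hΩ hz)
    · have := hc.1 h0
      rwa [sub_zero] at this
  · rw [h0] at hjet
    exact hf.jet_gradient_zero hn hp hΩ hT hfr hε₀ hψ hF hz hjet hzψ
      (bilin_le_lambdaMax hn (hφ.hessian_symm hzU))

end Limit

end TugOfWar

end

/-! ### The convergence theorem -/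

namespace TugOfWar

/-- Solutions of the dynamic programming principle converge uniformly to a viscosity solution. -/
theorem exists_viscositySolution {n : ℕ} (hn : 0 < n) {p : ℝ} (hp : 2 ≤ p)
    {Ω : Set (EuclideanSpace ℝ (Fin n))} (hΩ : IsOpen Ω) (hne : Ω.Nonempty)
    (hb : Bornology.IsBounded Ω) (hext : ExteriorSphereCondition Ω)
    {T : ℝ} (hT : 0 < T) {ε₀ : ℝ} (hε₀ : 0 < ε₀) {F ψ : SpaceTime n → ℝ} {C₁ C₂ : ℝ}
    (hF : ParabolicLipschitzOn C₁ F (parabolicStrip Ω T ε₀))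
    (hψ : ParabolicLipschitzOn C₂ ψ univ) (hψF : ∀ z ∈ parabolicStrip Ω T ε₀, ψ z ≤ F z)
    {u : ℝ → SpaceTime n → ℝ}
    (hu : ∀ ε : ℝ, 0 < ε → ε ≤ ε₀ → IsDPPSolution Ω T p F ψ ε (u ε)) :
    TendstoUniformlyOn u (upperLimit (gameDomain Ω T) u) (𝓝[>] (0 : ℝ))
        (cylinder Ω T ∪ parabolicBoundary Ω T) ∧
      IsViscositySolution Ω T p F ψ (upperLimit (gameDomain Ω T) u) := by
  set K := closure (cylinder Ω T) with hK
  have hfr := frontier_nonempty_of_bounded hn hne hb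
  have hKeq : K = closure Ω ×ˢ Icc 0 T := closure_cylinder Ω hT
  have hKc : IsCompact K := by
    rw [hKeq]
    exact hb.isCompact_closure.prod isCompact_Icc
  have hKt : ∀ z ∈ K, 0 ≤ z.2 ∧ z.2 ≤ T := by
    rw [hKeq]
    exact fun z hz => hz.2
  have hψc : Continuous ψ := continuousOn_univ.1 hψ.continuousOn
  have hFc := hF.continuousOn
  obtain ⟨M, hM0, hMF, hMψ⟩ : ∃ M : ℝ, 0 ≤ M ∧ (∀ z ∈ parabolicStrip Ω T ε₀, |F z| ≤ M) ∧
      ∀ z ∈ cylinder Ω T, |ψ z| ≤ M := by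
    obtain ⟨M₁, h1⟩ := hF.exists_abs_le (isBounded_parabolicStrip hb hfr T ε₀)
    obtain ⟨M₂, h2⟩ := hKc.exists_bound_of_continuousOn hψc.continuousOn
    refine ⟨max 0 (max M₁ M₂), le_max_left _ _, fun z hz => ?_, fun z hz => ?_⟩
    · exact (h1 z hz).trans ((le_max_left _ _).trans (le_max_right _ _))
    · exact (h2 z (subset_closure hz)).trans ((le_max_right _ _).trans (le_max_right _ _))
  have hM : ∀ ε, 0 < ε → ε ≤ ε₀ → ∀ z ∈ gameDomain Ω T ε, |u ε z| ≤ M := fun ε h0 h1 =>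
    (hu ε h0 h1).abs_le hp h0 (fun z hz => hMF z (parabolicStrip_mono Ω T h0.le h1 hz)) hMψ
  have hsub := isGameSubsolution_of_dpp hu hM
  -- The artificial obstacle `-M - 1` lies strictly below `w ≥ -M`, so the obstacle alternative
  -- never occurs for `-u ε`.
  have hsuper := isGameSubsolution_neg_of_dpp hu hM (-M - 1)
  have hev := hsub.eventually_bounded hε₀
  have hev' := hsuper.eventually_bounded hε₀
  have hfreq : ∀ z ∈ K, ∃ᶠ q in 𝓝[>] (0 : ℝ) ×ˢ 𝓝 z, q.2 ∈ gameDomain Ω T q.1 :=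
    fun z hz => frequently_mem_gameDomain hz
  set v := upperLimit (gameDomain Ω T) u with hv
  set w := upperLimit (gameDomain Ω T) (fun ε z => -u ε z) with hw
  have hvΓ : ∀ z ∈ parabolicBoundary Ω T, v z ≤ F z := fun z hz =>
    hsub.upperLimit_le_boundary hp hM0 hΩ hb hext hT hfr hε₀ hψc hFc hz
      (hψF z (parabolicBoundary_subset_strip hΩ T hε₀ hz))
  have hwΓ : ∀ z ∈ parabolicBoundary Ω T, w z ≤ -F z := fun z hz =>
    hsuper.upperLimit_le_boundary hp hM0 hΩ hb hext hT hfr hε₀ continuous_const hFc.neg hz (by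
      have := (abs_le.1 (hMF z (parabolicBoundary_subset_strip hΩ T hε₀ hz))).2
      linarith)
  have hwψ : ∀ z ∈ K, w z ≤ -ψ z := fun z hz => upperLimit_neg_le_obstacle hε₀ hu hM hψF hψc hz
  have hwM : ∀ z ∈ K, -M - 1 < w z := fun z hz => by
    have := (abs_le.1 (abs_upperLimit_le hev' (hfreq z hz))).1
    linarith
  have hle : ∀ z ∈ K, v z + w z ≤ 0 := by
    refine add_nonpos_of_jet_subsolutions hp hKc (isClosed_parabolicBoundary hT) hKt
      (upperSemicontinuousOn_upperLimit hev hfreq) (upperSemicontinuousOn_upperLimit hev' hfreq)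
      hψc (fun z _ hz => by linarith [hvΓ z hz, hwΓ z hz]) hwψ ?_ ?_
    · intro z hz hzΓ a g X hjet
      rcases hsub.upperLimit_jet hp hΩ hT hfr hε₀ hψc hFc hz le_rfl hjet with h | ⟨h, -⟩ | h
      · exact Or.inl h
      · exact absurd h hzΓ
      · exact Or.inr (by rwa [sub_zero] at h)
    · intro z hz hzΓ a g X hjet
      rcases hsuper.upperLimit_jet hp hΩ hT hfr hε₀ continuous_const hFc.neg hz le_rfl hjet
        with h | ⟨h, -⟩ | h
      · exact absurd (hwM z hz) (not_lt.2 h)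
      · exact absurd h hzΓ
      · rwa [sub_zero] at h
  have hge : ∀ z ∈ K, 0 ≤ v z + w z := fun z hz => add_upperLimit_neg_nonneg hev (hfreq z hz)
  have heq : ∀ z ∈ K, w z = -v z := fun z hz => by linarith [hle z hz, hge z hz]
  have hΓK : parabolicBoundary Ω T ⊆ K := parabolicBoundary_subset_closure hT
  have hcylK : cylinder Ω T ⊆ K := subset_closure
  have hnhds : ∀ z ∈ cylinder Ω T, K ∈ 𝓝 z := fun z hz =>
    mem_of_superset ((hΩ.prod isOpen_Ioo).mem_nhds hz) hcylK
  refine ⟨tendstoUniformlyOn_upperLimit hev hKc hfreq hle (union_subset hcylK hΓK) ?_,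
    continuousOn_upperLimit hev hfreq hle, fun z hz => ?_, fun z hz => ?_,
    fun z hz φ U hU hzU hφ hmin => ?_, fun z hz φ U hU hzU hφ hmax => ?_⟩
  · filter_upwards [self_mem_nhdsWithin] with ε hε
    exact union_subset_union_right _ (parabolicBoundary_subset_strip hΩ T hε)
  · have h1 := hwΓ z hz
    rw [heq z (hΓK hz)] at h1
    exact le_antisymm (hvΓ z hz) (by linarith)
  · have h1 := hwψ z (hcylK hz)
    rw [heq z (hcylK hz)] at h1
    linarith
  -- A minimum of `v - φ` is a maximum of `w - (-φ)`, since `w = -v` on `K`.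
  · refine (hsuper.subsolutionIneq hn hp hΩ hT hfr hε₀ continuous_const hFc.neg hz hU hzU hφ.neg
      ?_ (hwM z (hcylK hz))).of_neg
    filter_upwards [nhdsWithin_le_nhds hmin, self_mem_nhdsWithin] with y hy hyK
    have h1 := heq y hyK
    have h2 := heq z (hcylK hz)
    change w y - -φ y ≤ w z - -φ z
    linarith
  -- Contact from below means equality, because `w ≤ -ψ` already gives `ψ ≤ v`.
  · rcases le_or_gt (v z) (ψ z) with h | h
    · refine Or.inl (le_antisymm h ?_)
      have h1 := hwψ z (hcylK hz)
      rw [heq z (hcylK hz)] at h1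
      linarith
    · exact Or.inr (hsub.subsolutionIneq hn hp hΩ hT hfr hε₀ hψc hFc hz hU hzU hφ
        (nhdsWithin_le_nhds hmax) h)

end TugOfWar

theorem theorem4p7 {n : ℕ} (hn : 0 < n) (p : ℝ) (hp : 2 ≤ p)
    (Ω : Set (EuclideanSpace ℝ (Fin n))) (hΩ_open : IsOpen Ω) (hΩ_conn : IsConnected Ω)
    (hΩ_bdd : Bornology.IsBounded Ω) (hΩ_ext : TugOfWar.ExteriorSphereCondition Ω)
    (T : ℝ) (hT : 0 < T) (ε₀ : ℝ) (hε₀ : 0 < ε₀)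
    (F ψ : TugOfWar.SpaceTime n → ℝ) (C₁ C₂ : ℝ)
    (hF : TugOfWar.ParabolicLipschitzOn C₁ F (TugOfWar.parabolicStrip Ω T ε₀))
    (hψ : TugOfWar.ParabolicLipschitzOn C₂ ψ Set.univ)
    (hψF : ∀ z ∈ TugOfWar.parabolicStrip Ω T ε₀, ψ z ≤ F z)
    (u : ℝ → TugOfWar.SpaceTime n → ℝ)
    (hu : ∀ ε : ℝ, 0 < ε → ε ≤ ε₀ → TugOfWar.IsDPPSolution Ω T p F ψ ε (u ε)) :
    ∃ v : TugOfWar.SpaceTime n → ℝ,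
      TendstoUniformlyOn u v (𝓝[>] (0 : ℝ))
        (TugOfWar.cylinder Ω T ∪ TugOfWar.parabolicBoundary Ω T) ∧
      TugOfWar.IsViscositySolution Ω T p F ψ v :=
  ⟨_, TugOfWar.exists_viscositySolution hn hp hΩ_open hΩ_conn.nonempty hΩ_bdd hΩ_ext hT hε₀ hF hψ
    hψF hu⟩
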